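/- All graphs are finite and simple. A partially labeled graph is a graph some of whose vertices carry pairwise distinct labels from $\mathbb{N}$; such graphs are taken without isolated vertices (the empty graph $1$ is allowed) and up to label-preserving isomorphism. The gluing product $AB$ is obtained from the disjoint union of $A$ and $B$ by identifying vertices with the same label and keeping one copy of every doubled edge, and it is extended bilinearly to formal finite real linear combinations (graph combinations); $[[\cdot]]$ denotes the linear map removing all labels. For $d\in\mathbb{N}$, a $d$-sos graph combination is a finite sum $\sum_j[[a_j^2]]$, where every graph occurring in $a_j$ has at most $d$ edges. Let $\mathcal V_d$ be the set of connected unlabeled graphs of the form $[[AB]]$, where $A,B$ are partially labeled graphs with at most $d$ edges each, the graph $1$ being excluded. Every unlabeled graph with all its connected components in $\mathcal V_d$ is regarded as a monomial, namely the product of its components, in variables indexed by $\mathcal V_d$. In this way a $d$-sos graph combination is a polynomial on $\mathbb{R}^{\mathcal V_d}$. Let $$\mathcal S_d=\{\mathbf v\in\mathbb{R}_{\ge 0}^{\mathcal V_d} : a(\mathbf v)\ge 0 \text{ for all } d\text{-sos graph combinations } a\}$$ be the $d$-sos-profile, and for $\mathcal U\subseteq\mathcal V_d$ let $\mathcal S_{\mathcal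 U,d}$ be the image of $\mathcal S_d$ under the coordinate projection $\pi_{\mathcal U}:\mathbb{R}^{\mathcal V_d}\to\mathbb{R}^{\mathcal U}$. Let $\mathcal G_{\mathcal U}\subseteq\mathbb{R}^{\mathcal U}$ be the closure of the set of vectors $(t(C;G))_{C\in\mathcal U}$ of homomorphism densities over all nonempty graphs $G$. Fix a number of labels $\ell\ge 2d$. Let $\tilde{\mathcal M}_d$ be the matrix with entries $[[AB]]$, whose rows and columns are indexed by the partially labeled graphs $A$, $B$ with at most $d$ edges, labels from a fixed set of $\ell$ labels, and no connected component without a label (the graph $1$ included). Let $S^{2\times2}_{\tilde{\mathcal M}_d}$ be the set of all $\mathbf v\in\mathbb{R}_{\ge0}^{\mathcal V_d}$ such that all $2\times2$ principal minors of $\tilde{\mathcal M}_d(\mathbf v)$ are nonnegative. For $S\subseteq\mathbb{R}^s_{\ge0}$ let $\log(S)$ be the image of $S\cap\mathbb{R}^s_{>0}$ under the coordinatewise natural logarithm, and let $\operatorname{trop}(S)=\lim_{\tau\to0}\log_{1/\tau}(S)$ be the set of all limits of sequences $\log_{1/\tau_k}(\mathbf y_k)$ with $\mathbf y_k\in S\cap\mathbb{R}^s_{>0}$,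 $\tau_k\in(0,1)$ and $\tau_k\to0$. Theorem. The set $\mathcal V_d$ is finite. The $d$-sos-profile $\mathcal S_d$ is a basic closed semialgebraic set (defined by finitely many polynomial inequalities $p\ge0$) containing the graph profile $\mathcal G_{\mathcal V_d}$. Its tropicalization is $$\operatorname{trop}(\mathcal S_d)=\log\bigl(S^{2\times2}_{\tilde{\mathcal M}_d}\bigr),$$ and this set is a rational polyhedral cone. Moreover, for every $\mathcal U\subseteq\mathcal V_d$, the $(\mathcal U,d)$-sos-profile $\mathcal S_{\mathcal U,d}$ contains $\mathcal G_{\mathcal U}$, and $$\operatorname{trop}(\mathcal S_{\mathcal U,d})=\pi_{\mathcal U}\bigl(\log(S^{2\times2}_{\tilde{\mathcal M}_d})\bigr),$$ which is again a rational polyhedral cone. -/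

import Mathlib

open Filter Topology

/-! ### Sets in the nonnegative orthant, tropicalization, polyhedral cones -/

namespace Trop

variable {ι : Type*}

/-- The image of `S ∩ ℝ_{>0}^ι` under the coordinatewise natural logarithm. -/
def logSet (S : Set (ι → ℝ)) : Set (ι → ℝ) :=
  (fun v i => Real.log (v i)) '' {v | v ∈ S ∧ ∀ i, 0 < v i}

/-- The tropicalization (logarithmic limit set) of `S`: all limits of points
`log_{1/τ_k} (y_k)` with `y_k ∈ S ∩ ℝ_{>0}^ι`, `τ_k ∈ (0,1)` and `τ_k → 0`. -/
def trop (S : Set (ι → ℝ)) : Set (ι → ℝ) :=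
  {y | ∃ (τ : ℕ → ℝ) (p : ℕ → ι → ℝ),
      (∀ k, 0 < τ k ∧ τ k < 1) ∧ Tendsto τ atTop (𝓝 0) ∧
      (∀ k, p k ∈ S ∧ ∀ i, 0 < p k i) ∧
      Tendsto (fun k i => Real.logb (1 / τ k) (p k i)) atTop (𝓝 y)}

/-- Basic closed semialgebraic sets: finitely many polynomial inequalities `p ≥ 0`. -/
def IsBasicClosedSemialgebraic (S : Set (ι → ℝ)) : Prop :=
  ∃ P : Finset (MvPolynomial ι ℝ), S = {v | ∀ p ∈ P, 0 ≤ MvPolynomial.eval v p}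

/-- Rational polyhedral cones: finitely many homogeneous linear inequalities with integer
coefficients. -/
def IsRationalPolyhedralCone (C : Set (ι → ℝ)) : Prop :=
  ∃ A : Finset (ι →₀ ℤ), C = {y | ∀ a ∈ A, 0 ≤ a.sum fun i c => (c : ℝ) * y i}

/-- For a square matrix `M` of polynomials in the variables `x_i`, `i ∈ ι`: the set of nonnegative
points at which all `2 × 2` principal minors of `M` are nonnegative. -/
def nonnegMinors₂ {B : Type*} (M : Matrix B B (MvPolynomial ι ℝ)) : Set (ι → ℝ) :=
  {v | (∀ i, 0 ≤ v i) ∧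
    ∀ a b : B, a ≠ b → 0 ≤ ((M.map (MvPolynomial.eval v)).submatrix ![a, b] ![a, b]).det}

end Trop

/-! ### Partially labeled graphs without isolated vertices -/

namespace GraphSos

/-- A representative of a finite partially labeled simple graph without isolated vertices.
Its vertices are the non-isolated vertices of `graph`; the vertex `Sum.inl i` carries the label `i`
and the vertices `Sum.inr k` are unlabeled. -/
structure PreGraph where
  graph : SimpleGraph (ℕ ⊕ ℕ)
  finite_support : graph.support.Finite

/-- Isomorphism of partially labeled graphs: a renaming of the unlabeled vertices which respects
adjacency. -/
def PreGraph.Iso (G H : PreGraph) : Prop :=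
  ∃ σ : Equiv.Perm ℕ, ∀ u v,
    H.graph.Adj (Sum.map id σ u) (Sum.map id σ v) ↔ G.graph.Adj u v

/-- The renaming of vertices, as an isomorphism of the ambient graphs. -/
def renameIso {G H : PreGraph} (σ : Equiv.Perm ℕ)
    (h : ∀ u v, H.graph.Adj (Sum.map id σ u) (Sum.map id σ v) ↔ G.graph.Adj u v) :
    G.graph ≃g H.graph where
  toEquiv := Equiv.sumCongr (Equiv.refl ℕ) σ
  map_rel_iff' := by
    intro u v
    exact h u v

instance PreGraph.setoid : Setoid PreGraph where
  r := PreGraph.Iso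
  iseqv := by
    refine ⟨fun G => ⟨Equiv.refl ℕ, fun u v => by simp⟩, ?_, ?_⟩
    · rintro G H ⟨σ, h⟩
      refine ⟨σ.symm, fun u v => ?_⟩
      rw [← h]
      simp
    · rintro G H K ⟨σ, h⟩ ⟨τ, h'⟩
      refine ⟨σ.trans τ, fun u v => ?_⟩
      rw [← h, ← h']
      simp

/-- Partially labeled graphs without isolated vertices, up to (label preserving) isomorphism. -/
def PLGraph : Type := Quotient PreGraph.setoid

/-- Rename the vertices of a graph along an injection. -/
def PreGraph.rename (f : (ℕ ⊕ ℕ) ↪ (ℕ ⊕ ℕ)) (G : PreGraph) : PreGraph where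
  graph := G.graph.map f
  finite_support := by
    refine (G.finite_support.image f).subset ?_
    rintro u ⟨v, a, b, hab⟩
    grind [SimpleGraph.map_adj, SimpleGraph.mem_support]

/-- The union of two graphs: vertices with the same name are identified, and only one copy of a
doubled edge is kept. -/
def PreGraph.union (G H : PreGraph) : PreGraph where
  graph := G.graph ⊔ H.graph
  finite_support := by
    refine (G.finite_support.union H.finite_support).subset ?_
    rintro u ⟨v, h⟩
    rcases h with h | h
    · exact Or.inl ⟨v, h⟩
    · exact Or.inr ⟨v, h⟩

/-- Keeps the labels, gives the unlabeled vertices even names. -/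
def evenName : (ℕ ⊕ ℕ) ↪ (ℕ ⊕ ℕ) :=
  (Function.Embedding.refl ℕ).sumMap
    (Function.Embedding.inl.trans Equiv.natSumNatEquivNat.toEmbedding)

/-- Keeps the labels, gives the unlabeled vertices odd names. -/
def oddName : (ℕ ⊕ ℕ) ↪ (ℕ ⊕ ℕ) :=
  (Function.Embedding.refl ℕ).sumMap
    (Function.Embedding.inr.trans Equiv.natSumNatEquivNat.toEmbedding)

/-- Turns all vertices into (distinct) unlabeled ones. -/
def forgetLabel : (ℕ ⊕ ℕ) ↪ (ℕ ⊕ ℕ) :=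
  Equiv.natSumNatEquivNat.toEmbedding.trans Function.Embedding.inr

/-- Gluing product: the unlabeled vertices are made disjoint, vertices with the same label are
identified. -/
def PreGraph.mul (G H : PreGraph) : PreGraph := (G.rename evenName).union (H.rename oddName)

/-- Removing all labels. -/
def PreGraph.unlabel (G : PreGraph) : PreGraph := G.rename forgetLabel

/-- The connected component `c` of a graph, as a graph of its own (the empty graph if `c` is an
isolated point, that is, not a vertex). -/
def PreGraph.component (G : PreGraph) (c : G.graph.ConnectedComponent) : PreGraph where
  graph :=
    { Adj := fun u v => G.graph.Adj u v ∧ G.graph.connectedComponentMk u = c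
      symm := ⟨fun _ _ h =>
        ⟨h.1.symm, (SimpleGraph.ConnectedComponent.connectedComponentMk_eq_of_adj h.1.symm).trans
          h.2⟩⟩
      loopless := ⟨fun _ h => h.1.ne rfl⟩ }
  finite_support := G.finite_support.subset fun _ ⟨v, h⟩ => ⟨v, h.1⟩

/-- The number of edges. -/
noncomputable def PreGraph.numEdges (G : PreGraph) : ℕ := G.graph.edgeSet.ncard

/-- The set of labels that are used. -/
def PreGraph.labels (G : PreGraph) : Set ℕ := {i | Sum.inl i ∈ G.graph.support}

/-- The graph is connected (the empty graph is not). -/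
def PreGraph.IsConnected (G : PreGraph) : Prop :=
  G.graph.support.Nonempty ∧
    ∀ u ∈ G.graph.support, ∀ v ∈ G.graph.support, G.graph.Reachable u v

/-- Every connected component contains a labeled vertex. -/
def PreGraph.ComponentsLabeled (G : PreGraph) : Prop :=
  ∀ u ∈ G.graph.support, ∃ i, G.graph.Reachable u (Sum.inl i)

/-- The number of connected components which are isomorphic to the graph `C`. -/
noncomputable def PreGraph.mult (G : PreGraph) (C : PLGraph) : ℕ :=
  {c : G.graph.ConnectedComponent | (⟦G.component c⟧ : PLGraph) = C}.ncard

/-- The homomorphism density `t(H; T)`: the probability that a uniformly random map from the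
vertices of `H` to those of `T` is a graph homomorphism (labels are disregarded). -/
noncomputable def PreGraph.density (H : PreGraph) {n : ℕ} (T : SimpleGraph (Fin n)) : ℝ :=
  (Nat.card (H.graph.induce H.graph.support →g T) : ℝ) / (n : ℝ) ^ H.graph.support.ncard

/-! Invariance under isomorphism. -/

theorem map_adj_of_comm {f : (ℕ ⊕ ℕ) ↪ (ℕ ⊕ ℕ)} {P Q : ℕ ⊕ ℕ → ℕ ⊕ ℕ} (hQ : Q.Injective)
    (hP : P.Surjective) (hf : ∀ u, Q (f u) = f (P u)) {G H : SimpleGraph (ℕ ⊕ ℕ)}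
    (h : ∀ u v, H.Adj (P u) (P v) ↔ G.Adj u v) (u v : ℕ ⊕ ℕ) :
    (H.map f).Adj (Q u) (Q v) ↔ (G.map f).Adj u v := by
  simp only [SimpleGraph.map_adj]
  constructor
  · rintro ⟨a, b, hab, ha, hb⟩
    obtain ⟨a, rfl⟩ := hP a
    obtain ⟨b, rfl⟩ := hP b
    rw [← hf] at ha hb
    exact ⟨a, b, (h a b).1 hab, hQ ha, hQ hb⟩
  · rintro ⟨a, b, hab, rfl, rfl⟩
    exact ⟨P a, P b, (h a b).2 hab, (hf a).symm, (hf b).symm⟩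

theorem rename_bijective (σ : Equiv.Perm ℕ) :
    Function.Bijective (Sum.map id σ : ℕ ⊕ ℕ → ℕ ⊕ ℕ) :=
  (Equiv.sumCongr (Equiv.refl ℕ) σ).bijective

theorem PreGraph.mul_congr {G G' H H' : PreGraph} (hG : G.Iso G') (hH : H.Iso H') :
    (G.mul H).Iso (G'.mul H') := by
  obtain ⟨σ, hσ⟩ := hG
  obtain ⟨τ, hτ⟩ := hH
  refine ⟨Equiv.natSumNatEquivNat.symm.trans
    ((Equiv.sumCongr σ τ).trans Equiv.natSumNatEquivNat), fun u v => or_congr ?_ ?_⟩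
  · refine map_adj_of_comm (rename_bijective _).1 (rename_bijective σ).2 ?_ hσ u v
    rintro (i | k) <;> simp [evenName, -Equiv.natSumNatEquivNat_apply]
  · refine map_adj_of_comm (rename_bijective _).1 (rename_bijective τ).2 ?_ hτ u v
    rintro (i | k) <;> simp [oddName, -Equiv.natSumNatEquivNat_apply]

theorem PreGraph.unlabel_congr {G H : PreGraph} (h : G.Iso H) : G.unlabel.Iso H.unlabel := by
  obtain ⟨σ, hσ⟩ := h
  refine ⟨Equiv.natSumNatEquivNat.symm.trans
    ((Equiv.sumCongr (Equiv.refl ℕ) σ).trans Equiv.natSumNatEquivNat), fun u v => ?_⟩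
  refine map_adj_of_comm (rename_bijective _).1 (rename_bijective σ).2 ?_ hσ u v
  rintro (i | k) <;> simp [forgetLabel, -Equiv.natSumNatEquivNat_apply]

theorem mem_support_iso {G H : SimpleGraph (ℕ ⊕ ℕ)} (φ : G ≃g H) (u : ℕ ⊕ ℕ) :
    φ u ∈ H.support ↔ u ∈ G.support := by
  constructor
  · rintro ⟨v, hv⟩
    have hv' : H.Adj (φ u) (φ (φ.symm v)) := by simpa using hv
    exact ⟨φ.symm v, φ.map_adj_iff.1 hv'⟩
  · rintro ⟨v, hv⟩
    exact ⟨φ v, φ.map_adj_iff.2 hv⟩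

theorem PreGraph.numEdges_congr {G H : PreGraph} (h : G.Iso H) : G.numEdges = H.numEdges := by
  obtain ⟨σ, hσ⟩ := h
  exact Nat.card_congr (renameIso σ hσ).mapEdgeSet

theorem PreGraph.labels_congr {G H : PreGraph} (h : G.Iso H) : G.labels = H.labels := by
  obtain ⟨σ, hσ⟩ := h
  ext i
  exact (mem_support_iso (renameIso σ hσ) (Sum.inl i)).symm

theorem PreGraph.isConnected_congr {G H : PreGraph} (h : G.Iso H) :
    G.IsConnected = H.IsConnected := by
  obtain ⟨σ, hσ⟩ := h
  have hs := mem_support_iso (renameIso σ hσ)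
  have hb := (renameIso σ hσ).surjective
  refine propext (Iff.symm (and_congr ?_ ?_))
  · rw [Set.Nonempty, Set.Nonempty, hb.exists]
    exact exists_congr hs
  · rw [hb.forall]
    refine forall_congr' fun u => imp_congr (hs u) ?_
    rw [hb.forall]
    exact forall_congr' fun v => imp_congr (hs v) (renameIso σ hσ).reachable_iff

theorem PreGraph.componentsLabeled_congr {G H : PreGraph} (h : G.Iso H) :
    G.ComponentsLabeled = H.ComponentsLabeled := by
  obtain ⟨σ, hσ⟩ := h
  have hs := mem_support_iso (renameIso σ hσ)
  have hb := (renameIso σ hσ).surjective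
  have hr : ∀ u i, H.graph.Reachable (renameIso σ hσ u) (Sum.inl i) ↔
      G.graph.Reachable u (Sum.inl i) := fun u i =>
    (renameIso σ hσ).reachable_iff (u := u) (v := Sum.inl i)
  refine propext (Iff.symm ?_)
  rw [PreGraph.ComponentsLabeled, PreGraph.ComponentsLabeled, hb.forall]
  exact forall_congr' fun u => imp_congr (hs u) (exists_congr (hr u))

theorem PreGraph.component_congr {G H : PreGraph} (σ : Equiv.Perm ℕ)
    (h : ∀ u v, H.graph.Adj (Sum.map id σ u) (Sum.map id σ v) ↔ G.graph.Adj u v)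
    (c : G.graph.ConnectedComponent) :
    (G.component c).Iso (H.component ((renameIso σ h).connectedComponentEquiv c)) := by
  refine ⟨σ, fun u v => and_congr (h u v) ?_⟩
  exact SimpleGraph.ConnectedComponent.iso_image_comp_eq_map_iff_eq_comp (φ := renameIso σ h)

theorem PreGraph.mult_congr {G H : PreGraph} (h : G.Iso H) : G.mult = H.mult := by
  obtain ⟨σ, hσ⟩ := h
  funext C
  refine Nat.card_congr ((renameIso σ hσ).connectedComponentEquiv.subtypeEquiv fun c => ?_)
  have : (⟦G.component c⟧ : PLGraph) =
      ⟦H.component ((renameIso σ hσ).connectedComponentEquiv c)⟧ :=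
    Quotient.sound (PreGraph.component_congr σ hσ c)
  simp only [Set.mem_ofPred_eq, this]

theorem PreGraph.density_congr {G H : PreGraph} (h : G.Iso H) {n : ℕ} (T : SimpleGraph (Fin n)) :
    G.density T = H.density T := by
  obtain ⟨σ, hσ⟩ := h
  let e : G.graph.support ≃ H.graph.support :=
    (renameIso σ hσ).toEquiv.subtypeEquiv fun u => (mem_support_iso (renameIso σ hσ) u).symm
  let φ : G.graph.induce G.graph.support ≃g H.graph.induce H.graph.support :=
    { toEquiv := e
      map_rel_iff' := fun {u v} => hσ u v }
  have h1 : Nat.card (G.graph.induce G.graph.support →g T) =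
      Nat.card (H.graph.induce H.graph.support →g T) :=
    Nat.card_congr
      { toFun := fun f => f.comp φ.symm.toHom
        invFun := fun f => f.comp φ.toHom
        left_inv := fun f => by ext u; simp
        right_inv := fun f => by ext u; simp }
  have h2 : G.graph.support.ncard = H.graph.support.ncard := Nat.card_congr e
  rw [PreGraph.density, PreGraph.density, h1, h2]

/-! The same notions for isomorphism classes. -/

namespace PLGraph

/-- Gluing product of partially labeled graphs. -/
instance : Mul PLGraph :=
  ⟨Quotient.map₂ PreGraph.mul fun _ _ hG _ _ hH => PreGraph.mul_congr hG hH⟩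

/-- Removing all labels. -/
def unlabel : PLGraph → PLGraph :=
  Quotient.map PreGraph.unlabel fun _ _ h => PreGraph.unlabel_congr h

/-- The number of edges. -/
noncomputable def numEdges : PLGraph → ℕ :=
  Quotient.lift PreGraph.numEdges fun _ _ h => PreGraph.numEdges_congr h

/-- The set of labels that are used. -/
def labels : PLGraph → Set ℕ :=
  Quotient.lift PreGraph.labels fun _ _ h => PreGraph.labels_congr h

/-- The graph is connected (the empty graph is not). -/
def IsConnected : PLGraph → Prop :=
  Quotient.lift PreGraph.IsConnected fun _ _ h => PreGraph.isConnected_congr h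

/-- Every connected component contains a labeled vertex. -/
def ComponentsLabeled : PLGraph → Prop :=
  Quotient.lift PreGraph.ComponentsLabeled fun _ _ h => PreGraph.componentsLabeled_congr h

/-- `H.mult C` is the number of connected components of `H` isomorphic to `C`. -/
noncomputable def mult : PLGraph → PLGraph → ℕ :=
  Quotient.lift PreGraph.mult fun _ _ h => PreGraph.mult_congr h

/-- The homomorphism density `t(H; T)`. -/
noncomputable def density (H : PLGraph) {n : ℕ} (T : SimpleGraph (Fin n)) : ℝ :=
  Quotient.lift (fun G : PreGraph => G.density T) (fun _ _ h => PreGraph.density_congr h T) H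

end PLGraph

/-! ### Graph combinations, sums of squares, profiles -/

open PLGraph

/-- The gluing algebra: formal finite real linear combinations of partially labeled graphs without
isolated vertices, with the bilinear extension of the gluing product. -/
abbrev GraphComb : Type := MonoidAlgebra ℝ PLGraph

/-- The linear map `[[·]]` that removes the labels. -/
noncomputable def unlabelComb (a : GraphComb) : GraphComb :=
  MonoidAlgebra.mapDomain PLGraph.unlabel a

/-- `a` is a `d`-sos graph combination: `a = ∑ⱼ [[aⱼ²]]` for finitely many graph combinations `aⱼ`
of partially labeled graphs with at most `d` edges. -/
def IsSos (d : ℕ) (a : GraphComb) : Prop :=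
  ∃ (m : ℕ) (f : Fin m → GraphComb),
    (∀ j, ∀ H ∈ (f j).coeff.support, H.numEdges ≤ d) ∧
    a = ∑ j, unlabelComb (f j * f j)

/-- `𝒱_d`: the connected unlabeled graphs of the form `[[AB]]`, where `A` and `B` are partially
labeled graphs with at most `d` edges and no isolated vertices. -/
def V (d : ℕ) : Set PLGraph :=
  {C | C.IsConnected ∧ ∃ A B : PLGraph, A.numEdges ≤ d ∧ B.numEdges ≤ d ∧ C = (A * B).unlabel}

/-- An unlabeled graph as a monomial in its connected components, which are the variables. (The
components of all graphs that occur in `d`-sos graph combinations lie in `𝒱_d`.) -/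
noncomputable def toMonomial (d : ℕ) (H : PLGraph) : MvPolynomial (V d) ℝ :=
  ∏ᶠ C : V d, MvPolynomial.X C ^ H.mult C

/-- A combination of unlabeled graphs as a polynomial in the elements of `𝒱_d`. -/
noncomputable def toPolynomial (d : ℕ) (a : GraphComb) : MvPolynomial (V d) ℝ :=
  a.coeff.sum fun H α => MvPolynomial.C α * toMonomial d H

/-- The `d`-sos-profile `𝒮_d`. -/
def sosProfile (d : ℕ) : Set (V d → ℝ) :=
  {v | (∀ C, 0 ≤ v C) ∧ ∀ a, IsSos d a → 0 ≤ MvPolynomial.eval v (toPolynomial d a)}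

/-- The projection to the coordinates indexed by `U ⊆ 𝒱_d`. -/
def proj {d : ℕ} {U : Set PLGraph} (hU : U ⊆ V d) (v : V d → ℝ) : U → ℝ :=
  fun C => v ⟨C, hU C.2⟩

/-- The `(U,d)`-sos-profile. -/
def projSosProfile {d : ℕ} {U : Set PLGraph} (hU : U ⊆ V d) : Set (U → ℝ) :=
  proj hU '' sosProfile d

/-- The graph profile of `U`: the closure of the set of vectors `(t(C; T))_{C ∈ U}` over all finite
nonempty graphs `T`. -/
def graphProfile (U : Set PLGraph) : Set (U → ℝ) :=
  closure {v | ∃ (n : ℕ) (T : SimpleGraph (Fin n)), 0 < n ∧ v = fun C : U => C.1.density T}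

/-- The index set of the reduced moment matrix, with `ℓ` available labels: partially labeled graphs
with at most `d` edges, labels among `0, …, ℓ - 1`, and no unlabeled connected component. -/
def reducedB (d ℓ : ℕ) : Set PLGraph :=
  {A | A.numEdges ≤ d ∧ (∀ i ∈ A.labels, i < ℓ) ∧ A.ComponentsLabeled}

/-- The reduced moment matrix, with entries `[[AB]]`. -/
noncomputable def reducedMomentMatrix (d ℓ : ℕ) :
    Matrix (reducedB d ℓ) (reducedB d ℓ) (MvPolynomial (V d) ℝ) :=
  fun A B => toMonomial d ((A : PLGraph) * (B : PLGraph)).unlabel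

end GraphSos

/-! ### Isomorphisms, images of graphs, and the product `[[AB]]` -/

namespace GraphSos

/-! Nonnegativity on all `d`-sos combinations means that the moment form with entries `[[AB]]` is
positive semidefinite on graphs with at most `d` edges (`mem_sosProfile_iff`). Two reductions make
this a finite condition. Möbius inversion over sets of labels writes the form as a sum of forms that
each use at most `2d` labels (`GramPos.of_labels`), and splitting off unlabeled components only
rescales rows and columns (`GramPos.of_reduced`). Semidefiniteness of one finite matrix is then
expressed by the signs of the coefficients of its characteristic polynomial. Density vectors satisfy
it because fixing the images of the labels exhibits the matrix as a Gram matrix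
(`PreGraph.dens_mul`).

For the tropicalization, the `2 × 2` minors compare monomials, so in logarithmic coordinates they
are integral linear inequalities and cut out the closed rational cone `logCone`. A semidefinite
matrix has nonnegative minors, hence the tropicalization lies in this cone. Conversely, let `z`
satisfy all inequalities between distinct graphs strictly. At the point `exp (s z)` the reduced
matrix, scaled to unit diagonal, tends to the identity as `s` grows, so it is eventually
semidefinite by diagonal dominance (`eventually_exp_mem_sosProfile`). Strict points exist because
homomorphism counts into finite targets distinguish any two reduced graphs, which makes some
Cauchy–Schwarz inequality between densities strict (`exists_strict_dens`, `exists_strict`). Adding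
small multiples of a strict point approximates every point of the cone.

For projections, a positive point of the projected profile may lift only to points with vanishing
coordinates. `exists_mem_logCone` replaces the missing logarithms by a large multiple of a strict
nonpositive point. Fourier–Motzkin elimination shows that the projected cone is again rational
polyhedral. -/

/-- The isomorphism class of a representative. -/
abbrev PLGraph.mk (A : PreGraph) : PLGraph := Quotient.mk PreGraph.setoid A

@[elab_as_elim]
theorem PLGraph.ind {p : PLGraph → Prop} (h : ∀ G, p (PLGraph.mk G)) (A : PLGraph) : p A :=
  Quotient.inductionOn A h

theorem PreGraph.ext' {G H : PreGraph} (h : ∀ u v, G.graph.Adj u v ↔ H.graph.Adj u v) : G = H := by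
  cases G; cases H
  congr
  ext u v
  exact h u v

/-- A map that is injective on a finite set of natural numbers agrees there with a permutation. -/
theorem exists_perm_eqOn {s : Set ℕ} (hs : s.Finite) {f : ℕ → ℕ} (hf : s.InjOn f) :
    ∃ σ : Equiv.Perm ℕ, ∀ k ∈ s, σ k = f k := by
  let g : s ↪ ℕ := ⟨fun x => f x, fun x y h => Subtype.ext (hf x.2 y.2 h)⟩
  have h1 : (sᶜ).Infinite := hs.infinite_compl
  have h2 : ((Set.range g)ᶜ).Infinite := by
    have := hs.to_subtype
    exact (Set.finite_range g).infinite_compl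
  have := h1.to_subtype
  have := h2.to_subtype
  obtain ⟨e⟩ : Nonempty ((sᶜ : Set ℕ) ≃ ((Set.range g)ᶜ : Set ℕ)) := nonempty_equiv_of_countable
  obtain ⟨σ, hσ⟩ := Cardinal.extend_function g ⟨e⟩
  exact ⟨σ, fun k hk => hσ ⟨k, hk⟩⟩

/-- `H` is the image of `G` under a map that is injective on the vertices of `G`. -/
def PreGraph.IsImage (f : ℕ ⊕ ℕ → ℕ ⊕ ℕ) (G H : PreGraph) : Prop :=
  G.graph.support.InjOn f ∧ ∀ x y, H.graph.Adj x y ↔ ∃ u v, G.graph.Adj u v ∧ f u = x ∧ f v = y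

/-- Only finitely many unlabeled vertices occur, so an injection on them extends to a permutation of
`ℕ`, as `PreGraph.Iso` requires. -/
theorem PreGraph.IsImage.iso {f : ℕ ⊕ ℕ → ℕ ⊕ ℕ} {G H : PreGraph} (h : G.IsImage f H)
    (hl : ∀ i, Sum.inl i ∈ G.graph.support → f (Sum.inl i) = Sum.inl i)
    (hr : ∀ k, Sum.inr k ∈ G.graph.support → ∃ m, f (Sum.inr k) = Sum.inr m) : G.Iso H := by
  obtain ⟨hinj, hadj⟩ := h
  choose! g hg using hr
  have hfin : {k | Sum.inr k ∈ G.graph.support}.Finite :=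
    G.finite_support.preimage (Sum.inr_injective.injOn)
  obtain ⟨σ, hσ⟩ := exists_perm_eqOn (f := g) hfin (by
    intro a ha b hb hab
    have : f (Sum.inr a) = f (Sum.inr b) := by rw [hg a ha, hg b hb, hab]
    exact Sum.inr_injective (hinj ha hb this))
  have hf : ∀ u ∈ G.graph.support, f u = Sum.map id σ u := by
    rintro (i | k) hu
    · simpa using hl i hu
    · rw [hg k hu]
      simp [hσ k hu]
  refine ⟨σ, fun u v => ?_⟩
  rw [hadj]
  constructor
  · rintro ⟨a, b, hab, ha, hb⟩
    rw [hf a hab.mem_support_left] at ha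
    rw [hf b hab.mem_support_right] at hb
    rwa [← (rename_bijective σ).1 ha, ← (rename_bijective σ).1 hb]
  · intro huv
    exact ⟨u, v, huv, hf u huv.mem_support_left, hf v huv.mem_support_right⟩

theorem PreGraph.rename_adj {f : (ℕ ⊕ ℕ) ↪ (ℕ ⊕ ℕ)} {G : PreGraph} {x y : ℕ ⊕ ℕ} :
    (G.rename f).graph.Adj x y ↔ ∃ u v, G.graph.Adj u v ∧ f u = x ∧ f v = y :=
  SimpleGraph.map_adj ..

theorem PreGraph.rename_adj_apply {f : (ℕ ⊕ ℕ) ↪ (ℕ ⊕ ℕ)} {G : PreGraph} {x y : ℕ ⊕ ℕ} :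
    (G.rename f).graph.Adj (f x) (f y) ↔ G.graph.Adj x y :=
  SimpleGraph.map_adj_apply

theorem PreGraph.rename_support {f : (ℕ ⊕ ℕ) ↪ (ℕ ⊕ ℕ)} {G : PreGraph} :
    (G.rename f).graph.support = f '' G.graph.support :=
  SimpleGraph.support_map ..

theorem PreGraph.isImage_rename (f : (ℕ ⊕ ℕ) ↪ (ℕ ⊕ ℕ)) (G : PreGraph) :
    G.IsImage f (G.rename f) :=
  ⟨f.injective.injOn, fun _ _ => PreGraph.rename_adj⟩

theorem forgetLabel_inr (x : ℕ ⊕ ℕ) : forgetLabel x = Sum.inr (Equiv.natSumNatEquivNat x) := rfl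

/-- Once labels are forgotten, only adjacency has to be preserved, so injectivity on the vertices
suffices. The value of `g` on `Sum.inl` is a dummy, since `unlabel` leaves no labeled vertex. -/
theorem PreGraph.IsImage.unlabel {f : ℕ ⊕ ℕ → ℕ ⊕ ℕ} {G H : PreGraph} (h : G.IsImage f H) :
    G.unlabel.Iso H.unlabel := by
  obtain ⟨hinj, hadj⟩ := h
  let g : ℕ ⊕ ℕ → ℕ ⊕ ℕ := Sum.elim Sum.inl
    (fun m => forgetLabel (f (Equiv.natSumNatEquivNat.symm m)))
  have hg : ∀ u, g (forgetLabel u) = forgetLabel (f u) := by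
    intro u
    rw [forgetLabel_inr u]
    simp [g, -Equiv.natSumNatEquivNat_apply, -Equiv.natSumNatEquivNat_symm_apply]
  refine PreGraph.IsImage.iso (f := g) ⟨?_, ?_⟩ ?_ ?_
  · rw [PreGraph.unlabel, PreGraph.rename_support]
    rintro _ ⟨u, hu, rfl⟩ _ ⟨v, hv, rfl⟩ huv
    rw [hg, hg] at huv
    rw [hinj hu hv (forgetLabel.injective huv)]
  · intro x y
    rw [PreGraph.unlabel, PreGraph.rename_adj]
    constructor
    · rintro ⟨a, b, hab, rfl, rfl⟩
      obtain ⟨u, v, huv, rfl, rfl⟩ := (hadj a b).1 hab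
      exact ⟨forgetLabel u, forgetLabel v, PreGraph.rename_adj_apply.2 huv, hg u, hg v⟩
    · rintro ⟨a, b, hab, rfl, rfl⟩
      obtain ⟨u, v, huv, rfl, rfl⟩ := PreGraph.rename_adj.1 hab
      exact ⟨f u, f v, (hadj _ _).2 ⟨u, v, huv, rfl, rfl⟩, (hg u).symm, (hg v).symm⟩
  · intro i _
    rfl
  · intro k _
    exact ⟨_, rfl⟩

/-- The union of the images of two graphs. -/
def PreGraph.glue (f g : (ℕ ⊕ ℕ) ↪ (ℕ ⊕ ℕ)) (A B : PreGraph) : PreGraph :=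
  (A.rename f).union (B.rename g)

theorem PreGraph.glue_adj {f g : (ℕ ⊕ ℕ) ↪ (ℕ ⊕ ℕ)} {A B : PreGraph} {x y : ℕ ⊕ ℕ} :
    (PreGraph.glue f g A B).graph.Adj x y ↔
      (∃ u v, A.graph.Adj u v ∧ f u = x ∧ f v = y) ∨
      ∃ u v, B.graph.Adj u v ∧ g u = x ∧ g v = y :=
  or_congr PreGraph.rename_adj PreGraph.rename_adj

theorem PreGraph.glue_support {f g : (ℕ ⊕ ℕ) ↪ (ℕ ⊕ ℕ)} {A B : PreGraph} :
    (PreGraph.glue f g A B).graph.support = f '' A.graph.support ∪ g '' B.graph.support := by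
  rw [← PreGraph.rename_support, ← PreGraph.rename_support]
  ext x
  simp only [SimpleGraph.mem_support, Set.mem_union, ← exists_or]
  rfl

/-- Up to isomorphism the glued graph depends only on which vertices are identified. -/
theorem PreGraph.glue_unlabel_iso {f g f' g' : (ℕ ⊕ ℕ) ↪ (ℕ ⊕ ℕ)} {A B : PreGraph}
    (h : ∀ u ∈ A.graph.support, ∀ v ∈ B.graph.support, f u = g v ↔ f' u = g' v) :
    (PreGraph.glue f g A B).unlabel.Iso (PreGraph.glue f' g' A B).unlabel := by
  classical
  -- On the overlap of the two images both branches agree, by `h`.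
  let k : ℕ ⊕ ℕ → ℕ ⊕ ℕ := fun x =>
    if x ∈ f '' A.graph.support then f' (Function.invFun f x) else g' (Function.invFun g x)
  have hf : ∀ u ∈ A.graph.support, k (f u) = f' u := by
    intro u hu
    have : f u ∈ f '' A.graph.support := ⟨u, hu, rfl⟩
    simp only [k, if_pos this, Function.leftInverse_invFun f.injective u]
  have hg : ∀ u ∈ B.graph.support, k (g u) = g' u := by
    intro u hu
    by_cases hx : g u ∈ f '' A.graph.support
    · obtain ⟨w, hw, hwu⟩ := hx
      rw [← hwu, hf w hw]
      exact (h w hw u hu).1 hwu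
    · simp only [k, if_neg hx, Function.leftInverse_invFun g.injective u]
  refine PreGraph.IsImage.unlabel (f := k) ⟨?_, ?_⟩
  · rw [PreGraph.glue_support]
    rintro _ (⟨u, hu, rfl⟩ | ⟨u, hu, rfl⟩) _ (⟨v, hv, rfl⟩ | ⟨v, hv, rfl⟩) huv
    · rw [hf u hu, hf v hv] at huv
      rw [f'.injective huv]
    · rw [hf u hu, hg v hv] at huv
      exact (h u hu v hv).2 huv
    · rw [hg u hu, hf v hv] at huv
      exact ((h v hv u hu).2 huv.symm).symm
    · rw [hg u hu, hg v hv] at huv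
      rw [g'.injective huv]
  · intro x y
    rw [PreGraph.glue_adj]
    constructor
    · rintro (⟨u, v, huv, rfl, rfl⟩ | ⟨u, v, huv, rfl, rfl⟩)
      · exact ⟨f u, f v, PreGraph.glue_adj.2 (Or.inl ⟨u, v, huv, rfl, rfl⟩),
          hf u huv.mem_support_left, hf v huv.mem_support_right⟩
      · exact ⟨g u, g v, PreGraph.glue_adj.2 (Or.inr ⟨u, v, huv, rfl, rfl⟩),
          hg u huv.mem_support_left, hg v huv.mem_support_right⟩
    · rintro ⟨a, b, hab, rfl, rfl⟩
      rcases PreGraph.glue_adj.1 hab with ⟨u, v, huv, rfl, rfl⟩ | ⟨u, v, huv, rfl, rfl⟩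
      · exact Or.inl ⟨u, v, huv, (hf u huv.mem_support_left).symm,
          (hf v huv.mem_support_right).symm⟩
      · exact Or.inr ⟨u, v, huv, (hg u huv.mem_support_left).symm,
          (hg v huv.mem_support_right).symm⟩

theorem evenName_inl (i : ℕ) : evenName (Sum.inl i) = Sum.inl i := rfl
theorem oddName_inl (i : ℕ) : oddName (Sum.inl i) = Sum.inl i := rfl
theorem evenName_inr (k : ℕ) :
    evenName (Sum.inr k) = Sum.inr (Equiv.natSumNatEquivNat (Sum.inl k)) := rfl
theorem oddName_inr (k : ℕ) :
    oddName (Sum.inr k) = Sum.inr (Equiv.natSumNatEquivNat (Sum.inr k)) := rfl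

/-- Even and odd names never meet, so a product identifies vertices through common labels only.
Comparisons of products reduce to this criterion. -/
theorem evenName_eq_oddName {u v : ℕ ⊕ ℕ} :
    evenName u = oddName v ↔ ∃ i, u = Sum.inl i ∧ v = Sum.inl i := by
  rcases u with i | k <;> rcases v with j | l
  · simp [evenName_inl, oddName_inl, eq_comm]
  · simp [evenName_inl, oddName_inr]
  · simp [evenName_inr, oddName_inl]
  · simp only [evenName_inr, oddName_inr, Sum.inr.injEq, EmbeddingLike.apply_eq_iff_eq]
    simp

theorem PreGraph.mul_eq_glue (A B : PreGraph) : A.mul B = PreGraph.glue evenName oddName A B := rfl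

theorem PreGraph.glue_rename {f g h k : (ℕ ⊕ ℕ) ↪ (ℕ ⊕ ℕ)} {A B : PreGraph} :
    PreGraph.glue f g (A.rename h) (B.rename k) = PreGraph.glue (h.trans f) (k.trans g) A B := by
  refine PreGraph.ext' fun x y => ?_
  simp only [PreGraph.glue_adj, PreGraph.rename_adj]
  refine or_congr ?_ ?_
  · constructor
    · rintro ⟨_, _, ⟨a, b, hab, rfl, rfl⟩, rfl, rfl⟩
      exact ⟨a, b, hab, rfl, rfl⟩
    · rintro ⟨a, b, hab, rfl, rfl⟩
      exact ⟨_, _, ⟨a, b, hab, rfl, rfl⟩, rfl, rfl⟩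
  · constructor
    · rintro ⟨_, _, ⟨a, b, hab, rfl, rfl⟩, rfl, rfl⟩
      exact ⟨a, b, hab, rfl, rfl⟩
    · rintro ⟨a, b, hab, rfl, rfl⟩
      exact ⟨_, _, ⟨a, b, hab, rfl, rfl⟩, rfl, rfl⟩

theorem PLGraph.mk_mul_mk (A B : PreGraph) : PLGraph.mk A * PLGraph.mk B = PLGraph.mk (A.mul B) := rfl

theorem PLGraph.unlabel_mk (A : PreGraph) : (PLGraph.mk A).unlabel = PLGraph.mk A.unlabel := rfl

/-- `[[AB]]` depends only on which vertices are identified. -/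
theorem PLGraph.unlabel_rename_mul_rename {h k h' k' : (ℕ ⊕ ℕ) ↪ (ℕ ⊕ ℕ)} {A B : PreGraph}
    (H : ∀ u ∈ A.graph.support, ∀ v ∈ B.graph.support,
      (∃ i, h u = Sum.inl i ∧ k v = Sum.inl i) ↔ ∃ i, h' u = Sum.inl i ∧ k' v = Sum.inl i) :
    PLGraph.unlabel (PLGraph.mk (A.rename h) * PLGraph.mk (B.rename k)) =
      PLGraph.unlabel (PLGraph.mk (A.rename h') * PLGraph.mk (B.rename k')) := by
  simp only [PLGraph.mk_mul_mk, PLGraph.unlabel_mk, PreGraph.mul_eq_glue, PreGraph.glue_rename]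
  refine Quotient.sound (PreGraph.glue_unlabel_iso fun u hu v hv => ?_)
  simp only [Function.Embedding.trans_apply, evenName_eq_oddName]
  exact H u hu v hv

theorem PLGraph.unlabel_mul_comm (A B : PLGraph) : (A * B).unlabel = (B * A).unlabel := by
  induction A using PLGraph.ind with | h A => ?_
  induction B using PLGraph.ind with | h B => ?_
  simp only [PLGraph.mk_mul_mk, PLGraph.unlabel_mk, PreGraph.mul_eq_glue]
  have : PreGraph.glue evenName oddName B A = PreGraph.glue oddName evenName A B :=
    PreGraph.ext' fun x y => by simp only [PreGraph.glue_adj]; exact or_comm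
  rw [this]
  refine Quotient.sound (PreGraph.glue_unlabel_iso fun u _ v _ => ?_)
  rw [evenName_eq_oddName, eq_comm, evenName_eq_oddName]
  simp only [and_comm]

/-! ### Finiteness -/

theorem PreGraph.edgeSet_finite (G : PreGraph) : G.graph.edgeSet.Finite := by
  refine ((G.finite_support.prod G.finite_support).image fun p => s(p.1, p.2)).subset ?_
  intro e he
  induction e using Sym2.ind with | h u v => ?_
  have : G.graph.Adj u v := he
  exact ⟨(u, v), ⟨this.mem_support_left, this.mem_support_right⟩, rfl⟩

theorem PreGraph.support_ncard_le (G : PreGraph) : G.graph.support.ncard ≤ 2 * G.numEdges := by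
  classical
  have hE := G.edgeSet_finite
  have : G.graph.support ⊆ (hE.toFinset.biUnion fun e => e.toFinset : Finset (ℕ ⊕ ℕ)) := by
    rintro u ⟨v, huv⟩
    simp only [Finset.coe_biUnion, Set.mem_iUnion, Finset.mem_coe, Set.Finite.mem_toFinset]
    exact ⟨s(u, v), huv, by simp⟩
  calc G.graph.support.ncard
      ≤ ((hE.toFinset.biUnion fun e => e.toFinset : Finset (ℕ ⊕ ℕ)) : Set (ℕ ⊕ ℕ)).ncard :=
        Set.ncard_le_ncard this (Finset.finite_toSet _)
    _ = (hE.toFinset.biUnion fun e => e.toFinset).card := Set.ncard_coe_finset _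
    _ ≤ hE.toFinset.card * 2 := Finset.card_biUnion_le_card_mul _ _ _ fun e _ => by
        rw [Sym2.card_toFinset]
        split_ifs <;> omega
    _ = 2 * G.numEdges := by
        rw [PreGraph.numEdges, Set.ncard_eq_toFinset_card _ hE, mul_comm]

theorem PreGraph.labels_ncard_le (G : PreGraph) : G.labels.ncard ≤ 2 * G.numEdges := by
  refine le_trans ?_ G.support_ncard_le
  exact Set.ncard_le_ncard_of_injOn Sum.inl (fun i hi => hi) Sum.inl_injective.injOn
    G.finite_support

theorem PreGraph.labels_finite (G : PreGraph) : G.labels.Finite :=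
  G.finite_support.preimage Sum.inl_injective.injOn

theorem PreGraph.finite_of_support_subset {s : Set (ℕ ⊕ ℕ)} (hs : s.Finite) :
    {G : PreGraph | G.graph.support ⊆ s}.Finite := by
  refine Set.Finite.of_finite_image (f := fun G : PreGraph => {p : (ℕ ⊕ ℕ) × (ℕ ⊕ ℕ) |
    G.graph.Adj p.1 p.2}) ((hs.prod hs).finite_subsets.subset ?_) ?_
  · rintro _ ⟨G, hG, rfl⟩ p hp
    have hp : G.graph.Adj p.1 p.2 := hp
    exact ⟨hG hp.mem_support_left, hG hp.mem_support_right⟩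
  · intro G _ H _ h
    exact PreGraph.ext' fun u v => (Set.ext_iff.1 h (u, v) : _)

/-- Without isolated vertices, at most `m` edges span at most `2m` vertices. Hence each class has a
representative on one fixed finite set: the labels below `l` and the unlabeled vertices below `2m`.
-/
theorem PLGraph.finite_setOf (m l : ℕ) :
    {A : PLGraph | A.numEdges ≤ m ∧ ∀ i ∈ A.labels, i < l}.Finite := by
  have hs : (Sum.inl '' Set.Iio l ∪ Sum.inr '' Set.Iio (2 * m) : Set (ℕ ⊕ ℕ)).Finite :=
    ((Set.finite_Iio l).image _).union ((Set.finite_Iio (2 * m)).image _)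
  refine ((PreGraph.finite_of_support_subset hs).image (fun G => (⟦G⟧ : PLGraph))).subset ?_
  intro A
  induction A using PLGraph.ind with | h A => ?_
  rintro ⟨hm, hl⟩
  have hm : A.numEdges ≤ m := hm
  have hl : ∀ i ∈ A.labels, i < l := hl
  have hfin : {k | Sum.inr k ∈ A.graph.support}.Finite :=
    A.finite_support.preimage (Sum.inr_injective.injOn)
  have hcard : {k | Sum.inr k ∈ A.graph.support}.ncard ≤ 2 * m := by
    refine le_trans ?_ (A.support_ncard_le.trans (by omega))
    exact Set.ncard_le_ncard_of_injOn Sum.inr (fun i hi => hi) Sum.inr_injective.injOn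
      A.finite_support
  obtain ⟨f, hf1, hf2⟩ : ∃ f : ℕ → ℕ, Set.InjOn f {k | Sum.inr k ∈ A.graph.support} ∧
      ∀ k ∈ {k | Sum.inr k ∈ A.graph.support}, f k < 2 * m := by
    have : Fintype {k | Sum.inr k ∈ A.graph.support} := hfin.fintype
    let e := Fintype.equivFin {k | Sum.inr k ∈ A.graph.support}
    have hc : Fintype.card {k | Sum.inr k ∈ A.graph.support} ≤ 2 * m := by
      rwa [← Nat.card_eq_fintype_card]
    classical
    refine ⟨fun k => if h : k ∈ {k | Sum.inr k ∈ A.graph.support} then e ⟨k, h⟩ else 0, ?_, ?_⟩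
    · intro a ha b hb hab
      simp only [dif_pos ha, dif_pos hb] at hab
      have := e.injective (Fin.ext hab)
      simpa using this
    · intro k hk
      simp only [dif_pos hk]
      exact (e ⟨k, hk⟩).2.trans_le hc
  obtain ⟨σ, hσ⟩ := exists_perm_eqOn hfin hf1
  let h : (ℕ ⊕ ℕ) ↪ (ℕ ⊕ ℕ) := (Equiv.sumCongr (Equiv.refl ℕ) σ).toEmbedding
  refine ⟨A.rename h, ?_, ?_⟩
  · show (A.rename h).graph.support ⊆ _
    rw [PreGraph.rename_support]
    rintro _ ⟨i | k, hu, rfl⟩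
    · exact Or.inl ⟨i, hl i hu, rfl⟩
    · refine Or.inr ⟨σ k, ?_, rfl⟩
      rw [hσ k hu]
      exact hf2 k hu
  · exact (Quotient.sound ((PreGraph.isImage_rename h A).iso (fun i _ => rfl)
      (fun k _ => ⟨_, rfl⟩))).symm

theorem PreGraph.rename_numEdges (f : (ℕ ⊕ ℕ) ↪ (ℕ ⊕ ℕ)) (G : PreGraph) :
    (G.rename f).numEdges = G.numEdges := by
  rw [PreGraph.numEdges, PreGraph.rename, SimpleGraph.edgeSet_map]
  exact Set.ncard_image_of_injective _ f.sym2Map.injective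

theorem PreGraph.union_numEdges_le (G H : PreGraph) :
    (G.union H).numEdges ≤ G.numEdges + H.numEdges := by
  rw [PreGraph.numEdges, PreGraph.union, SimpleGraph.edgeSet_sup]
  exact Set.ncard_union_le _ _

theorem V_finite (d : ℕ) : (V d).Finite := by
  refine (PLGraph.finite_setOf (2 * d) 0).subset ?_
  rintro _ ⟨-, A, B, hA, hB, rfl⟩
  induction A using PLGraph.ind with | h A => ?_
  induction B using PLGraph.ind with | h B => ?_
  have hA : A.numEdges ≤ d := hA
  have hB : B.numEdges ≤ d := hB
  constructor
  · show ((A.mul B).rename forgetLabel).numEdges ≤ 2 * d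
    rw [PreGraph.rename_numEdges]
    refine (PreGraph.union_numEdges_le _ _).trans ?_
    rw [PreGraph.rename_numEdges, PreGraph.rename_numEdges]
    omega
  · intro i hi
    have hi : Sum.inl i ∈ ((A.mul B).rename forgetLabel).graph.support := hi
    rw [PreGraph.rename_support] at hi
    obtain ⟨x, -, hx⟩ := hi
    simp [forgetLabel_inr] at hx

instance (d : ℕ) : Finite (V d) := (V_finite d).to_subtype

/-! ### Connected components and disjoint unions -/

theorem PreGraph.union_adj {G H : PreGraph} {u v : ℕ ⊕ ℕ} :
    (G.union H).graph.Adj u v ↔ G.graph.Adj u v ∨ H.graph.Adj u v := Iff.rfl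

theorem PreGraph.union_support {G H : PreGraph} :
    (G.union H).graph.support = G.graph.support ∪ H.graph.support := by
  ext x
  simp only [SimpleGraph.mem_support, Set.mem_union, ← exists_or, PreGraph.union_adj]

/-- The subgraph spanned by a set of vertices. -/
def PreGraph.restrict (G : PreGraph) (p : Set (ℕ ⊕ ℕ)) : PreGraph where
  graph :=
    { Adj := fun u v => G.graph.Adj u v ∧ u ∈ p ∧ v ∈ p
      symm := ⟨fun _ _ h => ⟨h.1.symm, h.2.2, h.2.1⟩⟩
      loopless := ⟨fun _ h => h.1.ne rfl⟩ }
  finite_support := G.finite_support.subset fun _ ⟨v, h⟩ => ⟨v, h.1⟩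

theorem PreGraph.restrict_adj {G : PreGraph} {p : Set (ℕ ⊕ ℕ)} {u v : ℕ ⊕ ℕ} :
    (G.restrict p).graph.Adj u v ↔ G.graph.Adj u v ∧ u ∈ p ∧ v ∈ p := Iff.rfl

theorem PreGraph.restrict_support_subset (G : PreGraph) (p : Set (ℕ ⊕ ℕ)) :
    (G.restrict p).graph.support ⊆ G.graph.support ∩ p :=
  fun _ ⟨v, h⟩ => ⟨⟨v, h.1⟩, h.2.1⟩

/-- A set of vertices which is a union of connected components. -/
def PreGraph.IsClosed (G : PreGraph) (p : Set (ℕ ⊕ ℕ)) : Prop :=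
  ∀ u ∈ p, ∀ v, G.graph.Adj u v → v ∈ p

theorem PreGraph.IsClosed.mem_iff {G : PreGraph} {p : Set (ℕ ⊕ ℕ)} (hp : G.IsClosed p)
    {u v : ℕ ⊕ ℕ} (h : G.graph.Adj u v) : u ∈ p ↔ v ∈ p :=
  ⟨fun hu => hp u hu v h, fun hv => hp v hv u h.symm⟩

theorem PreGraph.IsClosed.union_restrict {G : PreGraph} {p : Set (ℕ ⊕ ℕ)} (hp : G.IsClosed p) :
    (G.restrict p).union (G.restrict pᶜ) = G := by
  refine PreGraph.ext' fun u v => ?_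
  simp only [PreGraph.union_adj, PreGraph.restrict_adj, Set.mem_compl_iff]
  constructor
  · rintro (h | h) <;> exact h.1
  · intro h
    have := hp.mem_iff h
    tauto

theorem PreGraph.disjoint_restrict (G : PreGraph) (p : Set (ℕ ⊕ ℕ)) :
    Disjoint (G.restrict p).graph.support (G.restrict pᶜ).graph.support := by
  rw [Set.disjoint_left]
  intro u hu hu'
  exact (G.restrict_support_subset _ hu').2 (G.restrict_support_subset _ hu).2

/-- A walk that starts in `p` never leaves it, and inside `p` the edges of `G` are edges of `H`. -/
theorem PreGraph.IsClosed.reachable {G H : PreGraph} {p : Set (ℕ ⊕ ℕ)} (hp : G.IsClosed p)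
    (hH : ∀ u ∈ p, ∀ v, G.graph.Adj u v → H.graph.Adj u v) {u v : ℕ ⊕ ℕ}
    (h : G.graph.Reachable u v) (hu : u ∈ p) : v ∈ p ∧ H.graph.Reachable u v := by
  obtain ⟨w⟩ := h
  induction w with
  | nil => exact ⟨hu, SimpleGraph.Reachable.refl _⟩
  | cons hab _ ih =>
    obtain ⟨h1, h2⟩ := ih (hp _ hu _ hab)
    exact ⟨h1, (hH _ hu _ hab).reachable.trans h2⟩

/-- The connected components, as subgraphs. -/
def PreGraph.comps (G : PreGraph) : Set PreGraph :=
  {K | K.IsConnected ∧ K.graph ≤ G.graph ∧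
    ∀ u ∈ K.graph.support, ∀ v, G.graph.Adj u v → K.graph.Adj u v}

theorem PreGraph.isClosed_support_of_mem_comps {G K : PreGraph} (hK : K ∈ G.comps) :
    G.IsClosed K.graph.support :=
  fun u hu v huv => (hK.2.2 u hu v huv).mem_support_right

theorem PreGraph.comps_finite (G : PreGraph) : G.comps.Finite :=
  (PreGraph.finite_of_support_subset G.finite_support).subset
    fun _ hK => SimpleGraph.support_mono hK.2.1

theorem PreGraph.component_mem_comps {G : PreGraph} {c : G.graph.ConnectedComponent}
    (h : (G.component c).graph.support.Nonempty) : G.component c ∈ G.comps := by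
  refine ⟨⟨h, ?_⟩, fun u v huv => huv.1, ?_⟩
  · rintro u ⟨a, hu⟩ v ⟨b, hv⟩
    have hcl : G.IsClosed {x | G.graph.connectedComponentMk x = c} := by
      intro x hx y hxy
      have hx : G.graph.connectedComponentMk x = c := hx
      show G.graph.connectedComponentMk y = c
      rw [← hx]
      exact (SimpleGraph.ConnectedComponent.connectedComponentMk_eq_of_adj hxy).symm
    refine (hcl.reachable (H := G.component c) (fun x hx y hxy => ⟨hxy, hx⟩) ?_ hu.2).2
    exact SimpleGraph.ConnectedComponent.exact (hu.2.trans hv.2.symm)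
  · rintro u ⟨a, hu⟩ v huv
    exact ⟨huv, hu.2⟩

theorem PreGraph.exists_component_eq {G K : PreGraph} (hK : K ∈ G.comps) :
    ∃ c, G.component c = K := by
  obtain ⟨⟨⟨u, hu⟩, hconn⟩, hle, hcl⟩ := hK
  refine ⟨G.graph.connectedComponentMk u, PreGraph.ext' fun a b => ⟨?_, ?_⟩⟩
  · rintro ⟨hab, hau⟩
    have hr : G.graph.Reachable u a := (SimpleGraph.ConnectedComponent.exact hau).symm
    have hp : G.IsClosed K.graph.support := fun u hu v huv => (hcl u hu v huv).mem_support_right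
    exact hcl a (hp.reachable hcl hr hu).1 b hab
  · intro hab
    refine ⟨hle hab, SimpleGraph.ConnectedComponent.sound ?_⟩
    exact (hconn a hab.mem_support_left u hu).mono hle

/-- The ambient vertex set is infinite, so there are infinitely many isolated points among the
connected components, all giving the empty graph. Connectedness of `C` excludes them, and the
remaining components are determined by their subgraphs. -/
theorem PreGraph.mult_eq_ncard (G : PreGraph) {C : PLGraph} (hC : C.IsConnected) :
    G.mult C = {K ∈ G.comps | PLGraph.mk K = C}.ncard := by
  have hne : ∀ K : PreGraph, PLGraph.mk K = C → K.graph.support.Nonempty := by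
    rintro K rfl
    exact hC.1
  have himg : {K ∈ G.comps | PLGraph.mk K = C} =
      G.component '' {c | PLGraph.mk (G.component c) = C} := by
    ext K
    constructor
    · rintro ⟨hK, hKC⟩
      obtain ⟨c, rfl⟩ := PreGraph.exists_component_eq hK
      exact ⟨c, hKC, rfl⟩
    · rintro ⟨c, hc, rfl⟩
      exact ⟨PreGraph.component_mem_comps (hne _ hc), hc⟩
  rw [himg]
  refine (Set.InjOn.ncard_image ?_).symm
  intro c hc c' hc' hcc
  obtain ⟨u, v, huv⟩ := hne _ hc
  have huv' : (G.component c').graph.Adj u v := hcc ▸ huv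
  exact huv.2.symm.trans huv'.2

theorem PreGraph.union_comm' (G H : PreGraph) : G.union H = H.union G :=
  PreGraph.ext' fun _ _ => or_comm

theorem PreGraph.not_adj_of_disjoint {G H : PreGraph}
    (h : Disjoint G.graph.support H.graph.support) {u v : ℕ ⊕ ℕ} (hu : u ∈ G.graph.support) :
    ¬ H.graph.Adj u v :=
  fun huv => Set.disjoint_left.1 h hu huv.mem_support_left

theorem PreGraph.isClosed_union_left {G H : PreGraph}
    (h : Disjoint G.graph.support H.graph.support) : (G.union H).IsClosed G.graph.support := by
  rintro u hu v (huv | huv)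
  · exact huv.mem_support_right
  · exact absurd huv (PreGraph.not_adj_of_disjoint h hu)

theorem PreGraph.comps_subset_comps_union {G H : PreGraph}
    (h : Disjoint G.graph.support H.graph.support) : G.comps ⊆ (G.union H).comps := by
  rintro K ⟨h1, h2, h3⟩
  refine ⟨h1, fun u v huv => Or.inl (h2 huv), ?_⟩
  rintro u hu v (huv | huv)
  · exact h3 u hu v huv
  · exact absurd huv (PreGraph.not_adj_of_disjoint h (SimpleGraph.support_mono h2 hu))

theorem PreGraph.mem_comps_of_mem_support {G H K : PreGraph}
    (h : Disjoint G.graph.support H.graph.support) (hK : K ∈ (G.union H).comps) {u : ℕ ⊕ ℕ}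
    (hu : u ∈ K.graph.support) (huG : u ∈ G.graph.support) : K ∈ G.comps := by
  obtain ⟨h1, h2, h3⟩ := hK
  have hsub : ∀ v ∈ K.graph.support, v ∈ G.graph.support := fun v hv =>
    ((PreGraph.isClosed_union_left h).reachable (H := G.union H) (fun _ _ _ h => h)
      ((h1.2 u hu v hv).mono h2) huG).1
  refine ⟨h1, fun a b hab => ?_, fun a ha b hab => h3 a ha b (Or.inl hab)⟩
  exact (h2 hab).resolve_right
    (PreGraph.not_adj_of_disjoint h (hsub a hab.mem_support_left))

theorem PreGraph.comps_union {G H : PreGraph} (h : Disjoint G.graph.support H.graph.support) :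
    (G.union H).comps = G.comps ∪ H.comps := by
  refine Set.Subset.antisymm ?_ (Set.union_subset (PreGraph.comps_subset_comps_union h) ?_)
  · intro K hK
    obtain ⟨u, hu⟩ := hK.1.1
    have : u ∈ (G.union H).graph.support := SimpleGraph.support_mono hK.2.1 hu
    rw [PreGraph.union_support] at this
    rcases this with h' | h'
    · exact Or.inl (PreGraph.mem_comps_of_mem_support h hK hu h')
    · rw [PreGraph.union_comm'] at hK
      exact Or.inr (PreGraph.mem_comps_of_mem_support h.symm hK hu h')
  · rw [PreGraph.union_comm']
    exact PreGraph.comps_subset_comps_union h.symm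

theorem PreGraph.disjoint_comps {G H : PreGraph} (h : Disjoint G.graph.support H.graph.support) :
    Disjoint G.comps H.comps := by
  rw [Set.disjoint_left]
  intro K hK hK'
  obtain ⟨u, hu⟩ := hK.1.1
  exact Set.disjoint_left.1 h (SimpleGraph.support_mono hK.2.1 hu)
    (SimpleGraph.support_mono hK'.2.1 hu)

theorem PreGraph.mult_union {G H : PreGraph} (h : Disjoint G.graph.support H.graph.support)
    {C : PLGraph} (hC : C.IsConnected) : (G.union H).mult C = G.mult C + H.mult C := by
  rw [PreGraph.mult_eq_ncard _ hC, PreGraph.mult_eq_ncard _ hC, PreGraph.mult_eq_ncard _ hC,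
    PreGraph.comps_union h, ← Set.ncard_union_eq
      ((PreGraph.disjoint_comps h).mono (fun _ h => h.1) (fun _ h => h.1))
      (G.comps_finite.subset fun _ h => h.1) (H.comps_finite.subset fun _ h => h.1)]
  congr 1
  ext K
  simp only [Set.mem_union, Set.mem_ofPred_eq]
  tauto

theorem PreGraph.IsConnected.comps {K : PreGraph} (hK : K.IsConnected) : K.comps = {K} := by
  ext L
  constructor
  · rintro ⟨⟨⟨u, hu⟩, -⟩, h2, h3⟩
    refine (PreGraph.ext' fun a b => ⟨fun h => h2 h, fun hab => ?_⟩ : L = K)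
    refine h3 a ?_ b hab
    have hp : K.IsClosed L.graph.support := fun u hu v huv => (h3 u hu v huv).mem_support_right
    exact (hp.reachable h3 (hK.2 u (SimpleGraph.support_mono h2 hu) a hab.mem_support_left) hu).1
  · rintro rfl
    exact ⟨hK, le_rfl, fun _ _ _ h => h⟩

theorem PreGraph.IsConnected.mult {K : PreGraph} (hK : K.IsConnected) {C : PLGraph}
    (hC : C.IsConnected) [Decidable (PLGraph.mk K = C)] :
    K.mult C = if PLGraph.mk K = C then 1 else 0 := by
  rw [PreGraph.mult_eq_ncard _ hC, hK.comps]
  split_ifs with h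
  · rw [show {L ∈ ({K} : Set PreGraph) | PLGraph.mk L = C} = {K} by
      ext L
      simp only [Set.mem_ofPred_eq, Set.mem_singleton_iff]
      constructor
      · exact fun h => h.1
      · rintro rfl
        exact ⟨rfl, h⟩]
    exact Set.ncard_singleton K
  · rw [show {L ∈ ({K} : Set PreGraph) | PLGraph.mk L = C} = ∅ by
      ext L
      simp only [Set.mem_ofPred_eq, Set.mem_singleton_iff, Set.mem_empty_iff_false, iff_false]
      rintro ⟨rfl, h'⟩
      exact h h']
    exact Set.ncard_empty _

theorem PreGraph.graph_eq_bot_of_numEdges {G : PreGraph} (h : G.numEdges = 0) : G.graph = ⊥ := by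
  rw [PreGraph.numEdges, Set.ncard_eq_zero G.edgeSet_finite] at h
  exact SimpleGraph.edgeSet_eq_empty.1 h

theorem PreGraph.numEdges_pos {G : PreGraph} {u v : ℕ ⊕ ℕ} (h : G.graph.Adj u v) :
    0 < G.numEdges := by
  rw [PreGraph.numEdges, Set.ncard_pos G.edgeSet_finite]
  exact ⟨s(u, v), h⟩

theorem PreGraph.comps_nonempty {G : PreGraph} (h : G.numEdges ≠ 0) : G.comps.Nonempty := by
  rw [PreGraph.numEdges, Ne, Set.ncard_eq_zero G.edgeSet_finite, ← Ne,
    ← Set.nonempty_iff_ne_empty] at h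
  obtain ⟨e, he⟩ := h
  induction e using Sym2.ind with | h u v => ?_
  have huv : G.graph.Adj u v := he
  exact ⟨G.component (G.graph.connectedComponentMk u),
    PreGraph.component_mem_comps ⟨u, v, huv, rfl⟩⟩

theorem PreGraph.numEdges_union {G H : PreGraph} (h : Disjoint G.graph.support H.graph.support) :
    (G.union H).numEdges = G.numEdges + H.numEdges := by
  rw [PreGraph.numEdges, PreGraph.union, SimpleGraph.edgeSet_sup]
  refine Set.ncard_union_eq ?_ G.edgeSet_finite H.edgeSet_finite
  rw [SimpleGraph.disjoint_edgeSet]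
  exact SimpleGraph.disjoint_of_disjoint_support _ h

/-! ### Products of disjoint unions -/

/-- `A = A₁ ⊔ A₂` and `B = B₁ ⊔ B₂` are disjoint unions such that the gluing does not identify
vertices of `A₁` and `B₂`, or of `A₂` and `B₁`. -/
structure PreGraph.Splits (A₁ A₂ B₁ B₂ : PreGraph) : Prop where
  left : Disjoint A₁.graph.support A₂.graph.support
  right : Disjoint B₁.graph.support B₂.graph.support
  cross : ∀ i, Sum.inl i ∈ A₁.graph.support → Sum.inl i ∉ B₂.graph.support
  cross' : ∀ i, Sum.inl i ∈ A₂.graph.support → Sum.inl i ∉ B₁.graph.support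

theorem PreGraph.Splits.diag {A₁ A₂ : PreGraph} (h : Disjoint A₁.graph.support A₂.graph.support) :
    PreGraph.Splits A₁ A₂ A₁ A₂ :=
  ⟨h, h, fun _ h1 h2 => Set.disjoint_left.1 h h1 h2, fun _ h1 h2 => Set.disjoint_left.1 h h2 h1⟩

theorem PreGraph.union_mul_union (A₁ A₂ B₁ B₂ : PreGraph) :
    (A₁.union A₂).mul (B₁.union B₂) = (A₁.mul B₁).union (A₂.mul B₂) := by
  refine PreGraph.ext' fun x y => ?_
  simp only [PreGraph.union_adj, PreGraph.mul_eq_glue, PreGraph.glue_adj, or_and_right, exists_or]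
  exact or_or_or_comm ..

theorem PreGraph.Splits.disjoint {A₁ A₂ B₁ B₂ : PreGraph} (h : PreGraph.Splits A₁ A₂ B₁ B₂) :
    Disjoint (A₁.mul B₁).graph.support (A₂.mul B₂).graph.support := by
  rw [PreGraph.mul_eq_glue, PreGraph.mul_eq_glue, PreGraph.glue_support, PreGraph.glue_support,
    Set.disjoint_left]
  rintro _ (⟨u, hu, rfl⟩ | ⟨u, hu, rfl⟩) (⟨v, hv, huv⟩ | ⟨v, hv, huv⟩)
  · rw [evenName.injective huv] at hv
    exact Set.disjoint_left.1 h.left hu hv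
  · obtain ⟨i, rfl, rfl⟩ := evenName_eq_oddName.1 huv.symm
    exact h.cross i hu hv
  · obtain ⟨i, rfl, rfl⟩ := evenName_eq_oddName.1 huv
    exact h.cross' i hv hu
  · rw [oddName.injective huv] at hv
    exact Set.disjoint_left.1 h.right hu hv

theorem PreGraph.unlabel_union (G H : PreGraph) :
    (G.union H).unlabel = G.unlabel.union H.unlabel := by
  refine PreGraph.ext' fun x y => ?_
  simp only [PreGraph.unlabel, PreGraph.union_adj, PreGraph.rename_adj, or_and_right, exists_or]

theorem PreGraph.disjoint_unlabel {G H : PreGraph}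
    (h : Disjoint G.graph.support H.graph.support) :
    Disjoint G.unlabel.graph.support H.unlabel.graph.support := by
  simp only [PreGraph.unlabel, PreGraph.rename_support]
  exact (Set.disjoint_image_iff forgetLabel.injective).2 h

theorem PreGraph.isConnected_rename {f : (ℕ ⊕ ℕ) ↪ (ℕ ⊕ ℕ)} {G : PreGraph} (h : G.IsConnected) :
    (G.rename f).IsConnected := by
  obtain ⟨h1, h2⟩ := h
  rw [PreGraph.IsConnected, PreGraph.rename_support]
  refine ⟨h1.image f, ?_⟩
  rintro _ ⟨u, hu, rfl⟩ _ ⟨v, hv, rfl⟩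
  let φ : G.graph →g (G.rename f).graph := ⟨f, fun h => PreGraph.rename_adj_apply.2 h⟩
  exact (h2 u hu v hv).map φ

/-- Induction over the connected components of a gluing product. -/
theorem PreGraph.mul_induction {P : PreGraph → PreGraph → Prop}
    (hempty : ∀ A B : PreGraph, A.graph = ⊥ → B.graph = ⊥ → P A B)
    (hconn : ∀ A B : PreGraph, (A.mul B).IsConnected → P A B)
    (hsplit : ∀ A₁ A₂ B₁ B₂ : PreGraph, PreGraph.Splits A₁ A₂ B₁ B₂ → P A₁ B₁ → P A₂ B₂ →
      P (A₁.union A₂) (B₁.union B₂)) (A B : PreGraph) : P A B := by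
  induction hn : A.numEdges + B.numEdges using Nat.strong_induction_on generalizing A B with
  | _ n ih =>
  subst hn
  by_cases h0 : (A.mul B).numEdges = 0
  · have hb := PreGraph.graph_eq_bot_of_numEdges h0
    refine hempty A B ?_ ?_
    · ext u v
      simp only [SimpleGraph.bot_adj, iff_false]
      intro huv
      have : (A.mul B).graph.Adj (evenName u) (evenName v) :=
        PreGraph.glue_adj.2 (Or.inl ⟨u, v, huv, rfl, rfl⟩)
      rw [hb] at this
      exact this
    · ext u v
      simp only [SimpleGraph.bot_adj, iff_false]
      intro huv
      have : (A.mul B).graph.Adj (oddName u) (oddName v) :=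
        PreGraph.glue_adj.2 (Or.inr ⟨u, v, huv, rfl, rfl⟩)
      rw [hb] at this
      exact this
  obtain ⟨K, hK⟩ := PreGraph.comps_nonempty h0
  have hcl := PreGraph.isClosed_support_of_mem_comps hK
  -- The traces of a component `K` on the two factors are unions of components and contain the same
  -- labels. Cutting along them therefore splits the product, and the first halves multiply to `K`.
  set p : Set (ℕ ⊕ ℕ) := evenName ⁻¹' K.graph.support with hp
  set q : Set (ℕ ⊕ ℕ) := oddName ⁻¹' K.graph.support with hq
  have hpA : A.IsClosed p := fun u hu v huv =>
    hcl _ hu _ (PreGraph.glue_adj.2 (Or.inl ⟨u, v, huv, rfl, rfl⟩))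
  have hqB : B.IsClosed q := fun u hu v huv =>
    hcl _ hu _ (PreGraph.glue_adj.2 (Or.inr ⟨u, v, huv, rfl, rfl⟩))
  have hs : PreGraph.Splits (A.restrict p) (A.restrict pᶜ) (B.restrict q) (B.restrict qᶜ) := by
    refine ⟨A.disjoint_restrict p, B.disjoint_restrict q, fun i h1 h2 => ?_, fun i h1 h2 => ?_⟩
    · exact (B.restrict_support_subset _ h2).2 (A.restrict_support_subset _ h1).2
    · exact (A.restrict_support_subset _ h1).2 (B.restrict_support_subset _ h2).2
  have hK' : (A.restrict p).mul (B.restrict q) = K := by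
    refine PreGraph.ext' fun x y => ?_
    rw [PreGraph.mul_eq_glue, PreGraph.glue_adj]
    constructor
    · rintro (⟨u, v, huv, rfl, rfl⟩ | ⟨u, v, huv, rfl, rfl⟩)
      · exact hK.2.2 _ huv.2.1 _ (PreGraph.glue_adj.2 (Or.inl ⟨u, v, huv.1, rfl, rfl⟩))
      · exact hK.2.2 _ huv.2.1 _ (PreGraph.glue_adj.2 (Or.inr ⟨u, v, huv.1, rfl, rfl⟩))
    · intro hxy
      have hxy' := hK.2.1 hxy
      rcases PreGraph.glue_adj.1 hxy' with ⟨u, v, huv, rfl, rfl⟩ | ⟨u, v, huv, rfl, rfl⟩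
      · exact Or.inl ⟨u, v, ⟨huv, hxy.mem_support_left, hxy.mem_support_right⟩, rfl, rfl⟩
      · exact Or.inr ⟨u, v, ⟨huv, hxy.mem_support_left, hxy.mem_support_right⟩, rfl, rfl⟩
  have hA := hpA.union_restrict
  have hB := hqB.union_restrict
  have h1 : P (A.restrict p) (B.restrict q) := by
    refine hconn _ _ ?_
    rw [hK']
    exact hK.1
  have h2 : P (A.restrict pᶜ) (B.restrict qᶜ) := by
    refine ih _ ?_ _ _ rfl
    have e1 := PreGraph.numEdges_union hs.left
    have e2 := PreGraph.numEdges_union hs.right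
    rw [hA] at e1
    rw [hB] at e2
    -- `K` has an edge, which comes from one of the factors, so the complementary pair has fewer
    -- edges.
    have h3 : 0 < (A.restrict p).numEdges + (B.restrict q).numEdges := by
      obtain ⟨x, y, hxy⟩ := hK.1.1
      rw [← hK', PreGraph.mul_eq_glue] at hxy
      rcases PreGraph.glue_adj.1 hxy with ⟨u, v, huv, -⟩ | ⟨u, v, huv, -⟩
      · have := PreGraph.numEdges_pos huv
        omega
      · have := PreGraph.numEdges_pos huv
        omega
    omega
  have := hsplit _ _ _ _ hs h1 h2
  rwa [hA, hB] at this

/-! ### Monomials -/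

theorem toMonomial_union (d : ℕ) {G H : PreGraph}
    (h : Disjoint G.graph.support H.graph.support) :
    toMonomial d (PLGraph.mk (G.union H)) =
      toMonomial d (PLGraph.mk G) * toMonomial d (PLGraph.mk H) := by
  rw [toMonomial, toMonomial, toMonomial,
    ← finprod_mul_distrib (Set.toFinite _) (Set.toFinite _)]
  refine finprod_congr fun C => ?_
  rw [← pow_add]
  congr 1
  exact PreGraph.mult_union h C.2.1

theorem toMonomial_splits (d : ℕ) {A₁ A₂ B₁ B₂ : PreGraph} (h : PreGraph.Splits A₁ A₂ B₁ B₂) :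
    toMonomial d (PLGraph.mk (A₁.union A₂) * PLGraph.mk (B₁.union B₂)).unlabel =
      toMonomial d (PLGraph.mk A₁ * PLGraph.mk B₁).unlabel *
        toMonomial d (PLGraph.mk A₂ * PLGraph.mk B₂).unlabel := by
  simp only [PLGraph.mk_mul_mk, PLGraph.unlabel_mk, PreGraph.union_mul_union,
    PreGraph.unlabel_union]
  exact toMonomial_union d (PreGraph.disjoint_unlabel h.disjoint)

theorem toMonomial_of_mem (d : ℕ) {C : PLGraph} (hC : C ∈ V d) :
    toMonomial d C = MvPolynomial.X ⟨C, hC⟩ := by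
  classical
  rw [toMonomial, finprod_eq_single _ ⟨C, hC⟩]
  · induction C using PLGraph.ind with | h K => ?_
    have : (PLGraph.mk K).mult (PLGraph.mk K) = 1 := by
      show K.mult _ = 1
      rw [PreGraph.IsConnected.mult hC.1 hC.1, if_pos rfl]
    rw [this, pow_one]
  · intro C' hne
    induction C using PLGraph.ind with | h K => ?_
    have : (PLGraph.mk K).mult C' = 0 := by
      show K.mult _ = 0
      rw [PreGraph.IsConnected.mult hC.1 C'.2.1, if_neg]
      exact fun h => hne (Subtype.ext h.symm)
    rw [this, pow_zero]

theorem toMonomial_of_graph_eq_bot (d : ℕ) {G : PreGraph} (h : G.graph = ⊥) :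
    toMonomial d (PLGraph.mk G) = 1 := by
  rw [toMonomial]
  refine finprod_eq_one_of_forall_eq_one fun C => ?_
  have : (PLGraph.mk G).mult C = 0 := by
    show G.mult _ = 0
    rw [PreGraph.mult_eq_ncard _ C.2.1, show {K ∈ G.comps | PLGraph.mk K = C} = ∅ by
      ext K
      simp only [Set.mem_ofPred_eq, Set.mem_empty_iff_false, iff_false]
      rintro ⟨hK, -⟩
      obtain ⟨u, hu⟩ := hK.1.1
      have := SimpleGraph.support_mono hK.2.1 hu
      simp [h] at this]
    exact Set.ncard_empty _
  rw [this, pow_zero]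

/-! ### Homomorphism densities in finite relational targets -/

section Dens

variable {X : Type} [Fintype X] [Nonempty X] (R : X → X → Prop)

/-- The maps from the vertices of `G` to `X` that send edges to related pairs. -/
abbrev Homs {W : Type} (G : SimpleGraph W) : Type :=
  {f : W → X // ∀ u v, G.Adj u v → R (f u) (f v)}

/-- The homomorphism density of `G` in the relation `R`. -/
noncomputable def PreGraph.dens (G : PreGraph) : ℝ :=
  (Nat.card (Homs R (G.graph.induce G.graph.support)) : ℝ) /
    (Fintype.card X : ℝ) ^ G.graph.support.ncard

instance (G : PreGraph) : Finite G.graph.support := G.finite_support.to_subtype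

/-- Homs from a graph with additional isolated vertices. -/
noncomputable def homsEquiv (G : PreGraph) {W : Type} (j : W ↪ (ℕ ⊕ ℕ))
    (hj : G.graph.support ⊆ Set.range j) :
    Homs R (G.graph.comap j) ≃
      Homs R (G.graph.induce G.graph.support) × ({w : W // j w ∉ G.graph.support} → X) := by
  classical
  exact
  { toFun := fun f => (⟨fun s => f.1 (hj s.2).choose, fun u v huv => f.2 _ _ (by
        rw [SimpleGraph.comap_adj, (hj u.2).choose_spec, (hj v.2).choose_spec]
        exact huv)⟩, fun w => f.1 w)
    invFun := fun p => ⟨fun w => if hw : j w ∈ G.graph.support then p.1.1 ⟨j w, hw⟩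
      else p.2 ⟨w, hw⟩, fun u v huv => by
        have huv : G.graph.Adj (j u) (j v) := huv
        simp only [dif_pos huv.mem_support_left, dif_pos huv.mem_support_right]
        exact p.1.2 _ _ huv⟩
    left_inv := fun f => by
      refine Subtype.ext (funext fun w => ?_)
      by_cases hw : j w ∈ G.graph.support
      · simp only [dif_pos hw]
        rw [j.injective (hj hw).choose_spec]
      · simp only [dif_neg hw]
    right_inv := fun p => by
      refine Prod.ext (Subtype.ext (funext fun s => ?_)) (funext fun w => ?_)
      · have := (hj s.2).choose_spec
        simp only [this, s.2, dif_pos]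
      · simp only [dif_neg w.2] }

/-- Each additional isolated vertex multiplies both the number of maps and the normalization by
`|X|`. Densities can thus be computed on any convenient finite vertex set. -/
theorem PreGraph.dens_eq (G : PreGraph) {W : Type} [Finite W] (j : W ↪ (ℕ ⊕ ℕ))
    (hj : G.graph.support ⊆ Set.range j) :
    G.dens R = (Nat.card (Homs R (G.graph.comap j)) : ℝ) / (Fintype.card X : ℝ) ^ Nat.card W := by
  classical
  have h0 : (Fintype.card X : ℝ) ≠ 0 := by
    exact_mod_cast Fintype.card_ne_zero
  have hW : Nat.card W = G.graph.support.ncard + Nat.card {w : W // j w ∉ G.graph.support} := by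
    have e1 : {w : W // j w ∈ G.graph.support} ≃ G.graph.support :=
      { toFun := fun w => ⟨j w, w.2⟩
        invFun := fun s => ⟨(hj s.2).choose, by rw [(hj s.2).choose_spec]; exact s.2⟩
        left_inv := fun w => Subtype.ext (j.injective (hj w.2).choose_spec)
        right_inv := fun s => Subtype.ext (hj s.2).choose_spec }
    rw [← Nat.card_congr (Equiv.sumCompl (fun w => j w ∈ G.graph.support)), Nat.card_sum,
      Nat.card_congr e1]
    rfl
  rw [Nat.card_congr (homsEquiv R G j hj), Nat.card_prod, Nat.card_fun, hW, PreGraph.dens, pow_add,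
    Nat.card_eq_fintype_card (α := X)]
  push_cast
  field_simp

theorem PreGraph.IsImage.dens {f : ℕ ⊕ ℕ → ℕ ⊕ ℕ} {G H : PreGraph} (h : G.IsImage f H) :
    G.dens R = H.dens R := by
  obtain ⟨hinj, hadj⟩ := h
  let j : G.graph.support ↪ (ℕ ⊕ ℕ) := ⟨fun s => f s, fun a b hab =>
    Subtype.ext (hinj a.2 b.2 hab)⟩
  have hj : H.graph.support ⊆ Set.range j := by
    rintro x ⟨y, hxy⟩
    obtain ⟨u, v, huv, rfl, rfl⟩ := (hadj x y).1 hxy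
    exact ⟨⟨u, huv.mem_support_left⟩, rfl⟩
  rw [PreGraph.dens_eq R H j hj, PreGraph.dens]
  have : H.graph.comap j = G.graph.induce G.graph.support := by
    ext a b
    simp only [SimpleGraph.comap_adj, hadj]
    constructor
    · rintro ⟨u, v, huv, hu, hv⟩
      have hu : f u = f a := hu
      have hv : f v = f b := hv
      have e1 := hinj huv.mem_support_left a.2 hu
      have e2 := hinj huv.mem_support_right b.2 hv
      show G.graph.Adj a b
      rwa [← e1, ← e2]
    · intro hab
      exact ⟨a, b, hab, rfl, rfl⟩
  rw [this]
  rfl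

theorem PreGraph.dens_rename (f : (ℕ ⊕ ℕ) ↪ (ℕ ⊕ ℕ)) (G : PreGraph) :
    (G.rename f).dens R = G.dens R :=
  ((PreGraph.isImage_rename f G).dens R).symm

theorem PreGraph.Iso.dens {G H : PreGraph} (h : G.Iso H) : G.dens R = H.dens R := by
  obtain ⟨σ, hσ⟩ := h
  refine PreGraph.IsImage.dens R (f := Sum.map id σ) ⟨(rename_bijective σ).1.injOn, fun x y => ?_⟩
  constructor
  · intro hxy
    obtain ⟨u, rfl⟩ := (rename_bijective σ).2 x
    obtain ⟨v, rfl⟩ := (rename_bijective σ).2 y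
    exact ⟨u, v, (hσ u v).1 hxy, rfl, rfl⟩
  · rintro ⟨u, v, huv, rfl, rfl⟩
    exact (hσ u v).2 huv

/-- The homomorphism density of an isomorphism class. -/
noncomputable def PLGraph.dens (H : PLGraph) : ℝ :=
  Quotient.lift (fun G : PreGraph => G.dens R) (fun _ _ h => PreGraph.Iso.dens R h) H

theorem PLGraph.dens_mk (G : PreGraph) : (PLGraph.mk G).dens R = G.dens R := rfl

theorem PreGraph.dens_union {G H : PreGraph} (h : Disjoint G.graph.support H.graph.support) :
    (G.union H).dens R = G.dens R * H.dens R := by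
  let j : G.graph.support ⊕ H.graph.support ↪ (ℕ ⊕ ℕ) :=
    ⟨Sum.elim Subtype.val Subtype.val, Subtype.val_injective.sumElim Subtype.val_injective
      fun a b hab => Set.disjoint_left.1 h a.2 (hab ▸ b.2)⟩
  have hj : (G.union H).graph.support ⊆ Set.range j := by
    rw [PreGraph.union_support]
    rintro x (hx | hx)
    · exact ⟨Sum.inl ⟨x, hx⟩, rfl⟩
    · exact ⟨Sum.inr ⟨x, hx⟩, rfl⟩
  have e : Homs R ((G.union H).graph.comap j) ≃
      Homs R (G.graph.induce G.graph.support) × Homs R (H.graph.induce H.graph.support) :=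
    { toFun := fun f => (⟨fun s => f.1 (Sum.inl s), fun u v huv => f.2 _ _ (Or.inl huv)⟩,
        ⟨fun s => f.1 (Sum.inr s), fun u v huv => f.2 _ _ (Or.inr huv)⟩)
      invFun := fun p => ⟨Sum.elim p.1.1 p.2.1, by
        rintro (a | a) (b | b) (hab | hab)
        · exact p.1.2 _ _ hab
        · exact absurd hab (PreGraph.not_adj_of_disjoint h a.2)
        · have hab : G.graph.Adj a b := hab
          exact absurd hab.symm (PreGraph.not_adj_of_disjoint h.symm b.2)
        · exact absurd hab (PreGraph.not_adj_of_disjoint h a.2)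
        · exact absurd hab (PreGraph.not_adj_of_disjoint h.symm a.2)
        · have hab : H.graph.Adj a b := hab
          exact absurd hab.symm (PreGraph.not_adj_of_disjoint h b.2)
        · exact absurd hab (PreGraph.not_adj_of_disjoint h.symm a.2)
        · exact p.2.2 _ _ hab⟩
      left_inv := fun f => Subtype.ext (funext fun s => by rcases s with s | s <;> rfl)
      right_inv := fun p => rfl }
  rw [PreGraph.dens_eq R _ j hj, Nat.card_congr e, Nat.card_prod, Nat.card_sum, pow_add,
    Nat.cast_mul, mul_div_mul_comm]
  rfl

theorem PreGraph.dens_of_graph_eq_bot {G : PreGraph} (h : G.graph = ⊥) : G.dens R = 1 := by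
  let j : Empty ↪ (ℕ ⊕ ℕ) := ⟨Empty.elim, fun a => a.elim⟩
  have : Nat.card (Homs R (G.graph.comap j)) = 1 := by
    rw [Nat.card_eq_one_iff_unique]
    exact ⟨⟨fun f g => Subtype.ext (funext fun a => a.elim)⟩, ⟨⟨fun a => a.elim, fun a => a.elim⟩⟩⟩
  rw [PreGraph.dens_eq R G j (by simp [h]), this]
  simp

theorem PreGraph.dens_nonneg (G : PreGraph) : 0 ≤ G.dens R := by
  rw [PreGraph.dens]; positivity

theorem PreGraph.dens_le_one (G : PreGraph) : G.dens R ≤ 1 := by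
  rw [PreGraph.dens]
  refine div_le_one_of_le₀ ?_ (by positivity)
  have h1 : Nat.card (Homs R (G.graph.induce G.graph.support)) ≤
      Nat.card (G.graph.support → X) := Nat.card_le_card_of_injective _ Subtype.val_injective
  rw [Nat.card_fun, Nat.card_eq_fintype_card (α := X)] at h1
  exact_mod_cast h1

/-- A loop at `x` makes the constant map a homomorphism. Positivity is what later allows logarithms
of density vectors. -/
theorem PreGraph.dens_pos (G : PreGraph) {x : X} (hx : R x x) : 0 < G.dens R := by
  have : Nonempty (Homs R (G.graph.induce G.graph.support)) := ⟨⟨fun _ => x, fun _ _ _ => hx⟩⟩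
  have h1 : 0 < Nat.card (Homs R (G.graph.induce G.graph.support)) := Nat.card_pos
  have h2 : 0 < Fintype.card X := Fintype.card_pos
  rw [PreGraph.dens]; positivity

theorem PLGraph.dens_nonneg (H : PLGraph) : 0 ≤ H.dens R := by
  induction H using PLGraph.ind with | h G => exact G.dens_nonneg R

theorem PLGraph.dens_le_one (H : PLGraph) : H.dens R ≤ 1 := by
  induction H using PLGraph.ind with | h G => exact G.dens_le_one R

theorem PLGraph.dens_pos (H : PLGraph) {x : X} (hx : R x x) : 0 < H.dens R := by
  induction H using PLGraph.ind with | h G => exact G.dens_pos R hx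

theorem PreGraph.density_eq_dens (G : PreGraph) {n : ℕ} (T : SimpleGraph (Fin n)) [NeZero n] :
    G.density T = G.dens T.Adj := by
  have e : (G.graph.induce G.graph.support →g T) ≃
      Homs T.Adj (G.graph.induce G.graph.support) :=
    { toFun := fun f => ⟨f, fun _ _ h => f.map_rel h⟩
      invFun := fun f => ⟨f.1, fun {_ _} h => f.2 _ _ h⟩
      left_inv := fun f => rfl
      right_inv := fun f => rfl }
  rw [PreGraph.density, PreGraph.dens, Nat.card_congr e, Fintype.card_fin]

theorem PLGraph.density_eq_dens (H : PLGraph) {n : ℕ} (T : SimpleGraph (Fin n)) [NeZero n] :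
    H.density T = H.dens T.Adj := by
  induction H using PLGraph.ind with | h G => exact G.density_eq_dens T

theorem PLGraph.dens_unlabel (H : PLGraph) : H.unlabel.dens R = H.dens R := by
  induction H using PLGraph.ind with | h G => exact G.dens_rename R _

/-- The monomial of `[[AB]]` takes the density of `[[AB]]` as its value at the density vector. -/
theorem eval_dens_toMonomial (d : ℕ) (A B : PLGraph) (hA : A.numEdges ≤ d) (hB : B.numEdges ≤ d) :
    MvPolynomial.eval (fun C : V d => C.1.dens R) (toMonomial d (A * B).unlabel) =
      (A * B).unlabel.dens R := by
  induction A using PLGraph.ind with | h A => ?_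
  induction B using PLGraph.ind with | h B => ?_
  induction A, B using PreGraph.mul_induction with
  | hempty A B h1 h2 =>
    have : (A.mul B).unlabel.graph = ⊥ := by
      ext x y
      simp [PreGraph.unlabel, PreGraph.rename_adj, PreGraph.mul_eq_glue, PreGraph.glue_adj, h1, h2]
    rw [PLGraph.mk_mul_mk, PLGraph.unlabel_mk, toMonomial_of_graph_eq_bot d this, PLGraph.dens_mk,
      PreGraph.dens_of_graph_eq_bot R this, map_one]
  | hconn A B h =>
    rw [toMonomial_of_mem d (C := (PLGraph.mk A * PLGraph.mk B).unlabel)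
      ⟨PreGraph.isConnected_rename h, _, _, hA, hB, rfl⟩, MvPolynomial.eval_X]
  | hsplit A₁ A₂ B₁ B₂ hs ih1 ih2 =>
    have eA := PreGraph.numEdges_union hs.left
    have eB := PreGraph.numEdges_union hs.right
    have hA : (A₁.union A₂).numEdges ≤ d := hA
    have hB : (B₁.union B₂).numEdges ≤ d := hB
    have hA1 : A₁.numEdges ≤ d := by omega
    have hA2 : A₂.numEdges ≤ d := by omega
    have hB1 : B₁.numEdges ≤ d := by omega
    have hB2 : B₂.numEdges ≤ d := by omega
    rw [toMonomial_splits d hs, map_mul, ih1 hA1 hB1, ih2 hA2 hB2]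
    simp only [PLGraph.dens_unlabel, PLGraph.mk_mul_mk, PreGraph.union_mul_union, PLGraph.dens_mk]
    rw [PreGraph.dens_union R hs.disjoint]

/-! ### Densities of products -/

/-- The unlabeled vertices. -/
abbrev PreGraph.Unl (A : PreGraph) : Type := {k : ℕ // Sum.inr k ∈ A.graph.support}

instance (A : PreGraph) : Finite A.Unl :=
  (A.finite_support.preimage Sum.inr_injective.injOn).to_subtype

/-- The possible vertices, for graphs with labels less than `N`. -/
def PreGraph.vert (N : ℕ) (A : PreGraph) : Fin N ⊕ A.Unl → ℕ ⊕ ℕ :=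
  Sum.map Fin.val Subtype.val

/-- The homomorphisms that extend a given map on the labels. -/
abbrev PreGraph.Ext (A : PreGraph) {N : ℕ} (φ : Fin N → X) : Type :=
  {f : A.Unl → X // ∀ u v, A.graph.Adj (A.vert N u) (A.vert N v) →
    R (Sum.elim φ f u) (Sum.elim φ f v)}

theorem PreGraph.exists_vert {A : PreGraph} {N : ℕ} (hA : ∀ i ∈ A.labels, i < N) {x : ℕ ⊕ ℕ}
    (hx : x ∈ A.graph.support) : ∃ u, A.vert N u = x := by
  rcases x with i | k
  · exact ⟨Sum.inl ⟨i, hA i hx⟩, rfl⟩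
  · exact ⟨Sum.inr ⟨k, hx⟩, rfl⟩

/-- Once the images `φ` of the labels are fixed, the unlabeled vertices of `A` and of `B` are mapped
independently. The average over `φ` exhibits the matrix of densities as a Gram matrix. Placing all
`N` labels, whether they occur or not, gives every pair the same average. -/
theorem PreGraph.dens_mul {A B : PreGraph} {N : ℕ} (hA : ∀ i ∈ A.labels, i < N)
    (hB : ∀ i ∈ B.labels, i < N) :
    (A.mul B).dens R = ((Fintype.card X : ℝ) ^ N)⁻¹ * ∑ φ : Fin N → X,
      ((Nat.card (A.Ext R φ) : ℝ) / (Fintype.card X : ℝ) ^ Nat.card A.Unl) *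
      ((Nat.card (B.Ext R φ) : ℝ) / (Fintype.card X : ℝ) ^ Nat.card B.Unl) := by
  classical
  let j₀ : Fin N ⊕ (A.Unl ⊕ B.Unl) → ℕ ⊕ ℕ :=
    Sum.elim (fun i => Sum.inl i)
      (Sum.elim (fun a => evenName (Sum.inr a.1)) (fun b => oddName (Sum.inr b.1)))
  have hj₀ : Function.Injective j₀ := by
    refine Function.Injective.sumElim (fun a b h => Fin.ext (Sum.inl_injective h))
      (Function.Injective.sumElim ?_ ?_ ?_) ?_
    · exact fun a b h => Subtype.ext (Sum.inr_injective (evenName.injective h))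
    · exact fun a b h => Subtype.ext (Sum.inr_injective (oddName.injective h))
    · intro a b h
      obtain ⟨i, hi, -⟩ := evenName_eq_oddName.1 h
      simp at hi
    · rintro a (b | b) h
      · simp [evenName_inr] at h
      · simp [oddName_inr] at h
  let j : Fin N ⊕ (A.Unl ⊕ B.Unl) ↪ (ℕ ⊕ ℕ) := ⟨j₀, hj₀⟩
  let iA : Fin N ⊕ A.Unl → Fin N ⊕ (A.Unl ⊕ B.Unl) := Sum.map id Sum.inl
  let iB : Fin N ⊕ B.Unl → Fin N ⊕ (A.Unl ⊕ B.Unl) := Sum.map id Sum.inr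
  have hiA : ∀ u, j (iA u) = evenName (A.vert N u) := by rintro (u | u) <;> rfl
  have hiB : ∀ u, j (iB u) = oddName (B.vert N u) := by rintro (u | u) <;> rfl
  have hj : (A.mul B).graph.support ⊆ Set.range j := by
    rw [PreGraph.mul_eq_glue, PreGraph.glue_support]
    rintro _ (⟨x, hx, rfl⟩ | ⟨x, hx, rfl⟩)
    · obtain ⟨u, rfl⟩ := PreGraph.exists_vert hA hx
      exact ⟨iA u, hiA u⟩
    · obtain ⟨u, rfl⟩ := PreGraph.exists_vert hB hx
      exact ⟨iB u, hiB u⟩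
  have hsumA : ∀ (φ : Fin N → X) (f : A.Unl → X) (g : B.Unl → X) u,
      Sum.elim φ (Sum.elim f g) (iA u) = Sum.elim φ f u := by
    rintro φ f g (u | u) <;> rfl
  have hsumB : ∀ (φ : Fin N → X) (f : A.Unl → X) (g : B.Unl → X) u,
      Sum.elim φ (Sum.elim f g) (iB u) = Sum.elim φ g u := by
    rintro φ f g (u | u) <;> rfl
  have e : Homs R ((A.mul B).graph.comap j) ≃ Σ φ : Fin N → X, A.Ext R φ × B.Ext R φ :=
    { toFun := fun f => ⟨fun i => f.1 (Sum.inl i),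
        ⟨fun a => f.1 (Sum.inr (Sum.inl a)), fun u v huv => by
          have h := f.2 (iA u) (iA v) (by
            rw [SimpleGraph.comap_adj, hiA, hiA]
            exact PreGraph.glue_adj.2 (Or.inl ⟨_, _, huv, rfl, rfl⟩))
          rcases u with u | u <;> rcases v with v | v <;> exact h⟩,
        ⟨fun b => f.1 (Sum.inr (Sum.inr b)), fun u v huv => by
          have h := f.2 (iB u) (iB v) (by
            rw [SimpleGraph.comap_adj, hiB, hiB]
            exact PreGraph.glue_adj.2 (Or.inr ⟨_, _, huv, rfl, rfl⟩))
          rcases u with u | u <;> rcases v with v | v <;> exact h⟩⟩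
      invFun := fun p => ⟨Sum.elim p.1 (Sum.elim p.2.1.1 p.2.2.1), fun x y hxy => by
        rcases PreGraph.glue_adj.1 hxy with ⟨a, b, hab, ha, hb⟩ | ⟨a, b, hab, ha, hb⟩
        · obtain ⟨u, rfl⟩ := PreGraph.exists_vert hA hab.mem_support_left
          obtain ⟨v, rfl⟩ := PreGraph.exists_vert hA hab.mem_support_right
          rw [← hiA] at ha hb
          rw [← j.injective ha, ← j.injective hb, hsumA, hsumA]
          exact p.2.1.2 u v hab
        · obtain ⟨u, rfl⟩ := PreGraph.exists_vert hB hab.mem_support_left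
          obtain ⟨v, rfl⟩ := PreGraph.exists_vert hB hab.mem_support_right
          rw [← hiB] at ha hb
          rw [← j.injective ha, ← j.injective hb, hsumB, hsumB]
          exact p.2.2.2 u v hab⟩
      left_inv := fun f => Subtype.ext (funext fun s => by rcases s with s | s | s <;> rfl)
      right_inv := fun p => rfl }
  rw [PreGraph.dens_eq R _ j hj, Nat.card_congr e, Nat.card_sigma, Nat.card_sum, Nat.card_sum,
    Nat.card_eq_fintype_card (α := Fin N), Fintype.card_fin]
  simp only [Nat.card_prod]
  push_cast
  rw [Finset.sum_div, Finset.mul_sum]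
  refine Finset.sum_congr rfl fun φ _ => ?_
  rw [pow_add, pow_add]
  have h0 : (Fintype.card X : ℝ) ≠ 0 := by
    exact_mod_cast Fintype.card_ne_zero
  field_simp

theorem PLGraph.dens_unlabel_mul {A B : PreGraph} {N : ℕ} (hA : ∀ i ∈ A.labels, i < N)
    (hB : ∀ i ∈ B.labels, i < N) :
    (PLGraph.mk A * PLGraph.mk B).unlabel.dens R =
      ((Fintype.card X : ℝ) ^ N)⁻¹ * ∑ φ : Fin N → X,
      ((Nat.card (A.Ext R φ) : ℝ) / (Fintype.card X : ℝ) ^ Nat.card A.Unl) *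
      ((Nat.card (B.Ext R φ) : ℝ) / (Fintype.card X : ℝ) ^ Nat.card B.Unl) := by
  rw [PLGraph.dens_unlabel, PLGraph.mk_mul_mk, PLGraph.dens_mk, PreGraph.dens_mul R hA hB]

end Dens

/-! ### The moment form -/

/-- The entry `[[AB]]` of the moment matrix, evaluated at `v`. -/
noncomputable def gram (d : ℕ) (v : V d → ℝ) (A B : PLGraph) : ℝ :=
  MvPolynomial.eval v (toMonomial d (A * B).unlabel)

theorem gram_comm (d : ℕ) (v : V d → ℝ) (A B : PLGraph) : gram d v A B = gram d v B A := by
  rw [gram, gram, PLGraph.unlabel_mul_comm]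

/-- The bilinear moment form. -/
noncomputable def momentForm (d : ℕ) (v : V d → ℝ) (a b : PLGraph →₀ ℝ) : ℝ :=
  Finsupp.linearCombination ℝ (fun A => Finsupp.linearCombination ℝ (gram d v A) b) a

theorem momentForm_sum_single (d : ℕ) (v : V d → ℝ) {ι : Type} (s : Finset ι) (x : ι → ℝ)
    (A : ι → PLGraph) :
    momentForm d v (∑ i ∈ s, Finsupp.single (A i) (x i)) (∑ i ∈ s, Finsupp.single (A i) (x i)) =
      ∑ i ∈ s, ∑ j ∈ s, x i * x j * gram d v (A i) (A j) := by
  simp only [momentForm, map_sum, Finsupp.linearCombination_single, smul_eq_mul, Finset.mul_sum,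
    mul_assoc]

theorem momentForm_self (d : ℕ) (v : V d → ℝ) (a : PLGraph →₀ ℝ) :
    momentForm d v a a =
      ∑ A ∈ a.support, ∑ B ∈ a.support, a A * a B * gram d v A B := by
  conv_lhs => rw [← Finsupp.sum_single a]
  exact momentForm_sum_single d v a.support a id

/-- The moment form is positive semidefinite on combinations of graphs with the property `p`. -/
def GramPos (d : ℕ) (v : V d → ℝ) (p : PLGraph → Prop) : Prop :=
  ∀ a : PLGraph →₀ ℝ, (∀ A ∈ a.support, p A) → 0 ≤ momentForm d v a a

/-- The graphs `A i` need not be distinct. This matters because removing labels or components may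
produce coincidences. -/
theorem GramPos.family {d : ℕ} {v : V d → ℝ} {p : PLGraph → Prop} (h : GramPos d v p)
    {ι : Type} (s : Finset ι) (x : ι → ℝ) (A : ι → PLGraph) (hA : ∀ i ∈ s, p (A i)) :
    0 ≤ ∑ i ∈ s, ∑ j ∈ s, x i * x j * gram d v (A i) (A j) := by
  classical
  rw [← momentForm_sum_single]
  refine h _ fun B hB => ?_
  obtain ⟨i, hi, hiB⟩ := Finset.mem_biUnion.1 (Finsupp.support_finsetSum hB)
  rw [Finset.mem_singleton.1 (Finsupp.support_single_subset hiB)]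
  exact hA i hi

theorem eval_toPolynomial (d : ℕ) (v : V d → ℝ) (a : GraphComb) :
    MvPolynomial.eval v (toPolynomial d a) =
      Finsupp.linearCombination ℝ (fun H => MvPolynomial.eval v (toMonomial d H)) a.coeff := by
  rw [toPolynomial, Finsupp.linearCombination_apply, Finsupp.sum, Finsupp.sum, map_sum]
  simp

theorem eval_toPolynomial_sq (d : ℕ) (v : V d → ℝ) (a : GraphComb) :
    MvPolynomial.eval v (toPolynomial d (unlabelComb (a * a))) = momentForm d v a.coeff a.coeff := by
  rw [eval_toPolynomial, unlabelComb, MonoidAlgebra.mapDomain]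
  show Finsupp.linearCombination ℝ _ (Finsupp.mapDomain _ _) = _
  rw [Finsupp.linearCombination_mapDomain, MonoidAlgebra.mul_def, momentForm_self]
  simp only [Finsupp.sum, MonoidAlgebra.coeff_sum, MonoidAlgebra.coeff_single, map_sum,
    Finsupp.linearCombination_single, smul_eq_mul]
  rfl

/-- Evaluation turns `[[a²]]` into the moment form at `(a, a)`, and testing sums of squares amounts
to testing single squares. -/
theorem mem_sosProfile_iff {d : ℕ} {v : V d → ℝ} :
    v ∈ sosProfile d ↔ (∀ C, 0 ≤ v C) ∧ GramPos d v (fun A => A.numEdges ≤ d) := by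
  refine and_congr_right fun _ => ⟨fun h a ha => ?_, fun h => ?_⟩
  · have := h (unlabelComb (MonoidAlgebra.ofCoeff a * MonoidAlgebra.ofCoeff a))
      ⟨1, fun _ => MonoidAlgebra.ofCoeff a, fun _ => ha, by simp⟩
    rwa [eval_toPolynomial_sq] at this
  · rintro _ ⟨m, f, hf, rfl⟩
    have : MvPolynomial.eval v (toPolynomial d (∑ j, unlabelComb (f j * f j))) =
        ∑ j, MvPolynomial.eval v (toPolynomial d (unlabelComb (f j * f j))) := by
      simp only [eval_toPolynomial, MonoidAlgebra.coeff_sum, map_sum]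
    rw [this]
    refine Finset.sum_nonneg fun j _ => ?_
    rw [eval_toPolynomial_sq]
    exact h _ (hf j)

/-! ### Reduction to finitely many labels -/

/-- Keeps the labels in `R` and removes all others. -/
def keepEmb (R : Finset ℕ) : (ℕ ⊕ ℕ) ↪ (ℕ ⊕ ℕ) where
  toFun := Sum.elim (fun i => if i ∈ R then Sum.inl i else forgetLabel (Sum.inl i))
    (fun k => forgetLabel (Sum.inr k))
  inj' := by
    have h := forgetLabel.injective
    rintro (i | k) (j | l) hij
    · simp only [Sum.elim_inl] at hij
      split_ifs at hij with h1 h2 h2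
      · exact hij
      · simp [forgetLabel_inr] at hij
      · simp [forgetLabel_inr] at hij
      · exact h hij
    · simp only [Sum.elim_inl, Sum.elim_inr] at hij
      split_ifs at hij with h1
      · simp [forgetLabel_inr] at hij
      · exact h hij
    · simp only [Sum.elim_inl, Sum.elim_inr] at hij
      split_ifs at hij with h1
      · simp [forgetLabel_inr] at hij
      · exact h hij
    · exact h hij

theorem keepEmb_inl (R : Finset ℕ) (j : ℕ) :
    keepEmb R (Sum.inl j) = if j ∈ R then Sum.inl j else forgetLabel (Sum.inl j) := rfl

theorem keepEmb_eq_inl {R : Finset ℕ} {u : ℕ ⊕ ℕ} {i : ℕ} :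
    keepEmb R u = Sum.inl i ↔ u = Sum.inl i ∧ i ∈ R := by
  rcases u with j | k
  · rw [keepEmb_inl]
    split_ifs with h
    · simp only [Sum.inl.injEq, iff_self_and]
      rintro rfl
      exact h
    · simp only [forgetLabel_inr, Sum.inl.injEq, reduceCtorEq, false_iff, not_and]
      rintro rfl
      exact h
  · simp [keepEmb, forgetLabel_inr]

/-- Renaming of the vertices of (a representative of) an isomorphism class. -/
noncomputable def PLGraph.rename (h : (ℕ ⊕ ℕ) ↪ (ℕ ⊕ ℕ)) (A : PLGraph) : PLGraph :=
  PLGraph.mk ((Quotient.out A).rename h)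

theorem PLGraph.mk_out (A : PLGraph) : PLGraph.mk (Quotient.out A) = A := Quotient.out_eq A

theorem PreGraph.rename_refl (G : PreGraph) : G.rename (Function.Embedding.refl _) = G :=
  PreGraph.ext' fun u v => by simp [PreGraph.rename_adj]

theorem PLGraph.rename_refl (A : PLGraph) : A.rename (Function.Embedding.refl _) = A := by
  rw [PLGraph.rename, PreGraph.rename_refl, PLGraph.mk_out]

theorem PLGraph.numEdges_rename (h : (ℕ ⊕ ℕ) ↪ (ℕ ⊕ ℕ)) (A : PLGraph) :
    (A.rename h).numEdges = A.numEdges := by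
  conv_rhs => rw [← A.mk_out]
  exact PreGraph.rename_numEdges h _

theorem PLGraph.mem_labels_rename {h : (ℕ ⊕ ℕ) ↪ (ℕ ⊕ ℕ)} {A : PLGraph} {i : ℕ} :
    i ∈ (A.rename h).labels ↔ ∃ u ∈ (Quotient.out A).graph.support, h u = Sum.inl i := by
  show Sum.inl i ∈ ((Quotient.out A).rename h).graph.support ↔ _
  rw [PreGraph.rename_support]
  rfl

theorem PLGraph.mem_labels {A : PLGraph} {i : ℕ} :
    i ∈ A.labels ↔ Sum.inl i ∈ (Quotient.out A).graph.support := by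
  conv_lhs => rw [← A.mk_out]
  rfl

theorem gram_rename (d : ℕ) (v : V d → ℝ) {h k h' k' : (ℕ ⊕ ℕ) ↪ (ℕ ⊕ ℕ)} {A B : PLGraph}
    (H : ∀ u ∈ (Quotient.out A).graph.support, ∀ v ∈ (Quotient.out B).graph.support,
      (∃ i, h u = Sum.inl i ∧ k v = Sum.inl i) ↔ ∃ i, h' u = Sum.inl i ∧ k' v = Sum.inl i) :
    gram d v (A.rename h) (B.rename k) = gram d v (A.rename h') (B.rename k') := by
  rw [gram, gram, PLGraph.rename, PLGraph.rename, PLGraph.rename, PLGraph.rename,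
    PLGraph.unlabel_rename_mul_rename H]

theorem PLGraph.labels_finite (A : PLGraph) : A.labels.Finite := by
  induction A using PLGraph.ind with | h G => exact G.labels_finite

theorem PLGraph.labels_ncard_le (A : PLGraph) : A.labels.ncard ≤ 2 * A.numEdges := by
  induction A using PLGraph.ind with | h G => exact G.labels_ncard_le

/-- The set of labels. -/
noncomputable def PLGraph.lab (A : PLGraph) : Finset ℕ := A.labels_finite.toFinset

theorem PLGraph.mem_lab {A : PLGraph} {i : ℕ} : i ∈ A.lab ↔ i ∈ A.labels :=
  Set.Finite.mem_toFinset _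

theorem PLGraph.card_lab_le (A : PLGraph) : A.lab.card ≤ 2 * A.numEdges := by
  refine le_trans (le_of_eq ?_) A.labels_ncard_le
  rw [Set.ncard_eq_toFinset_card _ A.labels_finite, PLGraph.lab]

/-- A label that is kept on one side only identifies nothing, so only the common part of `R` and
`R'` matters. -/
theorem gram_keep (d : ℕ) (v : V d → ℝ) (A B : PLGraph) (R R' : Finset ℕ) :
    gram d v (A.rename (keepEmb R)) (B.rename (keepEmb R')) =
      gram d v (A.rename (keepEmb (R ∩ R'))) (B.rename (keepEmb (R ∩ R'))) := by
  refine gram_rename d v fun u _ w _ => exists_congr fun i => ?_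
  simp only [keepEmb_eq_inl, Finset.mem_inter]
  tauto

theorem gram_eq_keep (d : ℕ) (v : V d → ℝ) (A B : PLGraph) :
    gram d v A B = gram d v (A.rename (keepEmb (A.lab ∩ B.lab)))
      (B.rename (keepEmb (A.lab ∩ B.lab))) := by
  conv_lhs => rw [← A.rename_refl, ← B.rename_refl]
  refine gram_rename d v fun u hu w hw => exists_congr fun i => ?_
  simp only [keepEmb_eq_inl, Finset.mem_inter, Function.Embedding.refl_apply, PLGraph.mem_lab,
    PLGraph.mem_labels]
  constructor
  · rintro ⟨rfl, rfl⟩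
    exact ⟨⟨rfl, hu, hw⟩, rfl, hu, hw⟩
  · exact fun h => ⟨h.1.1, h.2.1⟩

/-- Möbius inversion on the subset lattice. For fixed `R ∩ R' = S ⊆ T`, each element of `T` outside
`S` lies in neither set, only in `R`, or only in `R'`, with signs adding to `1 - 1 - 1 = -1`. The
inner double sum is therefore the Möbius transform of `φ` at `T`, and summing over `T ⊆ P` recovers
`φ P`. -/
theorem sum_powerset_inter (P : Finset ℕ) (φ : Finset ℕ → ℝ) :
    ∑ T ∈ P.powerset, ∑ R ∈ T.powerset, ∑ R' ∈ T.powerset,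
      (-1 : ℝ) ^ (T.card + R.card) * (-1) ^ (T.card + R'.card) * φ (R ∩ R') = φ P := by
  induction P using Finset.induction_on generalizing φ with
  | empty => simp
  | insert i P hi ih =>
    rw [Finset.sum_powerset_insert hi, ih φ]
    have key : ∀ T ∈ P.powerset, ∑ R ∈ (insert i T).powerset, ∑ R' ∈ (insert i T).powerset,
        (-1 : ℝ) ^ ((insert i T).card + R.card) * (-1) ^ ((insert i T).card + R'.card) *
          φ (R ∩ R') =
        ∑ R ∈ T.powerset, ∑ R' ∈ T.powerset,
          (-1 : ℝ) ^ (T.card + R.card) * (-1) ^ (T.card + R'.card) * φ (insert i (R ∩ R')) -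
        ∑ R ∈ T.powerset, ∑ R' ∈ T.powerset,
          (-1 : ℝ) ^ (T.card + R.card) * (-1) ^ (T.card + R'.card) * φ (R ∩ R') := by
      intro T hT
      have hiT : i ∉ T := fun h => hi (Finset.mem_powerset.1 hT h)
      simp only [Finset.sum_powerset_insert hiT]
      rw [← Finset.sum_add_distrib, ← Finset.sum_sub_distrib]
      refine Finset.sum_congr rfl fun R hR => ?_
      have hiR : i ∉ R := fun h => hiT (Finset.mem_powerset.1 hR h)
      rw [← Finset.sum_add_distrib, ← Finset.sum_add_distrib, ← Finset.sum_add_distrib,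
        ← Finset.sum_sub_distrib]
      refine Finset.sum_congr rfl fun R' hR' => ?_
      have hiR' : i ∉ R' := fun h => hiT (Finset.mem_powerset.1 hR' h)
      rw [Finset.card_insert_of_notMem hiT, Finset.card_insert_of_notMem hiR,
        Finset.card_insert_of_notMem hiR', Finset.insert_inter_of_notMem hiR',
        Finset.inter_insert_of_notMem hiR, ← Finset.insert_inter_distrib]
      ring
    rw [Finset.sum_congr rfl key, Finset.sum_sub_distrib, ih φ, ih fun S => φ (insert i S)]
    ring

/-- The signs factor over `R` and `R'`, so each `T` contributes the pairing of an alternating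
combination built from `A` with one built from `B`. Summed against coefficients, this becomes a
square. -/
theorem gram_eq_sum (d : ℕ) (v : V d → ℝ) (A B : PLGraph) :
    gram d v A B = ∑ T ∈ (A.lab ∩ B.lab).powerset, ∑ R ∈ T.powerset, ∑ R' ∈ T.powerset,
      (-1 : ℝ) ^ (T.card + R.card) * (-1) ^ (T.card + R'.card) *
        gram d v (A.rename (keepEmb R)) (B.rename (keepEmb R')) := by
  rw [gram_eq_keep, ← sum_powerset_inter (A.lab ∩ B.lab)
    (fun S => gram d v (A.rename (keepEmb S)) (B.rename (keepEmb S)))]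
  refine Finset.sum_congr rfl fun T _ => Finset.sum_congr rfl fun R _ =>
    Finset.sum_congr rfl fun R' _ => ?_
  rw [gram_keep d v A B R R']

/-- Renaming of the labels. -/
def relabelEmb (ρ : Equiv.Perm ℕ) : (ℕ ⊕ ℕ) ↪ (ℕ ⊕ ℕ) :=
  (Equiv.sumCongr ρ (Equiv.refl ℕ)).toEmbedding

theorem gram_relabel (d : ℕ) (v : V d → ℝ) (A B : PLGraph) (ρ : Equiv.Perm ℕ) :
    gram d v (A.rename (relabelEmb ρ)) (B.rename (relabelEmb ρ)) = gram d v A B := by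
  conv_rhs => rw [← A.rename_refl, ← B.rename_refl]
  refine gram_rename d v fun u _ w _ => ?_
  rcases u with i | k <;> rcases w with j | l <;> simp [relabelEmb]

/-- For `T` let `b_T` be the sum, over `A` with `T ⊆ A.lab` and over `R ⊆ T`, of `a A * (-1) ^ (|T|
+ |R|)` times the graph `A` with only the labels in `R` kept. By `gram_eq_sum` the form at `a` is
the sum over `T` of the forms at `b_T`. All labels in `b_T` lie in `T`, and `b_T` is an empty sum
unless `|T| ≤ 2d ≤ ℓ`. A permutation of the labels, which does not change the form, then moves `T`
below `ℓ`. -/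
theorem GramPos.of_labels {d ℓ : ℕ} (hℓ : 2 * d ≤ ℓ) {v : V d → ℝ}
    (h : GramPos d v (fun A => A.numEdges ≤ d ∧ ∀ i ∈ A.labels, i < ℓ)) :
    GramPos d v (fun A => A.numEdges ≤ d) := by
  classical
  intro a ha
  have hT : ∀ T : Finset ℕ, 0 ≤ ∑ p ∈ (a.support.filter fun A => T ⊆ A.lab) ×ˢ T.powerset,
      ∑ q ∈ (a.support.filter fun A => T ⊆ A.lab) ×ˢ T.powerset,
      (a p.1 * (-1) ^ (T.card + p.2.card)) * (a q.1 * (-1) ^ (T.card + q.2.card)) *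
        gram d v (p.1.rename (keepEmb p.2)) (q.1.rename (keepEmb q.2)) := by
    intro T
    by_cases hc : T.card ≤ ℓ
    · obtain ⟨ρ, hρ⟩ : ∃ ρ : Equiv.Perm ℕ, ∀ i ∈ T, ρ i < ℓ := by
        let f : ℕ → ℕ := fun i => if h : i ∈ T then T.equivFin ⟨i, h⟩ else 0
        obtain ⟨ρ, hρ⟩ := exists_perm_eqOn (f := f) T.finite_toSet (by
          intro i hi j hj hij
          simp only [f, dif_pos (Finset.mem_coe.1 hi), dif_pos (Finset.mem_coe.1 hj)] at hij
          simpa using T.equivFin.injective (Fin.ext hij))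
        refine ⟨ρ, fun i hi => ?_⟩
        rw [hρ i hi]
        simp only [f, dif_pos hi]
        exact (Fin.is_lt _).trans_le hc
      have := h.family ((a.support.filter fun A => T ⊆ A.lab) ×ˢ T.powerset)
        (fun p => a p.1 * (-1) ^ (T.card + p.2.card))
        (fun p => (p.1.rename (keepEmb p.2)).rename (relabelEmb ρ)) (by
          rintro ⟨A, R⟩ hp
          simp only [Finset.mem_product, Finset.mem_filter, Finset.mem_powerset] at hp
          refine ⟨?_, fun i hi => ?_⟩
          · rw [PLGraph.numEdges_rename, PLGraph.numEdges_rename]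
            exact ha A hp.1.1
          · obtain ⟨u, hu, hui⟩ := PLGraph.mem_labels_rename.1 hi
            rcases u with j | k
            · obtain ⟨w, -, hw⟩ := PLGraph.mem_labels_rename.1 (PLGraph.mem_labels.2 hu)
              have hj := (keepEmb_eq_inl.1 hw).2
              have : ρ j = i := Sum.inl_injective hui
              rw [← this]
              exact hρ j (hp.2 hj)
            · simp [relabelEmb] at hui)
      simpa only [gram_relabel] using this
    · have : (a.support.filter fun A => T ⊆ A.lab) = ∅ := by
        refine Finset.filter_false_of_mem fun A hA hTA => hc ?_
        have := ha A hA
        have h1 := A.card_lab_le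
        have h2 := Finset.card_le_card hTA
        omega
      rw [this]
      simp
  have hsum : momentForm d v a a = ∑ T ∈ (a.support.biUnion PLGraph.lab).powerset,
      ∑ p ∈ (a.support.filter fun A => T ⊆ A.lab) ×ˢ T.powerset,
      ∑ q ∈ (a.support.filter fun A => T ⊆ A.lab) ×ˢ T.powerset,
      (a p.1 * (-1) ^ (T.card + p.2.card)) * (a q.1 * (-1) ^ (T.card + q.2.card)) *
        gram d v (p.1.rename (keepEmb p.2)) (q.1.rename (keepEmb q.2)) := by
    rw [momentForm_self]
    -- Letting `T` run over one powerset common to all pairs `A`, `B` makes it possible to exchange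
    -- the sums.
    have h1 : ∀ A ∈ a.support, ∀ B ∈ a.support, a A * a B * gram d v A B =
        ∑ T ∈ (a.support.biUnion PLGraph.lab).powerset, if T ⊆ A.lab then if T ⊆ B.lab then
          ∑ R ∈ T.powerset, ∑ R' ∈ T.powerset,
          (a A * (-1) ^ (T.card + R.card)) * (a B * (-1) ^ (T.card + R'.card)) *
          gram d v (A.rename (keepEmb R)) (B.rename (keepEmb R')) else 0 else 0 := by
      intro A hA B hB
      simp only [← ite_and]
      rw [← Finset.sum_filter]
      have : ((a.support.biUnion PLGraph.lab).powerset.filter fun T => T ⊆ A.lab ∧ T ⊆ B.lab) =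
          (A.lab ∩ B.lab).powerset := by
        ext T
        simp only [Finset.mem_filter, Finset.mem_powerset, Finset.subset_inter_iff]
        refine ⟨fun h => h.2, fun h => ⟨h.1.trans ?_, h⟩⟩
        exact Finset.subset_biUnion_of_mem PLGraph.lab hA
      rw [this, gram_eq_sum, Finset.mul_sum]
      refine Finset.sum_congr rfl fun T _ => ?_
      rw [Finset.mul_sum]
      refine Finset.sum_congr rfl fun R _ => ?_
      rw [Finset.mul_sum]
      refine Finset.sum_congr rfl fun R' _ => ?_
      ring
    rw [Finset.sum_congr rfl fun A hA => Finset.sum_congr rfl fun B hB => h1 A hA B hB]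
    rw [Finset.sum_congr rfl fun A _ => Finset.sum_comm, Finset.sum_comm]
    refine Finset.sum_congr rfl fun T _ => ?_
    rw [Finset.sum_product, Finset.sum_filter]
    refine Finset.sum_congr rfl fun A _ => ?_
    by_cases hTA : T ⊆ A.lab
    · simp only [if_pos hTA, Finset.sum_product]
      rw [Finset.sum_comm, Finset.sum_filter]
    · simp only [if_neg hTA, Finset.sum_const_zero]
  rw [hsum]
  exact Finset.sum_nonneg fun T _ => hT T

/-! ### Removal of the unlabeled components -/

/-- The empty graph. -/
def PreGraph.empty : PreGraph := ⟨⊥, by simp⟩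

theorem PreGraph.union_empty (G : PreGraph) : G.union PreGraph.empty = G :=
  PreGraph.ext' fun _ _ => or_iff_left id

theorem PreGraph.empty_union (G : PreGraph) : PreGraph.empty.union G = G :=
  PreGraph.ext' fun _ _ => or_iff_right id

theorem PreGraph.empty_support : PreGraph.empty.graph.support = ∅ := SimpleGraph.support_bot

theorem gram_splits (d : ℕ) (v : V d → ℝ) {A₁ A₂ B₁ B₂ : PreGraph}
    (h : PreGraph.Splits A₁ A₂ B₁ B₂) :
    gram d v (PLGraph.mk (A₁.union A₂)) (PLGraph.mk (B₁.union B₂)) =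
      gram d v (PLGraph.mk A₁) (PLGraph.mk B₁) * gram d v (PLGraph.mk A₂) (PLGraph.mk B₂) := by
  rw [gram, toMonomial_splits d h, map_mul]
  rfl

/-- A graph without labels stays disjoint from the other factor: write `G = G ⊔ ∅` and `H = ∅ ⊔ H`.
-/
theorem gram_eq_mul_of_unlabeled (d : ℕ) (v : V d → ℝ) {G H : PreGraph}
    (hG : ∀ i, Sum.inl i ∉ G.graph.support) :
    gram d v (PLGraph.mk G) (PLGraph.mk H) =
      gram d v (PLGraph.mk G) (PLGraph.mk PreGraph.empty) *
        gram d v (PLGraph.mk H) (PLGraph.mk PreGraph.empty) := by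
  have hs : PreGraph.Splits G PreGraph.empty PreGraph.empty H := by
    refine ⟨?_, ?_, fun i h => absurd h (hG i), fun i h => ?_⟩
    · simp [PreGraph.empty_support]
    · simp [PreGraph.empty_support]
    · simp [PreGraph.empty_support] at h
  have := gram_splits d v hs
  rw [PreGraph.union_empty, PreGraph.empty_union] at this
  rw [this, gram_comm d v (PLGraph.mk PreGraph.empty)]

/-- The vertices in components with a label. -/
def PreGraph.labeledPart (G : PreGraph) : Set (ℕ ⊕ ℕ) := {u | ∃ i, G.graph.Reachable u (Sum.inl i)}

theorem PreGraph.isClosed_labeledPart (G : PreGraph) : G.IsClosed G.labeledPart := by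
  rintro u ⟨i, hi⟩ v huv
  exact ⟨i, huv.reachable.symm.trans hi⟩

theorem PreGraph.componentsLabeled_labeledPart (G : PreGraph) :
    (G.restrict G.labeledPart).ComponentsLabeled := by
  intro u hu
  obtain ⟨i, hi⟩ := (G.restrict_support_subset _ hu).2
  exact ⟨i, (G.isClosed_labeledPart.reachable (H := G.restrict G.labeledPart)
    (fun u hu v huv => ⟨huv, hu, G.isClosed_labeledPart u hu v huv⟩) hi ⟨i, hi⟩).2⟩

theorem PreGraph.inl_notMem_restrict (G : PreGraph) (i : ℕ) :
    Sum.inl i ∉ (G.restrict G.labeledPartᶜ).graph.support :=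
  fun h => (G.restrict_support_subset _ h).2 ⟨i, SimpleGraph.Reachable.refl _⟩

theorem PreGraph.restrict_numEdges_le (G : PreGraph) (p : Set (ℕ ⊕ ℕ)) :
    (G.restrict p).numEdges ≤ G.numEdges :=
  Set.ncard_le_ncard (SimpleGraph.edgeSet_mono fun _ _ h => h.1) G.edgeSet_finite

/-- Unlabeled components factor out as scalars depending on `A` or `B` alone. The full matrix is
thus a reduced one with repeated rows and columns, scaled on both sides by the same diagonal matrix;
the sign of `m` is irrelevant for semidefiniteness. -/
theorem exists_gram_eq_mul (d : ℕ) (v : V d → ℝ) : ∃ (f : PLGraph → PLGraph) (m : PLGraph → ℝ),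
    (∀ A, (f A).numEdges ≤ A.numEdges ∧ (f A).labels ⊆ A.labels ∧ (f A).ComponentsLabeled) ∧
    ∀ A B, gram d v A B = m A * m B * gram d v (f A) (f B) := by
  refine ⟨fun A => PLGraph.mk ((Quotient.out A).restrict (Quotient.out A).labeledPart),
    fun A => gram d v (PLGraph.mk ((Quotient.out A).restrict (Quotient.out A).labeledPartᶜ))
      (PLGraph.mk PreGraph.empty), fun A => ⟨?_, ?_, ?_⟩, fun A B => ?_⟩
  · conv_rhs => rw [← A.mk_out]
    exact PreGraph.restrict_numEdges_le _ _
  · intro i hi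
    exact PLGraph.mem_labels.2 (PreGraph.restrict_support_subset _ _ hi).1
  · exact PreGraph.componentsLabeled_labeledPart _
  · have hA := (Quotient.out A).isClosed_labeledPart.union_restrict
    have hB := (Quotient.out B).isClosed_labeledPart.union_restrict
    have hs : PreGraph.Splits ((Quotient.out A).restrict (Quotient.out A).labeledPart)
        ((Quotient.out A).restrict (Quotient.out A).labeledPartᶜ)
        ((Quotient.out B).restrict (Quotient.out B).labeledPart)
        ((Quotient.out B).restrict (Quotient.out B).labeledPartᶜ) :=
      ⟨PreGraph.disjoint_restrict _ _, PreGraph.disjoint_restrict _ _,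
        fun i _ => PreGraph.inl_notMem_restrict _ i,
        fun i h => absurd h (PreGraph.inl_notMem_restrict _ i)⟩
    have := gram_splits d v hs
    rw [hA, hB, PLGraph.mk_out, PLGraph.mk_out,
      gram_eq_mul_of_unlabeled d v (PreGraph.inl_notMem_restrict _)] at this
    rw [this]
    ring

theorem GramPos.of_reduced {d ℓ : ℕ} {v : V d → ℝ} (h : GramPos d v (· ∈ reducedB d ℓ)) :
    GramPos d v (fun A => A.numEdges ≤ d ∧ ∀ i ∈ A.labels, i < ℓ) := by
  obtain ⟨f, m, hf, hm⟩ := exists_gram_eq_mul d v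
  intro a ha
  rw [momentForm_self]
  have := h.family a.support (fun A => a A * m A) f (fun A hA =>
    ⟨(hf A).1.trans (ha A hA).1, fun i hi => (ha A hA).2 i ((hf A).2.1 hi), (hf A).2.2⟩)
  refine this.trans_eq (Finset.sum_congr rfl fun A _ => Finset.sum_congr rfl fun B _ => ?_)
  rw [hm A B]
  ring

theorem mem_sosProfile_of_reduced {d ℓ : ℕ} (hℓ : 2 * d ≤ ℓ) {v : V d → ℝ} (hv : ∀ C, 0 ≤ v C)
    (h : GramPos d v (· ∈ reducedB d ℓ)) : v ∈ sosProfile d :=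
  mem_sosProfile_iff.2 ⟨hv, h.of_reduced.of_labels hℓ⟩

/-! ### Positive semidefinite matrices through the characteristic polynomial -/

/-- Up to sign the coefficients are elementary symmetric functions of the eigenvalues. -/
theorem charpoly_coeff_nonneg {n : Type} [Fintype n] [DecidableEq n] {M : Matrix n n ℝ}
    (hM : M.PosSemidef) {k : ℕ} (hk : k ≤ Fintype.card n) :
    0 ≤ (-1) ^ (Fintype.card n - k) * M.charpoly.coeff k := by
  have hcard : Multiset.card (Finset.univ.val.map hM.1.eigenvalues) = Fintype.card n := by
    simp [Finset.card_univ]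
  have h : M.charpoly = ((Finset.univ.val.map hM.1.eigenvalues).map
      fun t => Polynomial.X - Polynomial.C t).prod := by
    rw [hM.1.charpoly_eq, Multiset.map_map]
    rfl
  rw [h, Multiset.prod_X_sub_C_coeff _ (by rw [hcard]; exact hk), hcard, ← mul_assoc, ← pow_add,
    Even.neg_one_pow ⟨_, rfl⟩, one_mul, Multiset.esymm]
  refine Multiset.sum_nonneg fun x hx => ?_
  obtain ⟨s, hs, rfl⟩ := Multiset.mem_map.1 hx
  refine Multiset.prod_nonneg fun y hy => ?_
  obtain ⟨i, -, rfl⟩ := Multiset.mem_map.1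
    (Multiset.mem_of_le (Multiset.mem_powersetCard.1 hs).1 hy)
  exact hM.eigenvalues_nonneg i

/-- With alternating signs of the coefficients of `p`, every term of `(-1) ^ n * p x` is nonnegative
for `x < 0` and the leading term is positive. So `p` has no negative root. -/
theorem posSemidef_of_charpoly_coeff {n : Type} [Fintype n] [DecidableEq n] {M : Matrix n n ℝ}
    (hM : M.IsHermitian)
    (h : ∀ k ≤ Fintype.card n, 0 ≤ (-1) ^ (Fintype.card n - k) * M.charpoly.coeff k) :
    M.PosSemidef := by
  rw [hM.posSemidef_iff_eigenvalues_nonneg]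
  intro i
  by_contra hneg
  have hneg : hM.eigenvalues i < 0 := lt_of_not_ge hneg
  set x := hM.eigenvalues i with hx
  have hroot : M.charpoly.eval x = 0 := by
    rw [hM.charpoly_eq, Polynomial.eval_prod]
    refine Finset.prod_eq_zero (Finset.mem_univ i) ?_
    simp [hx]
  have hdeg : M.charpoly.natDegree = Fintype.card n := M.charpoly_natDegree_eq_dim
  rw [Polynomial.eval_eq_sum_range, hdeg] at hroot
  have hsum : 0 < ∑ k ∈ Finset.range (Fintype.card n + 1),
      (-1) ^ Fintype.card n * (M.charpoly.coeff k * x ^ k) := by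
    refine Finset.sum_pos' (fun k hk => ?_) ⟨Fintype.card n, by simp, ?_⟩
    · have hk : k ≤ Fintype.card n := Nat.lt_succ_iff.1 (Finset.mem_range.1 hk)
      have h1 : (-1 : ℝ) ^ Fintype.card n = (-1) ^ (Fintype.card n - k) * (-1) ^ k := by
        rw [← pow_add, Nat.sub_add_cancel hk]
      calc (0 : ℝ) ≤ ((-1) ^ (Fintype.card n - k) * M.charpoly.coeff k) * (-x) ^ k :=
            mul_nonneg (h k hk) (pow_nonneg (by linarith) k)
        _ = _ := by rw [h1, neg_pow x]; ring
    · have hlead : M.charpoly.coeff (Fintype.card n) = 1 := by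
        rw [← hdeg]
        exact M.charpoly_monic
      rw [hlead, one_mul, ← mul_pow]
      exact pow_pos (by linarith) _
  rw [← Finset.mul_sum, hroot, mul_zero] at hsum
  exact lt_irrefl _ hsum

/-! ### The profile is basic closed semialgebraic -/

theorem isBasicClosedSemialgebraic_sosProfile (d : ℕ) :
    Trop.IsBasicClosedSemialgebraic (sosProfile d) := by
  classical
  -- `2d` labels suffice by `GramPos.of_labels`. The index set is already finite, so unlabeled
  -- components may stay.
  let F : Set PLGraph := {A | A.numEdges ≤ d ∧ ∀ i ∈ A.labels, i < 2 * d}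
  have : Fintype F := (PLGraph.finite_setOf d (2 * d)).fintype
  have : Fintype (V d) := Fintype.ofFinite _
  let M : Matrix F F (MvPolynomial (V d) ℝ) := fun A B => toMonomial d (A.1 * B.1).unlabel
  refine ⟨Finset.univ.image (fun C : V d => MvPolynomial.X C) ∪
    (Finset.range (Fintype.card F + 1)).image
      (fun k => (-1) ^ (Fintype.card F - k) * M.charpoly.coeff k), ?_⟩
  ext v
  have hMv : ∀ A B, (M.map (MvPolynomial.eval v)) A B = gram d v A B := fun A B => rfl
  have hherm : (M.map (MvPolynomial.eval v)).IsHermitian := by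
    ext A B
    rw [Matrix.conjTranspose_apply, hMv, hMv, gram_comm, star_trivial]
  have hcoeff : ∀ k, MvPolynomial.eval v ((-1) ^ (Fintype.card F - k) * M.charpoly.coeff k) =
      (-1) ^ (Fintype.card F - k) * (M.map (MvPolynomial.eval v)).charpoly.coeff k := by
    intro k
    rw [Matrix.charpoly_map, Polynomial.coeff_map, map_mul, map_pow, map_neg, map_one]
  have hpsd : (M.map (MvPolynomial.eval v)).PosSemidef ↔
      GramPos d v (fun A => A.numEdges ≤ d ∧ ∀ i ∈ A.labels, i < 2 * d) := by
    constructor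
    · intro h a ha
      have := h.2 (a.subtypeDomain (· ∈ F))
      have hs : ∀ g : PLGraph → ℝ → ℝ, (a.subtypeDomain (· ∈ F)).sum (fun i x => g i.1 x) =
          ∑ A ∈ a.support, g A (a A) := fun g => by
        exact Finsupp.sum_subtypeDomain_index (h := fun A x => g A x) ha
      rw [momentForm_self]
      simp only [hMv] at this
      rw [hs (fun A x => (a.subtypeDomain (· ∈ F)).sum fun j xj => star x * gram d v A j * xj)]
        at this
      refine this.trans_eq (Finset.sum_congr rfl fun A _ => ?_)
      rw [hs (fun B y => star (a A) * gram d v A B * y)]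
      refine Finset.sum_congr rfl fun B _ => ?_
      rw [star_trivial]
      ring
    · intro h
      refine ⟨hherm, fun x => ?_⟩
      have := h.family x.support x (fun A => A.1) (fun A _ => A.2)
      refine this.trans_eq (Finset.sum_congr rfl fun A _ => Finset.sum_congr rfl fun B _ => ?_)
      simp only [hMv, star_trivial]
      ring
  have hiff : v ∈ sosProfile d ↔ (∀ C, 0 ≤ v C) ∧ (M.map (MvPolynomial.eval v)).PosSemidef := by
    rw [hpsd, mem_sosProfile_iff]
    refine and_congr_right fun _ => ⟨fun h a ha => h a fun A hA => (ha A hA).1, ?_⟩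
    exact fun h => h.of_labels le_rfl
  rw [hiff]
  simp only [Finset.mem_union, Finset.mem_image, Finset.mem_univ, true_and, Finset.mem_range,
    Set.mem_ofPred_eq, or_imp, forall_and, forall_exists_index, forall_apply_eq_imp_iff,
    MvPolynomial.eval_X, and_imp, forall_apply_eq_imp_iff₂, hcoeff]
  refine and_congr_right fun _ => ⟨fun h k hk => ?_, fun h => ?_⟩
  · exact charpoly_coeff_nonneg h (Nat.lt_succ_iff.1 hk)
  · exact posSemidef_of_charpoly_coeff hherm fun k hk => h k (Nat.lt_succ_iff.2 hk)

theorem isClosed_sosProfile (d : ℕ) : IsClosed (sosProfile d) := by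
  obtain ⟨P, hP⟩ := isBasicClosedSemialgebraic_sosProfile d
  rw [hP, Set.ofPred_forall]
  refine isClosed_iInter fun p => ?_
  rw [Set.ofPred_forall]
  exact isClosed_iInter fun _ => isClosed_le continuous_const (MvPolynomial.continuous_eval p)

/-! ### Density vectors belong to the profile -/

section Dens

variable {X : Type} [Fintype X] [Nonempty X] (R : X → X → Prop)

theorem exists_gram_dens_eq (d N : ℕ) : ∃ c : PLGraph → (Fin N → X) → ℝ, ∀ A B : PLGraph,
    A.numEdges ≤ d → B.numEdges ≤ d → (∀ i ∈ A.labels, i < N) → (∀ i ∈ B.labels, i < N) →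
    gram d (fun C => C.1.dens R) A B =
      ((Fintype.card X : ℝ) ^ N)⁻¹ * ∑ φ : Fin N → X, c A φ * c B φ := by
  refine ⟨fun A φ => (Nat.card ((Quotient.out A).Ext R φ) : ℝ) /
    (Fintype.card X : ℝ) ^ Nat.card (Quotient.out A).Unl, fun A B hA hB hlA hlB => ?_⟩
  rw [gram, eval_dens_toMonomial R d A B hA hB, ← PLGraph.dens_unlabel_mul R
    (A := Quotient.out A) (B := Quotient.out B), PLGraph.mk_out, PLGraph.mk_out]
  · exact fun i hi => hlA i (PLGraph.mem_labels.2 hi)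
  · exact fun i hi => hlB i (PLGraph.mem_labels.2 hi)

/-- At a density vector the moment form is an average of squares over the placements `φ` of the
labels. The relation `R` is arbitrary, so targets with loops are included. -/
theorem dens_mem_sosProfile (d : ℕ) : (fun C : V d => C.1.dens R) ∈ sosProfile d := by
  classical
  refine mem_sosProfile_iff.2 ⟨fun C => C.1.dens_nonneg R, fun a ha => ?_⟩
  obtain ⟨c, hc⟩ := exists_gram_dens_eq R d ((a.support.biUnion PLGraph.lab).sup id + 1)
  have hl : ∀ A ∈ a.support, ∀ i ∈ A.labels, i < (a.support.biUnion PLGraph.lab).sup id + 1 := by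
    intro A hA i hi
    refine Nat.lt_succ_iff.2 (Finset.le_sup (f := id) ?_)
    exact Finset.mem_biUnion.2 ⟨A, hA, PLGraph.mem_lab.2 hi⟩
  rw [momentForm_self, Finset.sum_congr rfl fun A hA => Finset.sum_congr rfl fun B hB => by
    rw [hc A B (ha A hA) (ha B hB) (hl A hA) (hl B hB)]]
  have : ∑ A ∈ a.support, ∑ B ∈ a.support, a A * a B *
      (((Fintype.card X : ℝ) ^ ((a.support.biUnion PLGraph.lab).sup id + 1))⁻¹ *
        ∑ φ, c A φ * c B φ) =
      ((Fintype.card X : ℝ) ^ ((a.support.biUnion PLGraph.lab).sup id + 1))⁻¹ *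
        ∑ φ, (∑ A ∈ a.support, a A * c A φ) ^ 2 := by
    symm
    simp only [sq, Finset.sum_mul_sum]
    rw [Finset.sum_comm, Finset.mul_sum]
    refine Finset.sum_congr rfl fun A _ => ?_
    rw [Finset.sum_comm, Finset.mul_sum]
    refine Finset.sum_congr rfl fun B _ => ?_
    rw [Finset.mul_sum, Finset.mul_sum, Finset.mul_sum]
    refine Finset.sum_congr rfl fun φ _ => ?_
    ring
  rw [this]
  positivity

end Dens

theorem continuous_proj {d : ℕ} {U : Set PLGraph} (hU : U ⊆ V d) : Continuous (proj hU) :=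
  continuous_pi fun C => continuous_apply (⟨C, hU C.2⟩ : V d)

/-- A projection of a closed set need not be closed. Density vectors lie in the unit cube, so the
closure is taken in the image of the compact part of the profile there. -/
theorem graphProfile_subset_projSosProfile {d : ℕ} {U : Set PLGraph} (hU : U ⊆ V d) :
    graphProfile U ⊆ projSosProfile hU := by
  have hK : IsCompact (sosProfile d ∩ Set.Icc 0 1) :=
    isCompact_Icc.inter_left (isClosed_sosProfile d)
  refine (closure_minimal ?_ (hK.image (continuous_proj hU)).isClosed).trans
    (Set.image_mono Set.inter_subset_left)
  rintro _ ⟨n, T, hn, rfl⟩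
  have : NeZero n := ⟨hn.ne'⟩
  refine ⟨fun C => C.1.dens T.Adj, ⟨dens_mem_sosProfile T.Adj d,
    fun C => C.1.dens_nonneg _, fun C => C.1.dens_le_one _⟩, ?_⟩
  funext C
  exact (C.1.density_eq_dens T).symm

theorem graphProfile_subset_sosProfile (d : ℕ) : graphProfile (V d) ⊆ sosProfile d := by
  refine (graphProfile_subset_projSosProfile (subset_refl (V d))).trans ?_
  rintro _ ⟨v, hv, rfl⟩
  exact hv

/-! ### Strict Cauchy–Schwarz inequalities -/

/-- Lagrange's identity; the factor `2` arises because ordered pairs are summed. -/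
theorem sum_sq_mul_sum_sq_sub {ι : Type} [Fintype ι] (f g : ι → ℝ) :
    2 * ((∑ i, f i * f i) * (∑ i, g i * g i) - (∑ i, f i * g i) ^ 2) =
      ∑ i, ∑ j, (f i * g j - f j * g i) ^ 2 := by
  have h : ∀ i j, (f i * g j - f j * g i) ^ 2 =
      (f i * f i) * (g j * g j) + (g i * g i) * (f j * f j) - 2 * ((f i * g i) * (f j * g j)) := by
    intro i j; ring
  simp only [h, Finset.sum_sub_distrib, Finset.sum_add_distrib, ← Finset.mul_sum,
    ← Finset.sum_mul]
  ring

theorem mul_eq_mul_of_sum_sq_le {ι : Type} [Fintype ι] {f g : ι → ℝ}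
    (h : (∑ i, f i * f i) * (∑ i, g i * g i) ≤ (∑ i, f i * g i) ^ 2) (i j : ι) :
    f i * g j = f j * g i := by
  have h0 := sum_sq_mul_sum_sq_sub f g
  have h1 : ∑ i, ∑ j, (f i * g j - f j * g i) ^ 2 ≤ 0 := by linarith
  have h2 : (f i * g j - f j * g i) ^ 2 ≤ ∑ i, ∑ j, (f i * g j - f j * g i) ^ 2 := by
    refine le_trans ?_ (Finset.single_le_sum
      (f := fun i => ∑ j, (f i * g j - f j * g i) ^ 2) (fun i _ => by positivity)
      (Finset.mem_univ i))
    exact Finset.single_le_sum (f := fun j => (f i * g j - f j * g i) ^ 2)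
      (fun j _ => by positivity) (Finset.mem_univ j)
  have h3 : (f i * g j - f j * g i) ^ 2 = 0 := le_antisymm (h2.trans h1) (sq_nonneg _)
  linarith [pow_eq_zero_iff (n := 2) (by norm_num) |>.1 h3]

/-! ### Homomorphisms distinguish partially labeled graphs -/

/-- Adds an isolated point with a loop to a relation. -/
def optRel {Y : Type} (r : Y → Y → Prop) : Option Y → Option Y → Prop
  | some a, some b => r a b
  | none, none => True
  | _, _ => False

theorem optRel_none_left {Y : Type} {r : Y → Y → Prop} {y : Option Y} (h : optRel r none y) :
    y = none := by
  rcases y with _ | y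
  · rfl
  · exact h.elim

theorem optRel_some_left {Y : Type} {r : Y → Y → Prop} {a : Y} {y : Option Y}
    (h : optRel r (some a) y) : ∃ b, y = some b ∧ r a b := by
  rcases y with _ | y
  · exact h.elim
  · exact ⟨y, rfl, h⟩

theorem PreGraph.vert_injective (N : ℕ) (A : PreGraph) : Function.Injective (A.vert N) :=
  Fin.val_injective.sumMap Subtype.val_injective

/-- The value `none` spreads from the labels along edges, since `none` is related only to itself,
and every component contains a label. This supplies a reference placement at which all counts equal
one. -/
theorem PreGraph.card_ext_none {A : PreGraph} {N : ℕ} (hA : ∀ i ∈ A.labels, i < N)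
    (hc : A.ComponentsLabeled) {Y : Type} (r : Y → Y → Prop) :
    Nat.card (A.Ext (optRel r) (fun _ : Fin N => none)) = 1 := by
  rw [Nat.card_eq_one_iff_unique]
  refine ⟨⟨fun f g => ?_⟩, ⟨⟨fun _ => none, ?_⟩⟩⟩
  · have key : ∀ f : A.Ext (optRel r) (fun _ : Fin N => none), ∀ k, f.1 k = none := by
      intro f k
      let p : Set (ℕ ⊕ ℕ) := {x | ∃ w, A.vert N w = x ∧ Sum.elim (fun _ => none) f.1 w = none}
      have hp : A.IsClosed p := by
        rintro _ ⟨w, rfl, hw⟩ y hy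
        obtain ⟨w', rfl⟩ := PreGraph.exists_vert hA hy.mem_support_right
        have := f.2 w w' hy
        rw [hw] at this
        exact ⟨w', rfl, optRel_none_left this⟩
      have hs : A.IsClosed A.graph.support := fun u _ v huv => huv.mem_support_right
      obtain ⟨i, hi⟩ := hc _ k.2
      have his := (hs.reachable (H := A) (fun _ _ _ h => h) hi k.2).1
      have hip : Sum.inl i ∈ p := ⟨Sum.inl ⟨i, hA i his⟩, rfl, rfl⟩
      obtain ⟨w, hw, hw'⟩ := (hp.reachable (H := A) (fun _ _ _ h => h) hi.symm hip).1
      have : w = Sum.inr k := A.vert_injective N hw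
      rw [this] at hw'
      exact hw'
    exact Subtype.ext (funext fun k => (key f k).trans (key g k).symm)
  · rintro (u | u) (v | v) _ <;> exact trivial

/-- No homomorphism count that respects labels distinguishes `A` and `B`. -/
def PreGraph.SameCounts (A B : PreGraph) (N : ℕ) : Prop :=
  ∀ (Y : Type) [Finite Y] (r : Y → Y → Prop) (φ : Fin N → Option Y),
    Nat.card (A.Ext (optRel r) φ) = Nat.card (B.Ext (optRel r) φ)

theorem PreGraph.SameCounts.symm {A B : PreGraph} {N : ℕ} (h : A.SameCounts B N) :
    B.SameCounts A N := fun Y _ r φ => (h Y r φ).symm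

/-- Place the label `i` alone on a point without any relation and everything else on `none`.
Extensions exist if `i` does not occur in the graph, and none exists if it does. -/
theorem PreGraph.SameCounts.labels_subset {A B : PreGraph} {N : ℕ} (h : A.SameCounts B N)
    (hA : ∀ i ∈ A.labels, i < N) : A.labels ⊆ B.labels := by
  intro i hi
  by_contra hiB
  have h1 := h Unit (fun _ _ => False) (fun j => if j.1 = i then some () else none)
  have hB : Nonempty (B.Ext (optRel fun _ _ : Unit => False)
      (fun j : Fin N => if j.1 = i then some () else none)) := by
    refine ⟨⟨fun _ => none, fun u v huv => ?_⟩⟩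
    have key : ∀ w, B.vert N w ∈ B.graph.support →
        Sum.elim (fun j : Fin N => if j.1 = i then some () else none) (fun _ => none) w = none := by
      rintro (w | w) hw
      · refine if_neg ?_
        rintro rfl
        exact hiB hw
      · rfl
    rw [key u huv.mem_support_left, key v huv.mem_support_right]
    trivial
  have hpos : 0 < Nat.card (B.Ext (optRel fun _ _ : Unit => False)
      (fun j : Fin N => if j.1 = i then some () else none)) := Nat.card_pos
  rw [← h1] at hpos
  obtain ⟨⟨f, hf⟩⟩ := (Nat.card_pos_iff.1 hpos).1
  obtain ⟨y, hy⟩ := hi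
  obtain ⟨w, rfl⟩ := PreGraph.exists_vert hA hy.mem_support_right
  have := hf (Sum.inl ⟨i, hA i ⟨_, hy⟩⟩) w hy
  simp only [Sum.elim_inl, if_true] at this
  obtain ⟨b, -, hb⟩ := optRel_some_left this
  exact hb

/-- The count for `⊆ S` is the sum of the exact counts over subsets of `S`, so Möbius inversion,
done here by induction on `S`, recovers the exact counts. -/
theorem card_eq_of_card_subset_eq {F F' γ : Type} [Finite F] [Finite F'] [DecidableEq γ]
    (m : F → Finset γ) (m' : F' → Finset γ)
    (h : ∀ S, Nat.card {f // m f ⊆ S} = Nat.card {f // m' f ⊆ S}) (S : Finset γ) :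
    Nat.card {f // m f = S} = Nat.card {f // m' f = S} := by
  classical
  have := Fintype.ofFinite F
  have := Fintype.ofFinite F'
  have key : ∀ {E : Type} [Fintype E] (m : E → Finset γ) (S : Finset γ),
      Nat.card {f // m f ⊆ S} = ∑ T ∈ S.powerset, Nat.card {f // m f = T} := by
    intro E _ m S
    simp only [Nat.card_eq_fintype_card, Fintype.card_subtype]
    rw [Finset.card_eq_sum_card_fiberwise (f := m) (t := S.powerset)
      (fun f hf => Finset.mem_coe.2 (Finset.mem_powerset.2 (Finset.mem_filter.1 hf).2))]
    refine Finset.sum_congr rfl fun T hT => ?_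
    rw [Finset.filter_filter]
    congr 1
    ext f
    simp only [Finset.mem_filter, Finset.mem_univ, true_and, and_iff_right_iff_imp]
    rintro rfl
    exact Finset.mem_powerset.1 hT
  induction S using Finset.strongInduction with
  | H S ih =>
    have h1 := h S
    rw [key m S, key m' S, ← Finset.insert_erase (Finset.mem_powerset_self S),
      Finset.sum_insert (Finset.notMem_erase _ _), Finset.sum_insert (Finset.notMem_erase _ _),
      Finset.sum_congr rfl fun T hT => ih T ?_] at h1
    · omega
    · rw [Finset.mem_erase, Finset.mem_powerset] at hT
      exact lt_of_le_of_ne hT.2 hT.1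

/-- The label-preserving map to the vertices of `A`. -/
noncomputable def PreGraph.labelMap (A : PreGraph) (N : ℕ) (i : Fin N) :
    Option A.graph.support := by
  classical
  exact if h : Sum.inl i.1 ∈ A.graph.support then some ⟨Sum.inl i, h⟩ else none

/-- Adjacency in `A`, where only the unlabeled vertices in `S` are available. -/
def PreGraph.relOn (A : PreGraph) (S : Set A.Unl) (u v : A.graph.support) : Prop :=
  A.graph.Adj u v ∧ (∀ k : A.Unl, u.1 = Sum.inr k.1 → k ∈ S) ∧
    ∀ k : A.Unl, v.1 = Sum.inr k.1 → k ∈ S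

theorem PreGraph.labelMap_ne {A : PreGraph} {N : ℕ} {i : Fin N} {u : A.graph.support} {k : ℕ}
    (h : A.labelMap N i = some u) : u.1 ≠ Sum.inr k := by
  rw [PreGraph.labelMap] at h
  split_ifs at h
  rw [← Option.some.inj h]
  simp

theorem PreGraph.exists_vert_of_unl (B : PreGraph) {N : ℕ} (hB : ∀ i ∈ B.labels, i < N)
    (b : B.Unl) : ∃ w, B.graph.Adj (B.vert N (Sum.inr b)) (B.vert N w) := by
  obtain ⟨y, hy⟩ := b.2
  obtain ⟨w, rfl⟩ := PreGraph.exists_vert hB hy.mem_support_right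
  exact ⟨w, hy⟩

/-- The target is `A` itself. Homomorphisms whose image uses unlabeled vertices of `A` only from `S`
are counted by `relOn S`, so by inclusion–exclusion equally many homomorphisms from `A` and from `B`
hit all unlabeled vertices. The identity of `A` is one of them. -/
theorem PreGraph.SameCounts.exists_hom {A B : PreGraph} {N : ℕ} (h : A.SameCounts B N)
    (hA : ∀ i ∈ A.labels, i < N) (hB : ∀ i ∈ B.labels, i < N) :
    ∃ f : B.Ext (optRel (A.relOn Set.univ)) (A.labelMap N),
      ∀ k : A.Unl, ∃ b, f.1 b = some ⟨Sum.inr k.1, k.2⟩ := by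
  classical
  have := Fintype.ofFinite A.Unl
  let m : ∀ B : PreGraph, B.Ext (optRel (A.relOn Set.univ)) (A.labelMap N) → Finset A.Unl :=
    fun B f => Finset.univ.filter fun k => ∃ b, f.1 b = some ⟨Sum.inr k.1, k.2⟩
  have hm : ∀ (B : PreGraph), (∀ i ∈ B.labels, i < N) → ∀ S : Finset A.Unl,
      Nat.card {f // m B f ⊆ S} = Nat.card (B.Ext (optRel (A.relOn S)) (A.labelMap N)) := by
    intro B hB S
    refine Nat.card_congr
      { toFun := fun f => ⟨f.1.1, fun u v huv => ?_⟩
        invFun := fun f => ⟨⟨f.1, fun u v huv => ?_⟩, ?_⟩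
        left_inv := fun f => rfl
        right_inv := fun f => rfl }
    · have h1 := f.1.2 u v huv
      have hS : ∀ w (x : A.graph.support), Sum.elim (A.labelMap N) f.1.1 w = some x →
          ∀ k : A.Unl, x.1 = Sum.inr k.1 → k ∈ S := by
        rintro (w | w) x hw k hk
        · exact absurd hk (PreGraph.labelMap_ne hw)
        · refine f.2 (Finset.mem_filter.2 ⟨Finset.mem_univ _, w, ?_⟩)
          rw [show f.1.1 w = some x from hw]
          exact congrArg some (Subtype.ext hk)
      rcases hu : Sum.elim (A.labelMap N) f.1.1 u with _ | x
      · rw [hu] at h1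
        rw [optRel_none_left h1]
        trivial
      · rw [hu] at h1
        obtain ⟨y, hv, hxy⟩ := optRel_some_left h1
        rw [hv]
        exact ⟨hxy.1, hS u x hu, hS v y hv⟩
    · have h1 := f.2 u v huv
      rcases hu : Sum.elim (A.labelMap N) f.1 u with _ | x
      · rw [hu] at h1
        rw [optRel_none_left h1]
        trivial
      · rw [hu] at h1
        obtain ⟨y, hv, hxy⟩ := optRel_some_left h1
        rw [hv]
        exact ⟨hxy.1, fun _ _ => trivial, fun _ _ => trivial⟩
    -- An unlabeled vertex of `B` has an edge. Its image is an edge of `relOn S`, whose unlabeled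
    -- endpoints lie in `S`.
    · intro k hk
      obtain ⟨b, hb⟩ := (Finset.mem_filter.1 hk).2
      obtain ⟨w, hw⟩ := B.exists_vert_of_unl hB b
      have h1 := f.2 _ _ hw
      rw [Sum.elim_inr, show f.1 b = some ⟨Sum.inr k.1, k.2⟩ from hb] at h1
      obtain ⟨y, -, hxy⟩ := optRel_some_left h1
      exact hxy.2.1 k rfl
  have hcard := card_eq_of_card_subset_eq (m A) (m B) (fun S => by
    rw [hm A hA S, hm B hB S]
    exact h _ _ _) Finset.univ
  have hne : Nonempty {f // m A f = Finset.univ} := by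
    have hval : ∀ w (hw : A.vert N w ∈ A.graph.support),
        Sum.elim (A.labelMap N) (fun a : A.Unl => some ⟨Sum.inr a.1, a.2⟩) w =
          some ⟨A.vert N w, hw⟩ := by
      rintro (w | w) hw
      · exact dif_pos hw
      · rfl
    refine ⟨⟨⟨fun a => some ⟨Sum.inr a.1, a.2⟩, fun u v huv => ?_⟩, ?_⟩⟩
    · rw [hval u huv.mem_support_left, hval v huv.mem_support_right]
      exact ⟨huv, fun _ _ => trivial, fun _ _ => trivial⟩
    · ext k
      simp only [m, Finset.mem_filter, Finset.mem_univ, true_and, iff_true]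
      exact ⟨k, rfl⟩
  have hpos : 0 < Nat.card {f // m A f = Finset.univ} := Nat.card_pos
  rw [hcard] at hpos
  obtain ⟨⟨f, hf⟩⟩ := (Nat.card_pos_iff.1 hpos).1
  exact ⟨f, fun k => by
    have hk : k ∈ m B f := hf ▸ Finset.mem_univ k
    exact (Finset.mem_filter.1 hk).2⟩

theorem PreGraph.SameCounts.card_unl_le {A B : PreGraph} {N : ℕ} (h : A.SameCounts B N)
    (hA : ∀ i ∈ A.labels, i < N) (hB : ∀ i ∈ B.labels, i < N) :
    Nat.card A.Unl ≤ Nat.card B.Unl := by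
  obtain ⟨f, hf⟩ := h.exists_hom hA hB
  choose s hs using hf
  refine Nat.card_le_card_of_injective s fun a b hab => ?_
  have := hs a
  rw [hab, hs b] at this
  have := congrArg Subtype.val (Option.some.inj this)
  exact Subtype.ext (Sum.inr_injective this).symm

/-- By symmetry both graphs have equally many unlabeled vertices, so a homomorphism that fixes
labels and hits every unlabeled vertex of `A` is bijective on unlabeled vertices. -/
theorem PreGraph.SameCounts.exists_map {A B : PreGraph} {N : ℕ} (h : A.SameCounts B N)
    (hA : ∀ i ∈ A.labels, i < N) (hB : ∀ i ∈ B.labels, i < N) :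
    ∃ F : ℕ ⊕ ℕ → ℕ ⊕ ℕ, B.graph.support.InjOn F ∧ (∀ i, F (Sum.inl i) = Sum.inl i) ∧
      (∀ k, ∃ l, F (Sum.inr k) = Sum.inr l) ∧
      ∀ u v, B.graph.Adj u v → A.graph.Adj (F u) (F v) := by
  classical
  have hcard : Nat.card A.Unl = Nat.card B.Unl :=
    le_antisymm (h.card_unl_le hA hB) (h.symm.card_unl_le hB hA)
  have hlab := h.symm.labels_subset hB
  obtain ⟨f, hf⟩ := h.exists_hom hA hB
  choose s hs using hf
  have hsi : Function.Injective s := by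
    intro a b hab
    have := hs a
    rw [hab, hs b] at this
    have := congrArg Subtype.val (Option.some.inj this)
    exact Subtype.ext (Sum.inr_injective this).symm
  have hsb : Function.Bijective s :=
    (Nat.bijective_iff_injective_and_card s).2 ⟨hsi, hcard⟩
  let e := Equiv.ofBijective s hsb
  let F : ℕ ⊕ ℕ → ℕ ⊕ ℕ := Sum.elim Sum.inl
    (fun k => if h : Sum.inr k ∈ B.graph.support then Sum.inr (e.symm ⟨k, h⟩).1 else Sum.inr k)
  have hF : ∀ k (h : Sum.inr k ∈ B.graph.support), F (Sum.inr k) = Sum.inr (e.symm ⟨k, h⟩).1 :=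
    fun k h => dif_pos h
  have hval : ∀ w, B.vert N w ∈ B.graph.support → ∃ hw,
      Sum.elim (A.labelMap N) f.1 w = some ⟨F (B.vert N w), hw⟩ := by
    rintro (w | w) hw
    · exact ⟨hlab hw, dif_pos (hlab hw)⟩
    · have h1 : F (B.vert N (Sum.inr w)) = Sum.inr (e.symm w).1 := hF w.1 hw
      have h2 := hs (e.symm w)
      have h3 : s (e.symm w) = w := e.apply_symm_apply w
      rw [h3] at h2
      refine ⟨h1 ▸ (e.symm w).2, ?_⟩
      simp only [h1]
      exact h2
  refine ⟨F, ?_, fun i => rfl, ?_, ?_⟩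
  · rintro (i | k) hu (j | l) hv huv
    · exact huv
    · rw [hF l hv] at huv
      simp [F] at huv
    · rw [hF k hu] at huv
      simp [F] at huv
    · rw [hF k hu, hF l hv] at huv
      have := e.symm.injective (Subtype.ext (Sum.inr_injective huv))
      simpa using this
  · intro k
    by_cases h : Sum.inr k ∈ B.graph.support
    · exact ⟨_, hF k h⟩
    · exact ⟨k, dif_neg h⟩
  · intro u v huv
    obtain ⟨w, rfl⟩ := PreGraph.exists_vert hB huv.mem_support_left
    obtain ⟨w', rfl⟩ := PreGraph.exists_vert hB huv.mem_support_right
    obtain ⟨h1, h1'⟩ := hval w huv.mem_support_left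
    obtain ⟨h2, h2'⟩ := hval w' huv.mem_support_right
    have := f.2 w w' huv
    rw [h1', h2'] at this
    exact this.1

theorem PreGraph.sym2_injOn {B : PreGraph} {F : ℕ ⊕ ℕ → ℕ ⊕ ℕ} (hF : B.graph.support.InjOn F) :
    B.graph.edgeSet.InjOn (Sym2.map F) := by
  intro e he e' he' hee
  induction e using Sym2.ind with | h a b => ?_
  induction e' using Sym2.ind with | h c d => ?_
  have hab : B.graph.Adj a b := he
  have hcd : B.graph.Adj c d := he'
  rw [Sym2.map_mk, Sym2.map_mk, Sym2.eq_iff] at hee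
  rw [Sym2.eq_iff]
  refine hee.imp ?_ ?_
  · exact fun h => ⟨hF hab.mem_support_left hcd.mem_support_left h.1,
      hF hab.mem_support_right hcd.mem_support_right h.2⟩
  · exact fun h => ⟨hF hab.mem_support_left hcd.mem_support_right h.1,
      hF hab.mem_support_right hcd.mem_support_left h.2⟩

theorem PreGraph.image_edgeSet_subset {A B : PreGraph} {F : ℕ ⊕ ℕ → ℕ ⊕ ℕ}
    (h : ∀ u v, B.graph.Adj u v → A.graph.Adj (F u) (F v)) :
    Sym2.map F '' B.graph.edgeSet ⊆ A.graph.edgeSet := by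
  rintro _ ⟨e, he, rfl⟩
  induction e using Sym2.ind with | h a b => ?_
  exact h a b he

theorem PreGraph.SameCounts.numEdges_le {A B : PreGraph} {N : ℕ} (h : A.SameCounts B N)
    (hA : ∀ i ∈ A.labels, i < N) (hB : ∀ i ∈ B.labels, i < N) : B.numEdges ≤ A.numEdges := by
  obtain ⟨F, hF, -, -, hadj⟩ := h.exists_map hA hB
  rw [PreGraph.numEdges, PreGraph.numEdges, ← (PreGraph.sym2_injOn hF).ncard_image]
  exact Set.ncard_le_ncard (PreGraph.image_edgeSet_subset hadj) A.edgeSet_finite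

/-- An injective homomorphism from `B` to `A` is injective on edges. The reverse comparison shows
that `A` has no more edges than `B`, so every edge of `A` is hit. -/
theorem PreGraph.SameCounts.iso {A B : PreGraph} {N : ℕ} (h : A.SameCounts B N)
    (hA : ∀ i ∈ A.labels, i < N) (hB : ∀ i ∈ B.labels, i < N) : B.Iso A := by
  have hle := h.symm.numEdges_le hB hA
  obtain ⟨F, hF, hl, hr, hadj⟩ := h.exists_map hA hB
  have himg : Sym2.map F '' B.graph.edgeSet = A.graph.edgeSet := by
    refine Set.eq_of_subset_of_ncard_le (PreGraph.image_edgeSet_subset hadj) ?_ A.edgeSet_finite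
    rw [(PreGraph.sym2_injOn hF).ncard_image]
    exact hle
  refine PreGraph.IsImage.iso (f := F) ⟨hF, fun x y => ⟨fun hxy => ?_, ?_⟩⟩ (fun i _ => hl i)
    (fun k _ => hr k)
  · have : s(x, y) ∈ Sym2.map F '' B.graph.edgeSet := by
      rw [himg]
      exact hxy
    obtain ⟨e, he, hexy⟩ := this
    induction e using Sym2.ind with | h a b => ?_
    have hab : B.graph.Adj a b := he
    rw [Sym2.map_mk, Sym2.eq_iff] at hexy
    rcases hexy with h | h
    · exact ⟨a, b, hab, h⟩
    · exact ⟨b, a, hab.symm, h.2, h.1⟩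
  · rintro ⟨u, v, huv, rfl, rfl⟩
    exact hadj u v huv

/-- Distinct graphs without unlabeled components are separated by a strict Cauchy–Schwarz
inequality between densities. -/
theorem exists_strict_dens {d ℓ : ℕ} {A B : PLGraph} (hA : A ∈ reducedB d ℓ)
    (hB : B ∈ reducedB d ℓ) (hAB : A ≠ B) : ∃ (Y : Type) (_ : Fintype Y) (r : Y → Y → Prop),
      gram d (fun C => C.1.dens (optRel r)) A B ^ 2 <
        gram d (fun C => C.1.dens (optRel r)) A A * gram d (fun C => C.1.dens (optRel r)) B B := by
  induction A using PLGraph.ind with | h A => ?_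
  induction B using PLGraph.ind with | h B => ?_
  by_contra! hle
  refine hAB (Quotient.sound (PreGraph.SameCounts.iso (N := ℓ) ?_ hB.2.1 hA.2.1))
  intro Y hY r φ
  have := Fintype.ofFinite Y
  have h := hle Y this r
  simp only [gram, eval_dens_toMonomial _ d _ _ hA.1 hA.1, eval_dens_toMonomial _ d _ _ hA.1 hB.1,
    eval_dens_toMonomial _ d _ _ hB.1 hB.1] at h
  rw [PLGraph.dens_unlabel_mul _ hA.2.1 hA.2.1, PLGraph.dens_unlabel_mul _ hA.2.1 hB.2.1,
    PLGraph.dens_unlabel_mul _ hB.2.1 hB.2.1, mul_mul_mul_comm, mul_pow, ← sq] at h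
  have hn : (0 : ℝ) < Fintype.card (Option Y) := by exact_mod_cast Fintype.card_pos
  -- Without strictness the two vectors of normalized extension counts are proportional. Comparing
  -- `φ` with the constant `none`, where both counts are one, determines the factor.
  have h1 := mul_eq_mul_of_sum_sq_le (le_of_mul_le_mul_left h (by positivity)) φ (fun _ => none)
  rw [PreGraph.card_ext_none hA.2.1 hA.2.2, PreGraph.card_ext_none hB.2.1 hB.2.2] at h1
  have hp1 : (Fintype.card (Option Y) : ℝ) ^ Nat.card A.Unl ≠ 0 := by positivity
  have hp2 : (Fintype.card (Option Y) : ℝ) ^ Nat.card B.Unl ≠ 0 := by positivity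
  field_simp at h1
  exact_mod_cast h1.symm

/-! ### The cone of logarithms -/

noncomputable instance (d : ℕ) : Fintype (V d) := Fintype.ofFinite _

/-- The logarithm of the monomial `[[AB]]` in logarithmic coordinates. -/
noncomputable def logGram (d : ℕ) (y : V d → ℝ) (A B : PLGraph) : ℝ :=
  ∑ C : V d, ((A * B).unlabel.mult C : ℝ) * y C

theorem gram_eq_prod (d : ℕ) (v : V d → ℝ) (A B : PLGraph) :
    gram d v A B = ∏ C : V d, v C ^ (A * B).unlabel.mult C := by
  rw [gram, toMonomial, finprod_eq_prod_of_fintype, map_prod]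
  simp

theorem gram_exp (d : ℕ) (y : V d → ℝ) (A B : PLGraph) :
    gram d (fun C => Real.exp (y C)) A B = Real.exp (logGram d y A B) := by
  rw [gram_eq_prod, logGram, Real.exp_sum]
  exact Finset.prod_congr rfl fun C _ => (Real.exp_nat_mul _ _).symm

theorem logGram_add (d : ℕ) (y z : V d → ℝ) (A B : PLGraph) :
    logGram d (y + z) A B = logGram d y A B + logGram d z A B := by
  simp only [logGram, Pi.add_apply, mul_add, Finset.sum_add_distrib]

theorem logGram_smul (d : ℕ) (c : ℝ) (y : V d → ℝ) (A B : PLGraph) :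
    logGram d (c • y) A B = c * logGram d y A B := by
  simp only [logGram, Pi.smul_apply, smul_eq_mul, Finset.mul_sum]
  exact Finset.sum_congr rfl fun C _ => by ring

theorem logGram_sum (d : ℕ) {ι : Type} (s : Finset ι) (y : ι → V d → ℝ) (A B : PLGraph) :
    logGram d (∑ i ∈ s, y i) A B = ∑ i ∈ s, logGram d (y i) A B := by
  simp only [logGram, Finset.sum_apply, Finset.mul_sum]
  exact Finset.sum_comm

theorem logGram_splits (d : ℕ) (y : V d → ℝ) {A₁ A₂ B₁ B₂ : PreGraph}
    (h : PreGraph.Splits A₁ A₂ B₁ B₂) :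
    logGram d y (PLGraph.mk (A₁.union A₂)) (PLGraph.mk (B₁.union B₂)) =
      logGram d y (PLGraph.mk A₁) (PLGraph.mk B₁) +
        logGram d y (PLGraph.mk A₂) (PLGraph.mk B₂) := by
  refine Real.exp_injective ?_
  rw [Real.exp_add, ← gram_exp, ← gram_exp, ← gram_exp, gram_splits d _ h]

theorem gram_of_mem (d : ℕ) (v : V d → ℝ) {A B : PLGraph} (h : (A * B).unlabel ∈ V d) :
    gram d v A B = v ⟨_, h⟩ := by
  rw [gram, toMonomial_of_mem d h, MvPolynomial.eval_X]

theorem logGram_of_mem (d : ℕ) (y : V d → ℝ) {A B : PLGraph} (h : (A * B).unlabel ∈ V d) :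
    logGram d y A B = y ⟨_, h⟩ := by
  refine Real.exp_injective ?_
  rw [← gram_exp, gram_of_mem d _ h]

/-- The cone of all `y` such that the point `exp y` has nonnegative `2 × 2` minors. -/
def logCone (d ℓ : ℕ) : Set (V d → ℝ) :=
  {y | ∀ A ∈ reducedB d ℓ, ∀ B ∈ reducedB d ℓ,
    2 * logGram d y A B ≤ logGram d y A A + logGram d y B B}

theorem mem_nonnegMinors₂_iff {d ℓ : ℕ} {v : V d → ℝ} :
    v ∈ Trop.nonnegMinors₂ (reducedMomentMatrix d ℓ) ↔ (∀ C, 0 ≤ v C) ∧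
      ∀ A ∈ reducedB d ℓ, ∀ B ∈ reducedB d ℓ,
        gram d v A B ^ 2 ≤ gram d v A A * gram d v B B := by
  refine and_congr_right fun _ => ?_
  have hdet : ∀ a b : reducedB d ℓ,
      (((reducedMomentMatrix d ℓ).map (MvPolynomial.eval v)).submatrix ![a, b] ![a, b]).det =
        gram d v a a * gram d v b b - gram d v a b ^ 2 := by
    intro a b
    rw [Matrix.det_fin_two]
    show gram d v a a * gram d v b b - gram d v a b * gram d v b a = _
    rw [gram_comm d v b a]
    ring
  constructor
  · intro h A hA B hB
    by_cases hAB : A = B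
    · rw [hAB, sq]
    · have := h ⟨A, hA⟩ ⟨B, hB⟩ (fun h => hAB (congrArg Subtype.val h))
      rw [hdet] at this
      linarith
  · intro h a b _
    rw [hdet]
    linarith [h a a.2 b b.2]

theorem exp_mem_nonnegMinors₂_iff {d ℓ : ℕ} {y : V d → ℝ} :
    (fun C => Real.exp (y C)) ∈ Trop.nonnegMinors₂ (reducedMomentMatrix d ℓ) ↔
      y ∈ logCone d ℓ := by
  rw [mem_nonnegMinors₂_iff, and_iff_right fun C => (Real.exp_pos _).le]
  refine forall₄_congr fun A _ B _ => ?_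
  rw [gram_exp, gram_exp, gram_exp, ← Real.exp_add, ← Real.exp_nat_mul, Real.exp_le_exp]
  norm_num

theorem logSet_nonnegMinors₂ (d ℓ : ℕ) :
    Trop.logSet (Trop.nonnegMinors₂ (reducedMomentMatrix d ℓ)) = logCone d ℓ := by
  ext y
  constructor
  · rintro ⟨v, ⟨hv, hpos⟩, rfl⟩
    rw [← exp_mem_nonnegMinors₂_iff]
    convert hv using 1
    funext C
    exact Real.exp_log (hpos C)
  · intro hy
    refine ⟨fun C => Real.exp (y C), ⟨exp_mem_nonnegMinors₂_iff.2 hy, fun C => Real.exp_pos _⟩, ?_⟩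
    funext C
    exact Real.log_exp _

theorem reducedB_finite (d ℓ : ℕ) : (reducedB d ℓ).Finite :=
  (PLGraph.finite_setOf d ℓ).subset fun _ h => ⟨h.1, h.2.1⟩

theorem isRationalPolyhedralCone_logCone (d ℓ : ℕ) :
    Trop.IsRationalPolyhedralCone (logCone d ℓ) := by
  classical
  refine ⟨((reducedB_finite d ℓ).toFinset ×ˢ (reducedB_finite d ℓ).toFinset).image fun p =>
    Finsupp.equivFunOnFinite.symm fun C : V d => ((p.1 * p.1).unlabel.mult C : ℤ) +
      (p.2 * p.2).unlabel.mult C - 2 * (p.1 * p.2).unlabel.mult C, ?_⟩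
  ext y
  simp only [Finset.mem_image, Finset.mem_product, Set.Finite.mem_toFinset, Prod.exists,
    Set.mem_ofPred_eq, forall_exists_index, and_imp]
  have key : ∀ A B : PLGraph, ((Finsupp.equivFunOnFinite.symm fun C : V d =>
      ((A * A).unlabel.mult C : ℤ) + (B * B).unlabel.mult C -
        2 * (A * B).unlabel.mult C).sum fun i c => (c : ℝ) * y i) =
      logGram d y A A + logGram d y B B - 2 * logGram d y A B := by
    intro A B
    rw [Finsupp.sum_fintype _ _ (by simp), logGram, logGram, logGram, Finset.mul_sum,
      ← Finset.sum_add_distrib, ← Finset.sum_sub_distrib]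
    refine Finset.sum_congr rfl fun C _ => ?_
    simp only [Finsupp.equivFunOnFinite_symm_apply_apply]
    push_cast
    ring
  constructor
  · rintro h _ A B hA hB rfl
    rw [key]
    linarith [h A hA B hB]
  · intro h A hA B hB
    have := h _ A B hA hB rfl
    rw [key] at this
    linarith

/-! ### Minors of points of the profile, strict points, vanishing coordinates -/

theorem gram_sq_le_of_mem_sosProfile {d : ℕ} {v : V d → ℝ} (hv : v ∈ sosProfile d)
    {A B : PLGraph} (hA : A.numEdges ≤ d) (hB : B.numEdges ≤ d) :
    gram d v A B ^ 2 ≤ gram d v A A * gram d v B B := by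
  have h : ∀ x : ℝ, 0 ≤ gram d v A A * (x * x) + (2 * gram d v A B) * x + gram d v B B := by
    intro x
    have := (mem_sosProfile_iff.1 hv).2.family Finset.univ ![x, 1] ![A, B] (by
      intro i _
      fin_cases i
      · exact hA
      · exact hB)
    simp only [Fin.sum_univ_two, Matrix.cons_val_zero, Matrix.cons_val_one] at this
    rw [gram_comm d v B A] at this
    linarith
  have := discrim_le_zero h
  rw [discrim] at this
  linarith

theorem sosProfile_subset_nonnegMinors₂ (d ℓ : ℕ) :
    sosProfile d ⊆ Trop.nonnegMinors₂ (reducedMomentMatrix d ℓ) :=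
  fun _ hv => mem_nonnegMinors₂_iff.2 ⟨hv.1, fun _ hA _ hB =>
    gram_sq_le_of_mem_sosProfile hv hA.1 hB.1⟩

/-- The cone has a nonpositive point at which all nontrivial inequalities are strict. -/
theorem exists_strict (d ℓ : ℕ) : ∃ y : V d → ℝ, (∀ C, y C ≤ 0) ∧
    ∀ A ∈ reducedB d ℓ, ∀ B ∈ reducedB d ℓ, A ≠ B →
      2 * logGram d y A B < logGram d y A A + logGram d y B B := by
  classical
  have hpair : ∀ p : PLGraph × PLGraph, ∃ y : V d → ℝ, (∀ C, y C ≤ 0) ∧ y ∈ logCone d ℓ ∧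
      (p.1 ∈ reducedB d ℓ → p.2 ∈ reducedB d ℓ → p.1 ≠ p.2 →
        2 * logGram d y p.1 p.2 < logGram d y p.1 p.1 + logGram d y p.2 p.2) := by
    rintro ⟨A, B⟩
    by_cases h : A ∈ reducedB d ℓ ∧ B ∈ reducedB d ℓ ∧ A ≠ B
    · obtain ⟨Y, _, r, hr⟩ := exists_strict_dens h.1 h.2.1 h.2.2
      -- The loop at `none` makes all densities positive. As they are at most one, their logarithms
      -- are nonpositive.
      have hpos : ∀ C : V d, 0 < C.1.dens (optRel r) := fun C =>
        C.1.dens_pos (optRel r) (x := none) trivial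
      have hexp : (fun C : V d => Real.exp (Real.log (C.1.dens (optRel r)))) =
          fun C : V d => C.1.dens (optRel r) := funext fun C => Real.exp_log (hpos C)
      refine ⟨fun C => Real.log (C.1.dens (optRel r)), fun C => ?_, ?_, fun _ _ _ => ?_⟩
      · exact Real.log_nonpos (hpos C).le (C.1.dens_le_one _)
      · rw [← exp_mem_nonnegMinors₂_iff, hexp]
        exact sosProfile_subset_nonnegMinors₂ d ℓ (dens_mem_sosProfile (optRel r) d)
      · rw [← hexp, gram_exp, gram_exp, gram_exp, ← Real.exp_add, ← Real.exp_nat_mul,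
          Real.exp_lt_exp] at hr
        exact_mod_cast hr
    · refine ⟨0, fun C => le_rfl, fun A _ B _ => by simp [logGram], fun h1 h2 h3 => ?_⟩
      exact absurd ⟨h1, h2, h3⟩ h
  choose y hy0 hyc hys using hpair
  let P := (reducedB_finite d ℓ).toFinset ×ˢ (reducedB_finite d ℓ).toFinset
  -- Every summand satisfies all inequalities weakly, and the summand belonging to a pair satisfies
  -- its inequality strictly.
  refine ⟨∑ p ∈ P, y p, fun C => ?_, fun A hA B hB hAB => ?_⟩
  · rw [Finset.sum_apply]
    exact Finset.sum_nonpos fun p _ => hy0 p C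
  · rw [logGram_sum, logGram_sum, logGram_sum, Finset.mul_sum, ← Finset.sum_add_distrib]
    refine Finset.sum_lt_sum (fun p _ => hyc p A hA B hB) ⟨(A, B), ?_, hys (A, B) hA hB hAB⟩
    simp [P, hA, hB]

theorem mk_mem_reducedB_of_union {d ℓ : ℕ} {A₁ A₂ : PreGraph}
    (h : Disjoint A₁.graph.support A₂.graph.support)
    (hA : PLGraph.mk (A₁.union A₂) ∈ reducedB d ℓ) : PLGraph.mk A₁ ∈ reducedB d ℓ := by
  refine ⟨?_, fun i hi => hA.2.1 i ?_, fun u hu => ?_⟩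
  · have h1 : (A₁.union A₂).numEdges ≤ d := hA.1
    rw [PreGraph.numEdges_union h] at h1
    show A₁.numEdges ≤ d
    omega
  · show Sum.inl i ∈ (A₁.union A₂).graph.support
    rw [PreGraph.union_support]
    exact Or.inl hi
  · have hu' : u ∈ (A₁.union A₂).graph.support := by
      rw [PreGraph.union_support]
      exact Or.inl hu
    obtain ⟨i, hi⟩ := hA.2.2 u hu'
    refine ⟨i, ((PreGraph.isClosed_union_left h).reachable (H := A₁) ?_ hi hu).2⟩
    rintro a ha b (hab | hab)
    · exact hab
    · exact absurd hab (PreGraph.not_adj_of_disjoint h ha)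

/-- It suffices to know the inequalities for connected products. -/
theorem mem_logCone_of_connected {d ℓ : ℕ} {y : V d → ℝ}
    (h : ∀ A ∈ reducedB d ℓ, ∀ B ∈ reducedB d ℓ, (A * B).unlabel ∈ V d →
      2 * logGram d y A B ≤ logGram d y A A + logGram d y B B) : y ∈ logCone d ℓ := by
  intro A hA B hB
  induction A using PLGraph.ind with | h A => ?_
  induction B using PLGraph.ind with | h B => ?_
  induction A, B using PreGraph.mul_induction with
  | hempty A B h1 h2 =>
    have : A = B := PreGraph.ext' fun u v => by rw [h1, h2]
    rw [this]
    linarith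
  | hconn A B hc =>
    exact h _ hA _ hB ⟨PreGraph.isConnected_rename hc, _, _, hA.1, hB.1, rfl⟩
  | hsplit A₁ A₂ B₁ B₂ hs ih1 ih2 =>
    have hA2 := hA
    have hB2 := hB
    rw [PreGraph.union_comm'] at hA2 hB2
    have i1 := ih1 (mk_mem_reducedB_of_union hs.left hA) (mk_mem_reducedB_of_union hs.right hB)
    have i2 := ih2 (mk_mem_reducedB_of_union hs.left.symm hA2)
      (mk_mem_reducedB_of_union hs.right.symm hB2)
    rw [logGram_splits d y hs, logGram_splits d y (PreGraph.Splits.diag hs.left),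
      logGram_splits d y (PreGraph.Splits.diag hs.right)]
    linarith

/-- The logarithm of a point with nonnegative minors extends to the coordinates that vanish. -/
theorem exists_mem_logCone {d ℓ : ℕ} {v : V d → ℝ}
    (hv : v ∈ Trop.nonnegMinors₂ (reducedMomentMatrix d ℓ)) :
    ∃ y ∈ logCone d ℓ, ∀ C, 0 < v C → y C = Real.log (v C) := by
  classical
  obtain ⟨hv0, hvm⟩ := mem_nonnegMinors₂_iff.1 hv
  obtain ⟨y₀, hy0, hys⟩ := exists_strict d ℓ
  let r : V d → ℝ := fun C => if 0 < v C then Real.log (v C) else 0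
  -- The missing logarithms of vanishing coordinates are filled in by a multiple `N` of the strict
  -- point `y₀`, with `N` large.
  let y : ℝ → V d → ℝ := fun N C => if 0 < v C then Real.log (v C) else N * y₀ C
  have hfin := reducedB_finite d ℓ
  have hev : ∀ᶠ N : ℝ in atTop, ∀ A ∈ reducedB d ℓ, ∀ B ∈ reducedB d ℓ, A ≠ B →
      0 ≤ logGram d r A A + logGram d r B B +
        N * (logGram d y₀ A A + logGram d y₀ B B - 2 * logGram d y₀ A B) := by
    refine (eventually_all_finite hfin).2 fun A hA => (eventually_all_finite hfin).2 fun B hB => ?_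
    by_cases hAB : A = B
    · exact Eventually.of_forall fun N h => absurd hAB h
    · have hδ : 0 < logGram d y₀ A A + logGram d y₀ B B - 2 * logGram d y₀ A B := by
        linarith [hys A hA B hB hAB]
      have ht := tendsto_atTop_add_const_left atTop (logGram d r A A + logGram d r B B)
        (tendsto_id.atTop_mul_const hδ)
      filter_upwards [ht.eventually_ge_atTop 0] with N hN _
      exact hN
  obtain ⟨N, hN, hN0⟩ := (hev.and (eventually_ge_atTop 0)).exists
  refine ⟨y N, mem_logCone_of_connected fun A hA B hB hK => ?_, fun C hC => if_pos hC⟩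
  by_cases hAB : A = B
  · rw [hAB]
    linarith
  rw [logGram_of_mem d (y N) hK]
  -- As `[[AB]]` is a single variable, it is either positive or zero. If it is positive, the minor
  -- forces both diagonal monomials to be positive, so all variables in them keep their logarithms
  -- and the inequality is the logarithm of the minor.
  by_cases hKpos : 0 < v ⟨_, hK⟩
  · have hyK : y N ⟨_, hK⟩ = Real.log (v ⟨_, hK⟩) := if_pos hKpos
    have hm := hvm A hA B hB
    rw [gram_of_mem d v hK] at hm
    have hprod : 0 < gram d v A A * gram d v B B := (pow_pos hKpos 2).trans_le hm
    have hne := mul_ne_zero_iff.1 hprod.ne'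
    have hlog : ∀ D : PLGraph, gram d v D D ≠ 0 →
        logGram d (y N) D D = Real.log (gram d v D D) := by
      intro D hD
      rw [gram_eq_prod] at hD ⊢
      rw [Real.log_prod fun C hC => Finset.prod_ne_zero_iff.1 hD C hC, logGram]
      refine Finset.sum_congr rfl fun C hC => ?_
      rw [Real.log_pow]
      by_cases hm0 : (D * D).unlabel.mult C = 0
      · rw [hm0]
        simp
      · have : v C ≠ 0 := fun h0 => Finset.prod_ne_zero_iff.1 hD C hC (by rw [h0, zero_pow hm0])
        rw [show y N C = Real.log (v C) from if_pos (lt_of_le_of_ne (hv0 C) this.symm)]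
    rw [hlog A hne.1, hlog B hne.2, ← Real.log_mul hne.1 hne.2, hyK]
    have := Real.log_le_log (by positivity) hm
    rwa [Real.log_pow] at this
  · have hyK : y N ⟨_, hK⟩ = N * y₀ ⟨_, hK⟩ := if_neg hKpos
    -- Because `y₀ ≤ 0`, the point `y N` dominates `r + N • y₀`. By the choice of `N`, the gap of
    -- `y₀` at `(A, B)` outweighs the fixed contribution of `r`.
    have hge : ∀ D : PLGraph, logGram d r D D + N * logGram d y₀ D D ≤ logGram d (y N) D D := by
      intro D
      rw [← logGram_smul, ← logGram_add, logGram, logGram]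
      refine Finset.sum_le_sum fun C _ => mul_le_mul_of_nonneg_left ?_ (Nat.cast_nonneg _)
      simp only [Pi.add_apply, Pi.smul_apply, smul_eq_mul, r, y]
      split_ifs
      · linarith [mul_nonpos_of_nonneg_of_nonpos hN0 (hy0 C)]
      · linarith
    have h1 := hN A hA B hB hAB
    have h2 : logGram d y₀ A B = y₀ ⟨_, hK⟩ := logGram_of_mem d y₀ hK
    rw [h2] at h1
    rw [hyK]
    linarith [hge A, hge B]

/-! ### From the cone back to the profile -/

/-- Strict points of the cone give points of the profile, by diagonal dominance. -/
theorem eventually_exp_mem_sosProfile {d ℓ : ℕ} (hℓ : 2 * d ≤ ℓ) {z : V d → ℝ}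
    (hz : ∀ A ∈ reducedB d ℓ, ∀ B ∈ reducedB d ℓ, A ≠ B →
      2 * logGram d z A B < logGram d z A A + logGram d z B B) :
    ∀ᶠ s : ℝ in atTop, (fun C => Real.exp (s * z C)) ∈ sosProfile d := by
  classical
  have hfin := reducedB_finite d ℓ
  set n : ℝ := (hfin.toFinset.card : ℝ) with hn
  have hn0 : 0 ≤ n := Nat.cast_nonneg _
  -- These exponentials are the off-diagonal entries after scaling to unit diagonal. With `n`
  -- reduced graphs, the bound `1 / (n + 1)` leaves the nonnegative factor `1 - card / (n + 1)` in
  -- front of the sum of squares.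
  have hev : ∀ᶠ s : ℝ in atTop, ∀ A ∈ reducedB d ℓ, ∀ B ∈ reducedB d ℓ, A ≠ B →
      Real.exp (-(s * ((logGram d z A A + logGram d z B B) / 2 - logGram d z A B))) ≤
        1 / (n + 1) := by
    refine (eventually_all_finite hfin).2 fun A hA => (eventually_all_finite hfin).2 fun B hB => ?_
    by_cases hAB : A = B
    · exact Eventually.of_forall fun N h => absurd hAB h
    · have hδ : 0 < (logGram d z A A + logGram d z B B) / 2 - logGram d z A B := by
        linarith [hz A hA B hB hAB]
      have ht := Real.tendsto_exp_neg_atTop_nhds_zero.comp (tendsto_id.atTop_mul_const hδ)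
      filter_upwards [ht.eventually_le_const (u := 1 / (n + 1)) (by positivity)] with s hs _
      exact hs
  filter_upwards [hev] with s hs
  refine mem_sosProfile_of_reduced hℓ (fun C => (Real.exp_pos _).le) fun a ha => ?_
  have hexp : ∀ A B, gram d (fun C => Real.exp (s * z C)) A B =
      Real.exp (s * logGram d z A B) := by
    intro A B
    rw [← logGram_smul, ← gram_exp]
    rfl
  set w : PLGraph → ℝ := fun A => a A * Real.exp (s * logGram d z A A / 2) with hw
  have hterm : ∀ A ∈ a.support, ∀ B ∈ a.support,
      (if A = B then w A ^ 2 else 0) - 1 / (n + 1) * ((w A ^ 2 + w B ^ 2) / 2) ≤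
        a A * a B * gram d (fun C => Real.exp (s * z C)) A B := by
    intro A hA B hB
    have hx : a A * a B * gram d (fun C => Real.exp (s * z C)) A B = w A * w B *
        Real.exp (-(s * ((logGram d z A A + logGram d z B B) / 2 - logGram d z A B))) := by
      rw [hexp, hw]
      have : Real.exp (s * logGram d z A B) = Real.exp (s * logGram d z A A / 2) *
          Real.exp (s * logGram d z B B / 2) *
          Real.exp (-(s * ((logGram d z A A + logGram d z B B) / 2 - logGram d z A B))) := by
        rw [← Real.exp_add, ← Real.exp_add]
        congr 1
        ring
      rw [this]
      ring
    rw [hx]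
    have hn1 : 0 ≤ 1 / (n + 1) := by positivity
    by_cases hAB : A = B
    · subst hAB
      rw [if_pos rfl, show -(s * ((logGram d z A A + logGram d z A A) / 2 - logGram d z A A)) = 0 by
        ring, Real.exp_zero]
      nlinarith [mul_nonneg hn1 (sq_nonneg (w A))]
    · rw [if_neg hAB]
      have h1 := hs A (ha A hA) B (ha B hB) hAB
      set E := Real.exp (-(s * ((logGram d z A A + logGram d z B B) / 2 - logGram d z A B)))
      have hE : 0 < E := Real.exp_pos _
      have h2 : -((w A ^ 2 + w B ^ 2) / 2) ≤ w A * w B := by nlinarith [sq_nonneg (w A + w B)]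
      have h3 : 0 ≤ (w A ^ 2 + w B ^ 2) / 2 := by positivity
      have h4 := mul_le_mul_of_nonneg_right h1 h3
      have h5 := mul_le_mul_of_nonneg_right h2 hE.le
      linarith
  rw [momentForm_self]
  refine le_trans ?_ (Finset.sum_le_sum fun A hA => Finset.sum_le_sum fun B hB => hterm A hA B hB)
  have hsum : ∑ A ∈ a.support, ∑ B ∈ a.support,
      ((if A = B then w A ^ 2 else 0) - 1 / (n + 1) * ((w A ^ 2 + w B ^ 2) / 2)) =
      (1 - 1 / (n + 1) * a.support.card) * ∑ A ∈ a.support, w A ^ 2 := by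
    simp only [Finset.sum_sub_distrib, ← Finset.mul_sum, ← Finset.sum_div,
      Finset.sum_add_distrib, Finset.sum_const, nsmul_eq_mul]
    have : ∑ A ∈ a.support, ∑ B ∈ a.support, (if A = B then w A ^ 2 else 0) =
        ∑ A ∈ a.support, w A ^ 2 :=
      Finset.sum_congr rfl fun A hA => by rw [Finset.sum_ite_eq, if_pos hA]
    rw [this]
    ring
  rw [hsum]
  have hcard : (a.support.card : ℝ) ≤ n := by
    rw [hn]
    exact_mod_cast Finset.card_le_card fun A hA => hfin.mem_toFinset.2 (ha A hA)
  refine mul_nonneg ?_ (Finset.sum_nonneg fun A _ => sq_nonneg _)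
  rw [sub_nonneg, one_div, inv_mul_le_iff₀ (by positivity)]
  linarith

/-- Each `z k = y + y₀ / (k + 1)` is strict, so `exp (s k * z k)` lies in the profile for some `s k
≥ k + 1`. With `τ k = exp (-s k)` the logarithm to base `1 / τ k` returns exactly `z k`, which tends
to `y`. -/
theorem logCone_subset_trop {d ℓ : ℕ} (hℓ : 2 * d ≤ ℓ) :
    logCone d ℓ ⊆ Trop.trop (sosProfile d) := by
  intro y hy
  obtain ⟨y₀, -, hys⟩ := exists_strict d ℓ
  let z : ℕ → V d → ℝ := fun k => y + (1 / ((k : ℝ) + 1)) • y₀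
  have hz : ∀ k : ℕ, ∃ s : ℝ, (k : ℝ) + 1 ≤ s ∧ (fun C => Real.exp (s * z k C)) ∈ sosProfile d := by
    intro k
    refine ((eventually_ge_atTop ((k : ℝ) + 1)).and (eventually_exp_mem_sosProfile hℓ
      fun A hA B hB hAB => ?_)).exists
    simp only [z, logGram_add, logGram_smul]
    have h1 := hy A hA B hB
    have h2 := mul_lt_mul_of_pos_left (hys A hA B hB hAB) (Nat.one_div_pos_of_nat (α := ℝ) (n := k))
    linarith
  choose s hs hsp using hz
  have hspos : ∀ k, 0 < s k := fun k => lt_of_lt_of_le (by positivity) (hs k)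
  have hs_top : Tendsto s atTop atTop := by
    refine tendsto_atTop_mono (f := fun k : ℕ => (k : ℝ)) (fun k => ?_)
      tendsto_natCast_atTop_atTop
    linarith [hs k]
  refine ⟨fun k => Real.exp (-s k), fun k C => Real.exp (s k * z k C), fun k => ?_, ?_, fun k => ?_,
    ?_⟩
  · exact ⟨Real.exp_pos _, (Real.exp_lt_exp.2 (by linarith [hspos k])).trans_eq Real.exp_zero⟩
  · exact Real.tendsto_exp_neg_atTop_nhds_zero.comp hs_top
  · exact ⟨hsp k, fun C => Real.exp_pos _⟩
  · have : (fun k C => Real.logb (1 / Real.exp (-s k)) (Real.exp (s k * z k C))) = z := by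
      funext k C
      rw [Real.logb, Real.log_exp, one_div, ← Real.exp_neg, neg_neg, Real.log_exp,
        mul_div_cancel_left₀ _ (hspos k).ne']
    rw [this, tendsto_pi_nhds]
    intro C
    have h := (tendsto_one_div_add_atTop_nhds_zero_nat (𝕜 := ℝ)).mul_const (y₀ C)
    have h2 := h.const_add (y C)
    rw [zero_mul, add_zero] at h2
    exact h2

end GraphSos

namespace Trop

/-! ### Rational polyhedral cones -/

variable {ι : Type*} [Fintype ι]

theorem isRationalPolyhedralCone_iff {C : Set (ι → ℝ)} : IsRationalPolyhedralCone C ↔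
    ∃ A : Finset (ι →₀ ℤ), C = {y | ∀ a ∈ A, 0 ≤ ∑ i, (a i : ℝ) * y i} := by
  refine exists_congr fun A => ?_
  have : ∀ (a : ι →₀ ℤ) (y : ι → ℝ), (a.sum fun i c => (c : ℝ) * y i) = ∑ i, (a i : ℝ) * y i :=
    fun a y => Finsupp.sum_fintype _ _ (by simp)
  simp only [this]

theorem IsRationalPolyhedralCone.isClosed {C : Set (ι → ℝ)} (h : IsRationalPolyhedralCone C) :
    IsClosed C := by
  obtain ⟨A, rfl⟩ := isRationalPolyhedralCone_iff.1 h
  simp only [Set.ofPred_forall]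
  refine isClosed_iInter fun a => isClosed_iInter fun _ => isClosed_le continuous_const ?_
  fun_prop

theorem IsRationalPolyhedralCone.smul_mem {C : Set (ι → ℝ)} (h : IsRationalPolyhedralCone C)
    {c : ℝ} (hc : 0 ≤ c) {y : ι → ℝ} (hy : y ∈ C) : c • y ∈ C := by
  obtain ⟨A, rfl⟩ := isRationalPolyhedralCone_iff.1 h
  intro a ha
  have : ∑ i, (a i : ℝ) * (c • y) i = c * ∑ i, (a i : ℝ) * y i := by
    rw [Finset.mul_sum]
    exact Finset.sum_congr rfl fun i _ => by simp only [Pi.smul_apply, smul_eq_mul]; ring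
  rw [this]
  exact mul_nonneg hc (hy a ha)

theorem exists_between_finset {α : Type*} (P N : Finset α) (f g : α → ℝ)
    (h : ∀ a ∈ P, ∀ b ∈ N, f a ≤ g b) : ∃ u, (∀ a ∈ P, f a ≤ u) ∧ ∀ b ∈ N, u ≤ g b := by
  by_cases hP : P.Nonempty
  · exact ⟨P.sup' hP f, fun a ha => Finset.le_sup' f ha, fun b hb =>
      Finset.sup'_le hP f fun a ha => h a ha b hb⟩
  · rw [Finset.not_nonempty_iff_eq_empty] at hP
    subst hP
    by_cases hN : N.Nonempty
    · exact ⟨N.inf' hN g, by simp, fun b hb => Finset.inf'_le g hb⟩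
    · rw [Finset.not_nonempty_iff_eq_empty] at hN
      subst hN
      exact ⟨0, by simp, by simp⟩

/-- Fourier–Motzkin elimination of one coordinate. -/
theorem IsRationalPolyhedralCone.eliminate [DecidableEq ι] {C : Set (ι → ℝ)}
    (h : IsRationalPolyhedralCone C) (i : ι) :
    IsRationalPolyhedralCone {y | ∃ t, Function.update y i t ∈ C} := by
  classical
  obtain ⟨A, rfl⟩ := isRationalPolyhedralCone_iff.1 h
  have hL : ∀ (a : ι →₀ ℤ) (y : ι → ℝ) (t : ℝ), ∑ j, (a j : ℝ) * Function.update y i t j =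
      ∑ j, (a j : ℝ) * y j + a i * (t - y i) := by
    intro a y t
    rw [← Finset.add_sum_erase _ _ (Finset.mem_univ i),
      ← Finset.add_sum_erase _ (fun j => (a j : ℝ) * y j) (Finset.mem_univ i),
      Function.update_self, Finset.sum_congr rfl fun j hj => by
        rw [Function.update_of_ne (Finset.ne_of_mem_erase hj)]]
    ring
  have hcomb : ∀ (a b : ι →₀ ℤ) (y : ι → ℝ), ∑ j, ((a i • b - b i • a) j : ℝ) * y j =
      a i * ∑ j, (b j : ℝ) * y j - b i * ∑ j, (a j : ℝ) * y j := by
    intro a b y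
    rw [Finset.mul_sum, Finset.mul_sum, ← Finset.sum_sub_distrib]
    refine Finset.sum_congr rfl fun j _ => ?_
    simp only [Finsupp.coe_sub, Finsupp.coe_smul, Pi.sub_apply, Pi.smul_apply, smul_eq_mul]
    push_cast
    ring
  -- The combination `a i • b - b i • a` has integer coefficients, positive multipliers `a i` and
  -- `-b i`, and vanishing coordinate at `i`.
  refine isRationalPolyhedralCone_iff.2 ⟨A.filter (fun a => a i = 0) ∪
    Finset.image₂ (fun a b => a i • b - b i • a) (A.filter fun a => 0 < a i)
      (A.filter fun a => a i < 0), ?_⟩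
  ext y
  simp only [Set.mem_ofPred_eq, Finset.mem_union, Finset.mem_filter, Finset.mem_image₂]
  constructor
  · rintro ⟨t, ht⟩ c (⟨hc, hc0⟩ | ⟨a, ⟨ha, hai⟩, b, ⟨hb, hbi⟩, rfl⟩)
    · have := ht c hc
      rwa [hL, hc0, Int.cast_zero, zero_mul, add_zero] at this
    · rw [hcomb]
      have h1 := ht a ha
      have h2 := ht b hb
      rw [hL] at h1 h2
      have hai' : (0 : ℝ) < a i := by exact_mod_cast hai
      have hbi' : (b i : ℝ) < 0 := by exact_mod_cast hbi
      have h3 := mul_nonneg hai'.le h2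
      have h4 := mul_nonneg (neg_nonneg.2 hbi'.le) h1
      linarith
  · intro hy
    -- `u` is the shift of the coordinate `i`. Inequalities with `a i > 0` bound it from below,
    -- those with `a i < 0` from above.
    obtain ⟨u, hu1, hu2⟩ := exists_between_finset (A.filter fun a => 0 < a i)
      (A.filter fun a => a i < 0) (fun a => -(∑ j, (a j : ℝ) * y j) / a i)
      (fun b => (∑ j, (b j : ℝ) * y j) / (-b i)) (by
        intro a ha b hb
        rw [Finset.mem_filter] at ha hb
        have h1 := hy _ (Or.inr ⟨a, ha, b, hb, rfl⟩)
        rw [hcomb] at h1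
        have hai' : (0 : ℝ) < a i := by exact_mod_cast ha.2
        have hbi' : (b i : ℝ) < 0 := by exact_mod_cast hb.2
        rw [div_le_div_iff₀ hai' (by linarith)]
        linarith)
    refine ⟨y i + u, fun a ha => ?_⟩
    rw [hL, add_sub_cancel_left]
    rcases lt_trichotomy (a i) 0 with hai | hai | hai
    · have hai' : (a i : ℝ) < 0 := by exact_mod_cast hai
      have := hu2 a (Finset.mem_filter.2 ⟨ha, hai⟩)
      rw [le_div_iff₀ (by linarith)] at this
      linarith
    · have := hy a (Or.inl ⟨ha, hai⟩)
      rw [hai]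
      simpa using this
    · have hai' : (0 : ℝ) < a i := by exact_mod_cast hai
      have := hu1 a (Finset.mem_filter.2 ⟨ha, hai⟩)
      rw [div_le_iff₀ hai'] at this
      linarith

/-- Eliminated coordinates stay as free dummies, so the ambient space is the same throughout the
induction. -/
theorem IsRationalPolyhedralCone.eliminate_finset {C : Set (ι → ℝ)}
    (h : IsRationalPolyhedralCone C) (s : Finset ι) :
    IsRationalPolyhedralCone {y | ∃ z ∈ C, ∀ i ∉ s, z i = y i} := by
  classical
  induction s using Finset.induction_on with
  | empty =>
    convert h using 1
    ext y
    simp only [Set.mem_ofPred_eq, Finset.notMem_empty, not_false_eq_true, forall_const]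
    constructor
    · rintro ⟨z, hz, hzy⟩
      rwa [← funext hzy]
    · exact fun hy => ⟨y, hy, fun _ => rfl⟩
  | insert i s hi ih =>
    convert ih.eliminate i using 1
    ext y
    simp only [Set.mem_ofPred_eq, Finset.mem_insert, not_or, and_imp]
    constructor
    · rintro ⟨z, hz, hzy⟩
      refine ⟨z i, z, hz, fun j hj => ?_⟩
      by_cases hji : j = i
      · rw [hji, Function.update_self]
      · rw [Function.update_of_ne hji, hzy j hji hj]
    · rintro ⟨t, z, hz, hzy⟩
      refine ⟨z, hz, fun j hji hj => ?_⟩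
      rw [hzy j hj, Function.update_of_ne hji]

/-- Coordinate projections of rational polyhedral cones are rational polyhedral cones. -/
theorem IsRationalPolyhedralCone.image_comp {κ : Type*} [Fintype κ] {e : κ → ι}
    (he : Function.Injective e) {C : Set (ι → ℝ)} (h : IsRationalPolyhedralCone C) :
    IsRationalPolyhedralCone ((fun z k => z (e k)) '' C) := by
  classical
  -- With all coordinates outside the range of `e` eliminated, their values are irrelevant and the
  -- inequalities may be read off on the extension by zero.
  obtain ⟨A, hA⟩ := isRationalPolyhedralCone_iff.1
    (h.eliminate_finset (Finset.univ.filter fun i => i ∉ Set.range e))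
  refine isRationalPolyhedralCone_iff.2
    ⟨A.image fun a => a.comapDomain e he.injOn, ?_⟩
  have hsum : ∀ (a : ι →₀ ℤ) (x : κ → ℝ), ∑ k, (a.comapDomain e he.injOn k : ℝ) * x k =
      ∑ i, (a i : ℝ) * Function.extend e x 0 i := by
    intro a x
    refine Fintype.sum_of_injective e he _ _ (fun i hi => ?_) fun k => ?_
    · rw [Function.extend_apply' _ _ _ (by simpa using hi)]
      simp
    · rw [he.extend_apply, Finsupp.comapDomain_apply]
  ext x
  simp only [Set.mem_ofPred_eq, Finset.forall_mem_image, hsum]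
  have hx : Function.extend e x 0 ∈ {y | ∃ z ∈ C, ∀ i ∉ Finset.univ.filter
      fun i => i ∉ Set.range e, z i = y i} ↔ ∀ a ∈ A,
        0 ≤ ∑ i, (a i : ℝ) * Function.extend e x 0 i := by
    rw [hA]
    rfl
  rw [← hx]
  simp only [Set.mem_ofPred_eq, Finset.mem_filter, Finset.mem_univ, true_and, not_not,
    Set.mem_range, forall_exists_index, forall_apply_eq_imp_iff, he.extend_apply, Set.mem_image,
    funext_iff]

/-- A tropicalization lies in every rational polyhedral cone that contains the logarithms. -/
theorem trop_subset {S C : Set (ι → ℝ)} (hC : IsRationalPolyhedralCone C)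
    (h : ∀ p ∈ S, (∀ i, 0 < p i) → (fun i => Real.log (p i)) ∈ C) : trop S ⊆ C := by
  rintro y ⟨τ, p, hτ, -, hp, hy⟩
  -- The logarithm to base `1 / τ k` is a nonnegative multiple of the natural one, so the sequence
  -- stays in the closed cone.
  refine hC.isClosed.mem_of_tendsto hy (Eventually.of_forall fun k => ?_)
  have hlog : 0 ≤ Real.log (1 / τ k) :=
    Real.log_nonneg (by rw [le_div_iff₀ (hτ k).1]; linarith [(hτ k).2])
  have := hC.smul_mem (inv_nonneg.2 hlog) (h (p k) (hp k).1 (hp k).2)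
  convert this using 1
  funext i
  simp only [Real.logb, Pi.smul_apply, smul_eq_mul]
  rw [div_eq_inv_mul]

end Trop

/-! ### Tropicalization of the profiles -/

namespace GraphSos

theorem isRationalPolyhedralCone_proj_logCone {d : ℕ} (ℓ : ℕ) {U : Set PLGraph} (hU : U ⊆ V d) :
    Trop.IsRationalPolyhedralCone (proj hU '' logCone d ℓ) := by
  have : Fintype U := ((V_finite d).subset hU).fintype
  exact (isRationalPolyhedralCone_logCone d ℓ).image_comp (e := Set.inclusion hU)
    (Set.inclusion_injective hU)

/-- One inclusion projects approximating sequences. In the other, only the coordinates in `U` of a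
lift are known to be positive, so its logarithm has to be completed by `exists_mem_logCone`. -/
theorem trop_projSosProfile {d ℓ : ℕ} (hℓ : 2 * d ≤ ℓ) {U : Set PLGraph} (hU : U ⊆ V d) :
    Trop.trop (projSosProfile hU) = proj hU '' logCone d ℓ := by
  have : Fintype U := ((V_finite d).subset hU).fintype
  refine Set.Subset.antisymm (Trop.trop_subset (isRationalPolyhedralCone_proj_logCone ℓ hU) ?_) ?_
  · rintro _ ⟨v, hv, rfl⟩ hpos
    obtain ⟨y, hy, hyv⟩ := exists_mem_logCone (sosProfile_subset_nonnegMinors₂ d ℓ hv)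
    exact ⟨y, hy, funext fun C => hyv _ (hpos C)⟩
  · rintro _ ⟨y, hy, rfl⟩
    obtain ⟨τ, p, hτ, hτ0, hp, hlim⟩ := logCone_subset_trop hℓ hy
    exact ⟨τ, fun k => proj hU (p k), hτ, hτ0,
      fun k => ⟨⟨p k, (hp k).1, rfl⟩, fun C => (hp k).2 _⟩,
      ((continuous_proj hU).tendsto y).comp hlim⟩

theorem trop_sosProfile {d ℓ : ℕ} (hℓ : 2 * d ≤ ℓ) :
    Trop.trop (sosProfile d) = logCone d ℓ := by
  refine Set.Subset.antisymm (Trop.trop_subset (isRationalPolyhedralCone_logCone d ℓ) ?_)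
    (logCone_subset_trop hℓ)
  intro v hv hpos
  rw [← logSet_nonnegMinors₂]
  exact ⟨v, ⟨sosProfile_subset_nonnegMinors₂ d ℓ hv, hpos⟩, rfl⟩

end GraphSos

open Trop GraphSos in
theorem theorem4 (d ℓ : ℕ) (hℓ : 2 * d ≤ ℓ) :
    (V d).Finite ∧
    IsBasicClosedSemialgebraic (sosProfile d) ∧
    graphProfile (V d) ⊆ sosProfile d ∧
    trop (sosProfile d) = logSet (nonnegMinors₂ (reducedMomentMatrix d ℓ)) ∧
    IsRationalPolyhedralCone (logSet (nonnegMinors₂ (reducedMomentMatrix d ℓ))) ∧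
    ∀ (U : Set PLGraph) (hU : U ⊆ V d),
      graphProfile U ⊆ projSosProfile hU ∧
      trop (projSosProfile hU) =
        proj hU '' logSet (nonnegMinors₂ (reducedMomentMatrix d ℓ)) ∧
      IsRationalPolyhedralCone (trop (projSosProfile hU)) := by
  refine ⟨V_finite d, isBasicClosedSemialgebraic_sosProfile d, graphProfile_subset_sosProfile d, ?_,
    ?_, fun U hU => ⟨graphProfile_subset_projSosProfile hU, ?_, ?_⟩⟩
  · rw [logSet_nonnegMinors₂, trop_sosProfile hℓ]
  · rw [logSet_nonnegMinors₂]
    exact isRationalPolyhedralCone_logCone d ℓ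
  · rw [logSet_nonnegMinors₂, trop_projSosProfile hℓ hU]
  · rw [trop_projSosProfile hℓ hU]
    exact isRationalPolyhedralCone_proj_logCone ℓ hU
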